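/- Let $X$ be a Polish space with a bornology (for instance the metrically bounded sets), let $\mathcal B_0$ be the ring of bounded Borel sets, and let $B_1\subseteq B_2\subseteq\cdots$ in $\mathcal B_0$ have union $X$ and be such that every $B\in\mathcal B_0$ is contained in some $B_n$. Let $\mathcal M^{\cdot\cdot}$ be the set of measures on $X$ with finite integer values on $\mathcal B_0$, with the $\sigma$-field $\mathcal F$ generated by the maps $\zeta_B(\mu)=\mu(B)$, $B\in\mathcal B_0$; a point process is a probability measure on $\mathcal M^{\cdot\cdot}$. Let $\xi_B(\mu)=\#\{x\in B:\mu(\{x\})>0\}$, and let $\mathcal G_B$ be the $\sigma$-field generated by $\xi_B$ and the increments $\zeta_{B'}-\zeta_B$, $B\subseteq B'\in\mathcal B_0$; put $\mathcal G_\infty=\bigcap_n\mathcal G_{B_n}$. Let $z\in(0,1)$ and let $\rho$ be a diffuse measure on $X$ that is finite on $\mathcal B_0$, with $\rho(X)=\infty$. For $0\le w<\infty$ the Pólya sum process $\mathrm{Poy}_{z,w\rho}$ is the (existing and unique) point process $P$ with $$\iint h(x,\mu)\,\mu(dx)P(d\mu)=z\iint h(x,\mu+\delta_x)\,(w\rho+\mu)(dx)P(d\mu)$$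 for all measurable $h\ge 0$. For $B\in\mathcal B_0$ let $\pi_B(\mu,\cdot)$ be the law of $\nu_B+\mu_{B^c}$, where $\nu$ has the law $\mathrm{Poy}_{z,\rho}(\,\cdot\mid\xi_B=\xi_B(\mu))$ and subscripts denote restrictions (if $\xi_B=\xi_B(\mu)$ has probability zero, which happens only if $\rho(B)=0$ and $\xi_B(\mu)\neq0$, take $\nu\sim\mathrm{Poy}_{z,\rho}$ instead). Let $C(\pi)$ be the set of point processes $P$ such that $P(A\mid\mathcal G_B)=\pi_B(\cdot,A)$ $P$-a.s. for all $B\in\mathcal B_0$ and $A\in\mathcal F$. Then: 1. $(\pi_B)$ is a local specification: $\mathcal G_B\subseteq\mathcal F$ decreases as $B$ increases; the $\pi_B(\mu,\cdot)$ are probability measures; $\pi_B\pi_{B'}=\pi_B$ for $B'\subseteq B$; $\pi_B(\cdot,A)$ is $\mathcal G_B$-measurable for $A\in\mathcal F$; and for $\mathcal G_B$-measurable $f\ge0$, $\pi_Bf(\mu)=f(\mu)$ at every $\mu$ for which $\mathrm{Poy}_{z,\rho}(\xi_B=\xi_B(\mu))>0$. 2. $\mathcal G_\infty$ is H-sufficient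 for $C(\pi)$: there is a Markov kernel $Q$ from $(\mathcal M^{\cdot\cdot},\mathcal G_\infty)$ to $(\mathcal M^{\cdot\cdot},\mathcal F)$ such that for every $P\in C(\pi)$, $P(A\mid\mathcal G_\infty)=Q_\mu(A)$ for $P$-a.e. $\mu$, for each $A\in\mathcal F$, and $Q_\mu\in C(\pi)$ for $P$-a.e. $\mu$. 3. $C(\pi)=\bigl\{\int\mathrm{Poy}_{z,w\rho}\,V(dw): V\text{ a probability measure on }[0,\infty)\bigr\}$. 4. The set of extreme points of $C(\pi)$ is $\{\mathrm{Poy}_{z,w\rho}:0\le w<\infty\}$. -/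

import Mathlib

open MeasureTheory ProbabilityTheory Set Bornology
open scoped ENNReal NNReal

noncomputable section

namespace PolyaSum

section Config

variable (X : Type*) [MeasurableSpace X] [Bornology X]

/-- The ring of bounded Borel sets of `X`, ordered by inclusion. -/
abbrev BoundedBorel : Type _ := {B : Set X // IsBounded B ∧ MeasurableSet B}

/-- Locally finite point measures: measures with finite integer values on bounded Borel sets. -/
@[ext]
structure PointMeasure where
  /-- the underlying measure -/
  toMeasure : Measure X
  exists_nat : ∀ B : BoundedBorel X, ∃ n : ℕ, toMeasure B.1 = n

variable {X}

/-- The evaluation `ζ_B`, the number of points in `B` counted with multiplicity. -/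
def zeta (B : BoundedBorel X) (μ : PointMeasure X) : ℝ≥0∞ := μ.toMeasure B.1

/-- The number `ξ_B` of occupied sites in `B`. -/
def xi (B : BoundedBorel X) (μ : PointMeasure X) : ℕ∞ :=
  {x | x ∈ B.1 ∧ μ.toMeasure {x} ≠ 0}.encard

/-- The σ-field generated by the evaluations `ζ_B`, `B` bounded Borel. -/
instance : MeasurableSpace (PointMeasure X) :=
  ⨆ B : BoundedBorel X, MeasurableSpace.comap (zeta B) inferInstance

/-- The configuration `μ + δ_x`. -/
def PointMeasure.addPoint (μ : PointMeasure X) (x : X) : PointMeasure X where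
  toMeasure := μ.toMeasure + Measure.dirac x
  exists_nat B := by
    classical
    obtain ⟨n, hn⟩ := μ.exists_nat B
    by_cases hx : x ∈ B.1
    · exact ⟨n + 1, by simp [hn, Measure.dirac_apply' x B.2.2, hx]⟩
    · exact ⟨n, by simp [hn, Measure.dirac_apply' x B.2.2, hx]⟩

/-- The configuration `ν_B + μ_{Bᶜ}`, equal to `ν` inside `B` and to `μ` outside `B`. -/
def glue (B : BoundedBorel X) (ν μ : PointMeasure X) : PointMeasure X where
  toMeasure := ν.toMeasure.restrict B.1 + μ.toMeasure.restrict B.1ᶜ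
  exists_nat C := by
    obtain ⟨n, hn⟩ := ν.exists_nat
      ⟨C.1 ∩ B.1, C.2.1.subset inter_subset_left, C.2.2.inter B.2.2⟩
    obtain ⟨m, hm⟩ := μ.exists_nat
      ⟨C.1 ∩ B.1ᶜ, C.2.1.subset inter_subset_left, C.2.2.inter B.2.2.compl⟩
    exact ⟨n + m, by simp only [Measure.add_apply, Measure.restrict_apply C.2.2, hn, hm,
      Nat.cast_add]⟩

/-- `P` is a point process solving the Campbell equation
`C_P(h) = z ∫∫ h(x, μ + δ_x) (ρ + μ)(dx) P(dμ)`, where `C_P(h) = ∫∫ h(x, μ) μ(dx) P(dμ)`. -/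
def IsPolyaSumProcess (z : ℝ) (ρ : Measure X) (P : Measure (PointMeasure X)) : Prop :=
  IsProbabilityMeasure P ∧
    ∀ h : X × PointMeasure X → ℝ≥0∞, Measurable h →
      ∫⁻ μ, ∫⁻ x, h (x, μ) ∂μ.toMeasure ∂P =
        ENNReal.ofReal z * ∫⁻ μ, ∫⁻ x, h (x, μ.addPoint x) ∂(ρ + μ.toMeasure) ∂P

open Classical in
/-- The Pólya sum process `Poy_{z,ρ}`: the solution of the Campbell equation above. -/
def polya (z : ℝ) (ρ : Measure X) : Measure (PointMeasure X) :=
  if h : ∃ P, IsPolyaSumProcess z ρ P then h.choose else 0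

/-- The σ-field of outside events, generated by the increments `ζ_{B'} - ζ_B`, `B ⊆ B'`. -/
abbrev outside (B : BoundedBorel X) : MeasurableSpace (PointMeasure X) :=
  ⨆ B' : {B' : BoundedBorel X // B.1 ⊆ B'.1},
    MeasurableSpace.comap (fun μ => zeta B'.1 μ - zeta B μ) inferInstance

/-- The σ-field generated by the outside events of `B` and by `ξ_B`. -/
abbrev sites (B : BoundedBorel X) : MeasurableSpace (PointMeasure X) :=
  outside B ⊔ MeasurableSpace.comap (xi B) ⊤

open Classical in
/-- The law `Poy_{z,ρ}( · | ξ_B = n)`. When `ξ_B = n` has probability zero (for diffuse `ρ`: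
when `ρ(B) = 0` and `n ≠ 0`) the conditioning is dropped. -/
def condLaw (z : ℝ) (ρ : Measure X) (B : BoundedBorel X) (n : ℕ∞) : Measure (PointMeasure X) :=
  if polya z ρ {ν | xi B ν = n} = 0 then polya z ρ else cond (polya z ρ) {ν | xi B ν = n}

/-- The kernel `π_B(μ, · ) = Poy_{z,ρ}( · | 𝒢_B)(μ)`, in the version
`π_B(μ, φ) = ∫ φ(ν_B + μ_{Bᶜ}) Poy_{z,ρ}(dν | ξ_B = ξ_B μ)`. -/
def siteKernel (z : ℝ) (ρ : Measure X) (B : BoundedBorel X) (μ : PointMeasure X) :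
    Measure (PointMeasure X) :=
  (condLaw z ρ B (xi B μ)).map (fun ν => glue B ν μ)

/-- `π` is a local specification for the decreasing family `𝒢`, where `π_B f = f` for
`𝒢_B`-measurable `f` is required at the configurations outside `N B`. -/
structure IsLocalSpecification (𝒢 : BoundedBorel X → MeasurableSpace (PointMeasure X))
    (π : BoundedBorel X → PointMeasure X → Measure (PointMeasure X))
    (N : BoundedBorel X → Set (PointMeasure X)) : Prop where
  le : ∀ B, 𝒢 B ≤ (inferInstance : MeasurableSpace (PointMeasure X))
  antitone : ∀ B B', B'.1 ⊆ B.1 → 𝒢 B ≤ 𝒢 B'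
  markov : ∀ B μ, IsProbabilityMeasure (π B μ)
  consistent : ∀ B B', B'.1 ⊆ B.1 → ∀ μ A, MeasurableSet A →
    ∫⁻ ν, π B' ν A ∂(π B μ) = π B μ A
  measurable : ∀ B A, MeasurableSet A → Measurable[𝒢 B] (fun μ => π B μ A)
  proper : ∀ B (f : PointMeasure X → ℝ≥0∞), Measurable[𝒢 B] f →
    ∀ μ, μ ∉ N B → ∫⁻ ν, f ν ∂(π B μ) = f μ

/-- The set `C(π)` of point processes `P` with `P( · | 𝒢_B) = π_B` `P`-a.s. for all `B`. -/
def invariantLaws (𝒢 : BoundedBorel X → MeasurableSpace (PointMeasure X))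
    (π : BoundedBorel X → PointMeasure X → Measure (PointMeasure X)) :
    Set (Measure (PointMeasure X)) :=
  {P | IsProbabilityMeasure P ∧ ∀ B : BoundedBorel X, ∀ A, MeasurableSet A →
    P[A.indicator (fun _ => (1 : ℝ)) | 𝒢 B] =ᵐ[P] fun μ => (π B μ).real A}

end Config

/-- `𝒯` is an H-sufficient statistic for the set `C` of laws: the elements of `C` have a common
conditional distribution `Q` given `𝒯`, and `Q_ω ∈ C` for `P`-a.e. `ω`, for each `P ∈ C`. -/
def IsHSufficient {Ω : Type*} (𝒯 : MeasurableSpace Ω) [mΩ : MeasurableSpace Ω]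
    (C : Set (Measure Ω)) : Prop :=
  𝒯 ≤ mΩ ∧
  ∃ Q : @Kernel Ω Ω 𝒯 mΩ, (∀ ω, IsProbabilityMeasure (Q ω)) ∧
    ∀ P ∈ C,
      (∀ A, MeasurableSet A →
        P[A.indicator (fun _ => (1 : ℝ)) | 𝒯] =ᵐ[P] fun ω => (Q ω).real A) ∧
      ∀ᵐ ω ∂P, Q ω ∈ C

end PolyaSum

end

set_option linter.unusedSectionVars false

noncomputable section

namespace PolyaSum

/-! Adding a point at an occupied site only raises its multiplicity, whereas a point drawn from the
diffuse measure `ρ` almost surely opens a new site. Splitting the Campbell equation by multiplicity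
therefore gives a Mecke formula for sites (`campbell_sites`): sites of multiplicity `j + 1` appear
with intensity `z^(j+1)/(j+1) ρ`. Iterating it, a solution consists inside a bounded `B` of a
Poisson number, of mean `siteRate z * ρ B`, of i.i.d. clusters (a uniformly placed site with a
logarithmic multiplicity), independent of the outside of `B` (`lintegral_xi_eq`). This gives
uniqueness; existence comes from superposing independent local processes over a partition
(`cellPolya`).

Replacing `ρ` by `w • ρ` multiplies the unnormalized law of `k` clusters by `w ^ k` only
(`clusters_smul`). Hence the law in `B` given the number of sites does not depend on `w`, and all
`Poy_{z,wρ}`, together with their mixtures, belong to `C(π)`.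

Conversely let `P ∈ C(π)`. Under `π_{K n}(μ, ·)` the number of sites in `B` is binomial with `ξ_{K
n}(μ)` trials and success probability `ρ(B)/ρ(K n)`, which tends to zero because `ρ(X) = ∞`.
Backward martingale convergence makes the void probabilities converge `P`-a.s. A zero limit would
send every probability of `k` sites to zero, which is impossible since `ξ_B` is finite; so the
density of sites in `K n` converges to a finite tail measurable `W` (`ae_tendsto_density`), and the
binomial laws tend to Poisson laws. As the law in `B` given the number of sites is prescribed, `P(·
| 𝒢_∞) = Poy_{z,Wρ}` (`measure_inter_tail`).

This yields H-sufficiency, and the mixture representation with `V` the law of `W`. An extreme law is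
trivial on the tail, so its `W` is constant. In the other direction, void probabilities show that a
Pólya sum process is a mixture of Pólya sum processes only trivially (`ae_eq_of_polya_eq_mixture`),
hence extreme. -/

/-- The bounded Borel sets contain an increasing cofinal sequence exhausting the space. -/
class SigmaBounded (X : Type*) [MeasurableSpace X] [Bornology X] : Prop where
  exists_exhaustion : ∃ K : ℕ → BoundedBorel X, (∀ m n, m ≤ n → (K m).1 ⊆ (K n).1) ∧
    ⋃ n, (K n).1 = univ ∧ ∀ B : BoundedBorel X, ∃ n, B.1 ⊆ (K n).1

/-! ### Configurations: algebra, measurability, atoms and occupied sites. -/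

section Basic

variable {X : Type*} [MeasurableSpace X] [Bornology X]

namespace BoundedBorel

/-- The part of a bounded Borel set inside a Borel set. -/
def inter (B : BoundedBorel X) (S : Set X) (hS : MeasurableSet S) : BoundedBorel X :=
  ⟨B.1 ∩ S, B.2.1.subset inter_subset_left, B.2.2.inter hS⟩

/-- The union of two bounded Borel sets. -/
def union (B C : BoundedBorel X) : BoundedBorel X :=
  ⟨B.1 ∪ C.1, B.2.1.union C.2.1, B.2.2.union C.2.2⟩

/-- A fixed increasing cofinal sequence of bounded Borel sets. -/
def exhaust (X : Type*) [MeasurableSpace X] [Bornology X] [SigmaBounded X] (n : ℕ) :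
    BoundedBorel X := (SigmaBounded.exists_exhaustion (X := X)).choose n

variable [SigmaBounded X]

lemma exhaust_mono {m n : ℕ} (h : m ≤ n) : (exhaust X m).1 ⊆ (exhaust X n).1 :=
  (SigmaBounded.exists_exhaustion (X := X)).choose_spec.1 m n h

variable (X) in
lemma iUnion_exhaust : ⋃ n, (exhaust X n).1 = univ :=
  (SigmaBounded.exists_exhaustion (X := X)).choose_spec.2.1

lemma exists_subset_exhaust (B : BoundedBorel X) : ∃ n, B.1 ⊆ (exhaust X n).1 :=
  (SigmaBounded.exists_exhaustion (X := X)).choose_spec.2.2 B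

/-- A partition of the space into bounded Borel sets. -/
def cell (X : Type*) [MeasurableSpace X] [Bornology X] [SigmaBounded X] (n : ℕ) :
    BoundedBorel X :=
  ⟨disjointed (fun n => (exhaust X n).1) n, (exhaust X n).2.1.subset (disjointed_subset _ n),
    MeasurableSet.disjointed (fun n => (exhaust X n).2.2) n⟩

lemma cell_disjoint : Pairwise (Function.onFun Disjoint fun n => (cell X n).1) :=
  disjoint_disjointed _

variable (X) in
lemma iUnion_cell : ⋃ n, (cell X n).1 = univ := by
  rw [← iUnion_exhaust X]; exact iUnion_disjointed

lemma disjoint_cell {m n : ℕ} (h : m < n) : Disjoint (exhaust X m).1 (cell X n).1 := by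
  refine Disjoint.mono_left (le_partialSups (fun n => (exhaust X n).1) m) ?_
  rw [partialSups_eq_accumulate, Set.disjoint_left]
  rintro x hx hx'
  obtain ⟨k, hk, hxk⟩ := Set.mem_accumulate.1 hx
  obtain ⟨y, hy⟩ : ∃ y : ℕ, n = y + 1 := ⟨n - 1, by omega⟩
  subst hy
  have hy : (cell X (y + 1)).1 = (exhaust X (y + 1)).1 \
      partialSups (fun n => (exhaust X n).1) y := disjointed_add_one (fun n => (exhaust X n).1) y
  rw [hy] at hx'
  exact hx'.2 (le_partialSups_of_le (fun n => (exhaust X n).1) (by omega : k ≤ y) hxk)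

end BoundedBorel

open BoundedBorel

namespace PointMeasure

lemma lt_top (μ : PointMeasure X) (B : BoundedBorel X) : μ.toMeasure B.1 < ∞ := by
  obtain ⟨n, hn⟩ := μ.exists_nat B
  simp [hn]

instance : Zero (PointMeasure X) := ⟨⟨0, fun _ => ⟨0, by simp⟩⟩⟩

instance : Add (PointMeasure X) := ⟨fun μ ν => ⟨μ.toMeasure + ν.toMeasure, fun B => by
  obtain ⟨n, hn⟩ := μ.exists_nat B
  obtain ⟨m, hm⟩ := ν.exists_nat B
  exact ⟨n + m, by simp [hn, hm]⟩⟩⟩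

@[simp] lemma toMeasure_zero : (0 : PointMeasure X).toMeasure = 0 := rfl

@[simp] lemma toMeasure_add (μ ν : PointMeasure X) :
    (μ + ν).toMeasure = μ.toMeasure + ν.toMeasure := rfl

instance : AddCommMonoid (PointMeasure X) where
  add_assoc μ ν κ := by ext1; simp [add_assoc]
  zero_add μ := by ext1; simp
  add_zero μ := by ext1; simp
  add_comm μ ν := by ext1; simp [add_comm]
  nsmul := nsmulRec

/-- The part of a configuration inside a Borel set. -/
def restrict (μ : PointMeasure X) (S : Set X) (hS : MeasurableSet S) : PointMeasure X where
  toMeasure := μ.toMeasure.restrict S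
  exists_nat B := by
    rw [Measure.restrict_apply B.2.2]
    exact μ.exists_nat (B.inter S hS)

/-- The configuration of `j` points at `x`. -/
def site (j : ℕ) (x : X) : PointMeasure X where
  toMeasure := (j : ℝ≥0∞) • Measure.dirac x
  exists_nat B := by
    classical
    by_cases hx : x ∈ B.1
    · exact ⟨j, by simp [Measure.dirac_apply' x B.2.2, hx]⟩
    · exact ⟨0, by simp [Measure.dirac_apply' x B.2.2, hx]⟩

lemma toMeasure_site (j : ℕ) (x : X) :
    (site j x : PointMeasure X).toMeasure = (j : ℝ≥0∞) • Measure.dirac x := rfl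

lemma toMeasure_restrict (μ : PointMeasure X) {S : Set X} (hS : MeasurableSet S) :
    (μ.restrict S hS).toMeasure = μ.toMeasure.restrict S := rfl

lemma addPoint_eq (μ : PointMeasure X) (x : X) : μ.addPoint x = site 1 x + μ := by
  ext1
  simp [addPoint, toMeasure_site, add_comm]

lemma site_add (i j : ℕ) (x : X) : (site (i + j) x : PointMeasure X) = site i x + site j x := by
  ext1
  simp [toMeasure_site, add_smul]

lemma glue_eq (B : BoundedBorel X) (ν μ : PointMeasure X) :
    glue B ν μ = ν.restrict B.1 B.2.2 + μ.restrict B.1ᶜ B.2.2.compl := rfl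

lemma restrict_add (μ ν : PointMeasure X) {S : Set X} (hS : MeasurableSet S) :
    (μ + ν).restrict S hS = μ.restrict S hS + ν.restrict S hS := by
  ext1; simp [toMeasure_restrict]

lemma restrict_restrict (μ : PointMeasure X) {S T : Set X} (hS : MeasurableSet S)
    (hT : MeasurableSet T) : (μ.restrict S hS).restrict T hT = μ.restrict (T ∩ S) (hT.inter hS) := by
  ext1; simp [toMeasure_restrict, Measure.restrict_restrict hT]

lemma restrict_congr (μ : PointMeasure X) {S T : Set X} (hS : MeasurableSet S) (h : S = T) :
    μ.restrict S hS = μ.restrict T (h ▸ hS) := by subst h; rfl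

lemma restrict_eq_self {μ : PointMeasure X} {S : Set X} (hS : MeasurableSet S)
    (h : μ.toMeasure Sᶜ = 0) : μ.restrict S hS = μ := by
  ext1
  rw [toMeasure_restrict, Measure.restrict_eq_self_of_ae_mem]
  exact h

lemma restrict_eq_zero {μ : PointMeasure X} {S : Set X} (hS : MeasurableSet S)
    (h : μ.toMeasure S = 0) : μ.restrict S hS = 0 := by
  ext1
  rw [toMeasure_restrict, Measure.restrict_eq_zero.2 h, toMeasure_zero]

lemma restrict_add_restrict_compl (μ : PointMeasure X) {S : Set X} (hS : MeasurableSet S) :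
    μ.restrict S hS + μ.restrict Sᶜ hS.compl = μ := by
  ext1; simp [toMeasure_restrict, Measure.restrict_add_restrict_compl hS]

end PointMeasure

open PointMeasure

lemma measurable_zeta (B : BoundedBorel X) : Measurable (zeta (X := X) B) := by
  rw [measurable_iff_comap_le]
  exact le_iSup (fun B : BoundedBorel X => MeasurableSpace.comap (zeta B) inferInstance) B

lemma measurable_pointMeasure {α : Type*} [MeasurableSpace α] {f : α → PointMeasure X}
    (h : ∀ B : BoundedBorel X, Measurable fun a => (f a).toMeasure B.1) : Measurable f := by
  rw [measurable_iff_comap_le]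
  unfold instMeasurableSpacePointMeasure
  rw [MeasurableSpace.comap_iSup]
  refine iSup_le fun B => ?_
  rw [MeasurableSpace.comap_comp, ← measurable_iff_comap_le]
  exact h B

section

variable [SigmaBounded X]

lemma measure_eq_iSup_exhaust (m : Measure X) (S : Set X) :
    m S = ⨆ n, m (S ∩ (exhaust X n).1) := by
  rw [← Monotone.measure_iUnion (fun i j h => inter_subset_inter_right _ (exhaust_mono h)),
    ← inter_iUnion, iUnion_exhaust, inter_univ]

lemma measurable_toMeasure : Measurable (PointMeasure.toMeasure (X := X)) := by
  refine Measure.measurable_of_measurable_coe _ fun S hS => ?_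
  simp_rw [measure_eq_iSup_exhaust _ S]
  refine Measurable.iSup fun n => ?_
  rw [show S ∩ (exhaust X n).1 = ((exhaust X n).inter S hS).1 from inter_comm _ _]
  exact measurable_zeta _

lemma measurable_apply {S : Set X} (hS : MeasurableSet S) :
    Measurable fun μ : PointMeasure X => μ.toMeasure S :=
  (Measure.measurable_coe hS).comp measurable_toMeasure

instance : MeasurableAdd₂ (PointMeasure X) where
  measurable_add := measurable_pointMeasure fun B => by
    simp only [toMeasure_add, Measure.add_apply]
    exact ((measurable_apply B.2.2).comp measurable_fst).add
      ((measurable_apply B.2.2).comp measurable_snd)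

lemma measurable_restrict {S : Set X} (hS : MeasurableSet S) :
    Measurable fun μ : PointMeasure X => μ.restrict S hS := measurable_pointMeasure fun B => by
  simp only [toMeasure_restrict, Measure.restrict_apply B.2.2]
  exact measurable_apply (B.2.2.inter hS)

@[fun_prop]
lemma measurable_restrict_comp {α : Type*} [MeasurableSpace α] {f : α → PointMeasure X}
    (hf : Measurable f) {S : Set X} (hS : MeasurableSet S) :
    Measurable fun a => (f a).restrict S hS := (measurable_restrict hS).comp hf

lemma measurable_glue (B : BoundedBorel X) :
    Measurable fun p : PointMeasure X × PointMeasure X => glue B p.1 p.2 :=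
  ((measurable_restrict B.2.2).comp measurable_fst).add
    ((measurable_restrict B.2.2.compl).comp measurable_snd)

end

lemma measurable_site (j : ℕ) : Measurable (site (X := X) j) := measurable_pointMeasure fun B => by
  simp only [toMeasure_site, Measure.smul_apply, smul_eq_mul]
  exact (((Measure.measurable_coe B.2.2).comp Measure.measurable_dirac)).const_mul _

@[fun_prop]
lemma measurable_site_comp {α : Type*} [MeasurableSpace α] {f : α → X} (hf : Measurable f) (j : ℕ) :
    Measurable fun a => site (X := X) j (f a) := (measurable_site j).comp hf

section Kernel

variable [SigmaBounded X]

variable (X) in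
/-- The kernel sending a configuration to its underlying measure. -/
def pointKernel : Kernel (PointMeasure X) X := ⟨PointMeasure.toMeasure, measurable_toMeasure⟩

lemma pointKernel_apply (μ : PointMeasure X) : pointKernel X μ = μ.toMeasure := rfl

-- A configuration has finite mass on a cell, but with no bound uniform in the configuration, which
-- a finite kernel requires. Hence each cell is split further according to the number `m` of points
-- in it.
open Classical in
instance : IsSFiniteKernel (pointKernel X) := by
  have hm : ∀ n m : ℕ, MeasurableSet {μ : PointMeasure X | μ.toMeasure (cell X n).1 = m} :=
    fun n m => measurable_apply (cell X n).2.2 (measurableSet_singleton _)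
  let η : ℕ → ℕ → Kernel (PointMeasure X) X := fun n m =>
    Kernel.piecewise (hm n m) ((pointKernel X).restrict (cell X n).2.2) 0
  have hη : ∀ n m, IsFiniteKernel (η n m) := fun n m => by
    refine ⟨⟨m, by simp, fun μ => ?_⟩⟩
    simp only [η, Kernel.piecewise_apply]
    split_ifs with h
    · have : μ.toMeasure (cell X n).1 = m := h
      simp [Kernel.restrict_apply, pointKernel_apply, this]
    · simp
  have h : pointKernel X = Kernel.sum fun n => Kernel.sum (η n) := by
    ext μ S hS
    rw [Kernel.sum_apply' _ _ hS]
    have h1 : ∀ n, (Kernel.sum (η n)) μ S = μ.toMeasure (S ∩ (cell X n).1) := fun n => by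
      rw [Kernel.sum_apply' _ _ hS]
      obtain ⟨k, hk⟩ := μ.exists_nat (cell X n)
      rw [tsum_eq_single k]
      · simp [η, Kernel.piecewise_apply, hk, Kernel.restrict_apply, Measure.restrict_apply hS,
          pointKernel_apply]
      · intro b hb
        simp [η, Kernel.piecewise_apply, hk, hb.symm]
    simp_rw [h1]
    rw [← measure_iUnion _ (fun n => hS.inter (cell X n).2.2), ← inter_iUnion, iUnion_cell,
      inter_univ, pointKernel_apply]
    exact fun i j hij => (cell_disjoint hij).mono inter_subset_right inter_subset_right
  rw [h]
  infer_instance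

lemma measurable_lintegral_toMeasure {α : Type*} [MeasurableSpace α] {f : α → PointMeasure X}
    (hf : Measurable f) {h : α → X → ℝ≥0∞} (hh : Measurable (Function.uncurry h)) :
    Measurable fun a => ∫⁻ x, h a x ∂(f a).toMeasure :=
  Measurable.lintegral_kernel_prod_right (κ := (pointKernel X).comap f hf) hh

end Kernel

section Atoms

variable [StandardBorelSpace X]

lemma measurableSet_diag (X : Type*) [MeasurableSpace X] [StandardBorelSpace X] :
    MeasurableSet {p : X × X | p.1 = p.2} := by
  let := upgradeStandardBorel X
  exact isClosed_diagonal.measurableSet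

/-- The singleton `{x}` is a section of the diagonal, which is measurable in a standard Borel space;
this gives joint measurability in the point and the configuration. -/
lemma measurable_apply_singleton [SigmaBounded X] :
    Measurable fun p : X × PointMeasure X => p.2.toMeasure {p.1} := by
  have h := Kernel.measurable_kernel_prodMk_left
    (κ := (pointKernel X).comap (fun p : X × PointMeasure X => p.2) measurable_snd)
    (t := {q : (X × PointMeasure X) × X | q.1.1 = q.2})
    ((measurableSet_diag X).preimage ((measurable_fst.comp measurable_fst).prodMk measurable_snd))
  convert h using 2 with p
  simp only [Kernel.comap_apply, pointKernel_apply]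
  congr 1
  ext y
  simp [eq_comm]

/-- Sets without atoms are null for integer valued measures. -/
lemma PointMeasure.measure_eq_zero_of_forall_singleton (μ : PointMeasure X) (B : BoundedBorel X)
    (h : ∀ x ∈ B.1, μ.toMeasure {x} = 0) : μ.toMeasure B.1 = 0 := by
  obtain ⟨n, hn⟩ := μ.exists_nat B
  induction n using Nat.strong_induction_on generalizing B with
  | _ n ih =>
    rcases Nat.eq_zero_or_pos n with rfl | hpos
    · simpa using hn
    exfalso
    have hne : B.1.Nonempty := nonempty_of_measure_ne_zero (μ := μ.toMeasure)
      (by rw [hn]; exact_mod_cast hpos.ne')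
    -- If `Uᶜ` takes fewer than `n` points of `B`, it is null by induction; otherwise it takes all
    -- of them and `U` is null. So the measure on `B` is two-valued.
    have hd : ∀ U, MeasurableSet U → U ∈ ae (μ.toMeasure.restrict B.1) ∨
        Uᶜ ∈ ae (μ.toMeasure.restrict B.1) := by
      intro U hU
      obtain ⟨k, hk⟩ := μ.exists_nat (B.inter U hU)
      obtain ⟨l, hl⟩ := μ.exists_nat (B.inter Uᶜ hU.compl)
      have hkl : k + l = n := by
        have := measure_inter_add_sdiff (μ := μ.toMeasure) B.1 hU
        rw [hn, sdiff_eq] at this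
        simp only [inter] at hk hl
        rw [hk, hl] at this
        exact_mod_cast this
      simp only [mem_ae_iff, Measure.restrict_apply hU, Measure.restrict_apply hU.compl, compl_compl]
      rw [inter_comm, inter_comm U]
      by_cases hln : l < n
      · exact Or.inl (ih l hln (B.inter Uᶜ hU.compl) (fun x hx => h x hx.1) hl)
      · have : k = 0 := by omega
        right
        simpa [this, inter] using hk
    -- On a countably separated space a two-valued measure sits at a single point, which would be an
    -- atom in `B`.
    obtain ⟨a, ha, hal⟩ :=
      Filter.exists_mem_singleton_mem_of_mem_of_nonempty_of_forall_separating MeasurableSet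
        (l := ae (μ.toMeasure.restrict B.1)) (self_mem_ae_restrict B.2.2) hne hd
    rw [mem_ae_iff, Measure.restrict_apply (measurableSet_singleton a).compl] at hal
    have h1 : μ.toMeasure B.1 = 0 := by
      rw [← measure_inter_add_sdiff (μ := μ.toMeasure) B.1 (measurableSet_singleton a), sdiff_eq,
        inter_comm _ {a}ᶜ, hal, add_zero]
      exact measure_mono_null inter_subset_right (h a ha)
    rw [hn] at h1
    exact hpos.ne' (by exact_mod_cast h1)

lemma PointMeasure.exists_nat_singleton [SigmaBounded X] (μ : PointMeasure X) (x : X) :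
    ∃ n : ℕ, μ.toMeasure {x} = n := by
  obtain ⟨n, hn⟩ := mem_iUnion.1 ((iUnion_exhaust X).symm ▸ mem_univ x)
  obtain ⟨k, hk⟩ := μ.exists_nat ((exhaust X n).inter {x} (measurableSet_singleton x))
  refine ⟨k, ?_⟩
  rw [← hk]
  simp [inter, inter_eq_self_of_subset_right (singleton_subset_iff.2 hn)]

variable [SigmaBounded X]

/-- The occupied sites of a configuration in a bounded set. -/
lemma PointMeasure.finite_atoms (μ : PointMeasure X) (B : BoundedBorel X) :
    {x | x ∈ B.1 ∧ μ.toMeasure {x} ≠ 0}.Finite := by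
  have h := Measure.finite_const_le_meas_of_disjoint_iUnion (μ.toMeasure.restrict B.1)
    (ε := 1) one_pos (As := fun x : X => {x}) (fun x => measurableSet_singleton x)
    (fun x y hxy => by simpa using hxy) (by
      refine ((measure_mono (subset_univ _)).trans_lt ?_).ne
      rw [Measure.restrict_apply_univ]; exact μ.lt_top B)
  refine h.subset fun x hx => ?_
  obtain ⟨k, hk⟩ := μ.exists_nat_singleton x
  have : k ≠ 0 := by rintro rfl; exact hx.2 (by simpa using hk)
  rw [mem_ofPred_eq, Measure.restrict_apply (measurableSet_singleton x),
    inter_eq_self_of_subset_left (singleton_subset_iff.2 hx.1), hk]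
  exact_mod_cast Nat.one_le_iff_ne_zero.2 this

lemma PointMeasure.measure_diff_atoms (μ : PointMeasure X) (B : BoundedBorel X) :
    μ.toMeasure (B.1 \ {x | x ∈ B.1 ∧ μ.toMeasure {x} ≠ 0}) = 0 :=
  μ.measure_eq_zero_of_forall_singleton
    (B.inter {x | x ∈ B.1 ∧ μ.toMeasure {x} ≠ 0}ᶜ (μ.finite_atoms B).measurableSet.compl)
    fun x hx => by
      by_contra h0
      exact hx.2 ⟨hx.1, h0⟩

lemma PointMeasure.ae_singleton_ne_zero (μ : PointMeasure X) :
    ∀ᵐ x ∂μ.toMeasure, μ.toMeasure {x} ≠ 0 := by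
  have h : {x | ¬ μ.toMeasure {x} ≠ 0} ⊆
      ⋃ n, (exhaust X n).1 \ {x | x ∈ (exhaust X n).1 ∧ μ.toMeasure {x} ≠ 0} := by
    intro x hx
    obtain ⟨n, hn⟩ := mem_iUnion.1 ((iUnion_exhaust X).symm ▸ mem_univ x)
    exact mem_iUnion.2 ⟨n, hn, fun h => hx h.2⟩
  exact measure_mono_null h (measure_iUnion_null fun n => μ.measure_diff_atoms _)

lemma xi_lt_top (B : BoundedBorel X) (μ : PointMeasure X) : xi B μ < ⊤ :=
  (μ.finite_atoms B).encard_lt_top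

/-- Weighting each point by the inverse multiplicity counts every site once. This makes `ξ_B` an
integral against `μ`, hence measurable and accessible to the Campbell equation. -/
lemma lintegral_inv_apply_singleton (B : BoundedBorel X) (μ : PointMeasure X) :
    ∫⁻ x in B.1, (μ.toMeasure {x})⁻¹ ∂μ.toMeasure = (xi B μ : ℝ≥0∞) := by
  set A := {x | x ∈ B.1 ∧ μ.toMeasure {x} ≠ 0} with hA
  have hAB : A ⊆ B.1 := fun x hx => hx.1
  have h1 : ∫⁻ x in B.1, (μ.toMeasure {x})⁻¹ ∂μ.toMeasure
      = ∫⁻ x in A, (μ.toMeasure {x})⁻¹ ∂μ.toMeasure := by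
    refine setLIntegral_congr (ae_eq_set.2 ⟨μ.measure_diff_atoms B, ?_⟩)
    rw [sdiff_eq_empty.2 hAB, measure_empty]
  have hfin : A.Finite := μ.finite_atoms B
  rw [h1, ← hfin.coe_toFinset, lintegral_finset]
  have h2 : ∀ x ∈ hfin.toFinset, (μ.toMeasure {x})⁻¹ * μ.toMeasure {x} = 1 := fun x hx => by
    rw [hfin.mem_toFinset] at hx
    obtain ⟨k, hk⟩ := μ.exists_nat_singleton x
    exact ENNReal.inv_mul_cancel hx.2 (by simp [hk])
  rw [Finset.sum_congr rfl h2, xi, ← hA, hfin.encard_eq_coe_toFinset_card]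
  simp

lemma measurable_xi_toENNReal (B : BoundedBorel X) :
    Measurable fun μ : PointMeasure X => (xi B μ : ℝ≥0∞) := by
  simp_rw [← lintegral_inv_apply_singleton]
  simp_rw [← lintegral_indicator B.2.2]
  refine measurable_lintegral_toMeasure measurable_id ?_
  have : Measurable fun p : PointMeasure X × X => (p.1.toMeasure {p.2})⁻¹ :=
    (measurable_apply_singleton.comp measurable_swap).inv
  exact this.indicator (B.2.2.preimage measurable_snd)

lemma measurableSet_xi_eq (B : BoundedBorel X) (n : ℕ∞) :
    MeasurableSet {μ : PointMeasure X | xi B μ = n} := by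
  have : {μ : PointMeasure X | xi B μ = n} = {μ | (xi B μ : ℝ≥0∞) = n} := by
    ext μ; simp
  rw [this]
  exact measurable_xi_toENNReal B (measurableSet_singleton _)

lemma measurable_xi (B : BoundedBorel X) : Measurable[_, ⊤] (xi (X := X) B) := by
  refine @measurable_to_countable' _ _ ⊤ _ _ _ fun n => measurableSet_xi_eq B n

lemma exists_xi_eq (B : BoundedBorel X) (μ : PointMeasure X) : ∃ n : ℕ, xi B μ = n :=
  (ENat.ne_top_iff_exists.1 (xi_lt_top B μ).ne).imp fun _ h => h.symm

end Atoms

/-- The part of `B` outside `B'`. -/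
def BoundedBorel.diff (B B' : BoundedBorel X) : BoundedBorel X := B.inter B'.1ᶜ B'.2.2.compl

lemma xi_add_diff {B B' : BoundedBorel X} (h : B'.1 ⊆ B.1) (μ : PointMeasure X) :
    xi B μ = xi B' μ + xi (B.diff B') μ := by
  rw [xi, xi, xi, ← Set.encard_union_eq]
  · congr 1
    ext x
    simp only [BoundedBorel.diff, inter, mem_ofPred_eq, mem_union, mem_inter_iff, mem_compl_iff]
    have := @h x
    tauto
  · rw [Set.disjoint_left]
    rintro x ⟨h1, -⟩ ⟨h2, -⟩
    exact h2.2 h1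

lemma xi_congr [MeasurableSingletonClass X] {B : BoundedBorel X} {μ ν : PointMeasure X} {S : Set X} (hS : MeasurableSet S)
    (hB : B.1 ⊆ S) (h : μ.restrict S hS = ν.restrict S hS) : xi B μ = xi B ν := by
  unfold xi
  congr 1
  ext x
  simp only [mem_ofPred_eq]
  refine and_congr_right fun hx => ?_
  have h1 : ∀ κ : PointMeasure X, κ.toMeasure {x} = (κ.restrict S hS).toMeasure {x} := fun κ => by
    rw [toMeasure_restrict, Measure.restrict_apply (measurableSet_singleton x),
      inter_eq_self_of_subset_left (singleton_subset_iff.2 (hB hx))]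
  rw [h1 μ, h1 ν, h]

lemma measure_eq_zero_of_xi [StandardBorelSpace X] {B : BoundedBorel X} {μ : PointMeasure X}
    (h : xi B μ = 0) : μ.toMeasure B.1 = 0 := by
  rw [xi, Set.encard_eq_zero, Set.eq_empty_iff_forall_notMem] at h
  refine μ.measure_eq_zero_of_forall_singleton B fun x hx => ?_
  by_contra h0
  exact h x ⟨hx, h0⟩

end Basic

end PolyaSum

end

noncomputable section

namespace PolyaSum

open BoundedBorel PointMeasure

/-- Diffuse measures that are finite on bounded Borel sets. -/
class IsDiffuse {X : Type*} [MeasurableSpace X] [Bornology X] (ρ : Measure X) : Prop where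
  lt_top : ∀ B : BoundedBorel X, ρ B.1 < ∞
  singleton : ∀ x, ρ {x} = 0

/-! ### Clusters: logarithmic multiplicities and Poisson weights. -/

section Weights

/-- The coefficients of `-log (1 - z)`, the intensities of the multiplicities. -/
def logWeight (z : ℝ) (j : ℕ) : ℝ≥0∞ := ENNReal.ofReal z ^ (j + 1) / (j + 1 : ℕ)

/-- The intensity `-log (1 - z)` of occupied sites. -/
def siteRate (z : ℝ) : ℝ≥0∞ := ∑' j, logWeight z j

lemma siteRate_lt_top {z : ℝ} (hz : z < 1) : siteRate z < ∞ := by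
  have h1 : ENNReal.ofReal z < 1 := by simpa using hz
  have h2 : siteRate z ≤ ∑' j, ENNReal.ofReal z ^ j := by
    refine ENNReal.tsum_le_tsum fun j => ?_
    refine (ENNReal.div_le_of_le_mul ?_).trans (pow_le_pow_right_of_le_one' h1.le (Nat.le_succ j))
    exact le_mul_of_one_le_right' (by exact_mod_cast Nat.succ_pos j)
  refine h2.trans_lt ?_
  rw [ENNReal.tsum_geometric]
  exact ENNReal.inv_lt_top.2 (tsub_pos_of_lt h1)

lemma siteRate_pos {z : ℝ} (hz : 0 < z) : siteRate z ≠ 0 := by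
  intro h
  have := ENNReal.tsum_eq_zero.1 h 0
  simp [logWeight] at this
  linarith

/-- The exponential series. -/
def expSeries (c : ℝ≥0∞) : ℝ≥0∞ := ∑' k : ℕ, c ^ k * ((k.factorial : ℕ) : ℝ≥0∞)⁻¹

lemma expSeries_eq {c : ℝ≥0∞} (hc : c ≠ ∞) : expSeries c = ENNReal.ofReal (Real.exp c.toReal) := by
  rw [Real.exp_eq_exp_ℝ, NormedSpace.exp_eq_tsum_div, expSeries,
    ENNReal.ofReal_tsum_of_nonneg (fun n => by positivity)
      (Real.summable_pow_div_factorial c.toReal)]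
  refine tsum_congr fun k => ?_
  rw [ENNReal.ofReal_div_of_pos (by positivity), ENNReal.ofReal_pow ENNReal.toReal_nonneg,
    ENNReal.ofReal_toReal hc, ENNReal.ofReal_natCast, div_eq_mul_inv]

lemma expSeries_ne_zero (c : ℝ≥0∞) : expSeries c ≠ 0 := by
  intro h
  simpa using ENNReal.tsum_eq_zero.1 h 0

lemma expSeries_ne_top {c : ℝ≥0∞} (hc : c ≠ ∞) : expSeries c ≠ ∞ := by
  rw [expSeries_eq hc]; exact ENNReal.ofReal_ne_top

/-- The weights of the Poisson distribution. -/
def poissonWeight (c : ℝ≥0∞) (k : ℕ) : ℝ≥0∞ :=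
  (expSeries c)⁻¹ * (c ^ k * ((k.factorial : ℕ) : ℝ≥0∞)⁻¹)

lemma tsum_poissonWeight {c : ℝ≥0∞} (hc : c ≠ ∞) : ∑' k, poissonWeight c k = 1 := by
  simp_rw [poissonWeight]
  rw [ENNReal.tsum_mul_left]
  exact ENNReal.inv_mul_cancel (expSeries_ne_zero c) (expSeries_ne_top hc)

end Weights

variable {X : Type*} [MeasurableSpace X] [Bornology X] [SigmaBounded X]

instance (ρ : Measure X) [h : IsDiffuse ρ] : SigmaFinite ρ :=
  ⟨⟨⟨fun n => (exhaust X n).1, fun _ => trivial, fun _ => h.lt_top _, iUnion_exhaust X⟩⟩⟩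

instance (ρ : Measure X) [h : IsDiffuse ρ] (w : ℝ≥0) : IsDiffuse (w • ρ) where
  lt_top B := by
    rw [Measure.smul_apply, ENNReal.smul_def, smul_eq_mul]
    exact ENNReal.mul_lt_top ENNReal.coe_lt_top (h.lt_top B)
  singleton x := by simp [h.singleton x]

/-- The intensity measure of a single cluster in `B`. -/
def cluster (z : ℝ) (ρ : Measure X) (B : BoundedBorel X) : Measure (PointMeasure X) :=
  Measure.sum fun j => logWeight z j • (ρ.restrict B.1).map (site (j + 1))

instance (z : ℝ) (ρ : Measure X) [SFinite ρ] (B : BoundedBorel X) : SFinite (cluster z ρ B) := by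
  unfold cluster; infer_instance

lemma lintegral_cluster (z : ℝ) (ρ : Measure X) (B : BoundedBorel X) {F : PointMeasure X → ℝ≥0∞}
    (hF : Measurable F) : ∫⁻ ν, F ν ∂cluster z ρ B =
      ∑' j, logWeight z j * ∫⁻ x in B.1, F (site (j + 1) x) ∂ρ := by
  rw [cluster, lintegral_sum_measure]
  refine tsum_congr fun j => ?_
  rw [lintegral_smul_measure, smul_eq_mul, lintegral_map hF (measurable_site _)]

/-- The law, up to normalization, of the superposition of `k` independent clusters in `B`. -/
def clusters (z : ℝ) (ρ : Measure X) (B : BoundedBorel X) : ℕ → Measure (PointMeasure X)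
  | 0 => Measure.dirac 0
  | k + 1 => (cluster z ρ B).conv (clusters z ρ B k)

instance (z : ℝ) (ρ : Measure X) [SFinite ρ] (B : BoundedBorel X) (k : ℕ) :
    SFinite (clusters z ρ B k) := by
  induction k with
  | zero => rw [clusters]; infer_instance
  | succ k ih => rw [clusters]; unfold Measure.conv; infer_instance

variable {z : ℝ} {ρ : Measure X}

@[simp] lemma lintegral_clusters_zero (B : BoundedBorel X) {F : PointMeasure X → ℝ≥0∞}
    (hF : Measurable F) : ∫⁻ ν, F ν ∂clusters z ρ B 0 = F 0 := by
  rw [clusters, lintegral_dirac' _ hF]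

variable [SFinite ρ]

lemma lintegral_clusters_succ (B : BoundedBorel X) (k : ℕ) {F : PointMeasure X → ℝ≥0∞}
    (hF : Measurable F) : ∫⁻ ν, F ν ∂clusters z ρ B (k + 1) =
      ∫⁻ ν, ∫⁻ ν', F (ν + ν') ∂clusters z ρ B k ∂cluster z ρ B := by
  rw [clusters, Measure.lintegral_conv hF]

lemma lintegral_cluster_one (B : BoundedBorel X) :
    cluster z ρ B univ = siteRate z * ρ B.1 := by
  rw [← lintegral_one, lintegral_cluster _ _ _ measurable_const]
  simp [siteRate, ENNReal.tsum_mul_right]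

lemma clusters_univ (B : BoundedBorel X) (k : ℕ) :
    clusters z ρ B k univ = (siteRate z * ρ B.1) ^ k := by
  induction k with
  | zero => simp [clusters]
  | succ k ih =>
    rw [← lintegral_one, lintegral_clusters_succ _ _ measurable_const]
    simp [ih, lintegral_cluster_one, pow_succ]

/-- Every cluster sits at a point of `B`, so restricting to `B` changes nothing. -/
lemma lintegral_clusters_restrict (B : BoundedBorel X) (k : ℕ) {F : PointMeasure X → ℝ≥0∞}
    (hF : Measurable F) :
    ∫⁻ ν, F (ν.restrict B.1 B.2.2) ∂clusters z ρ B k = ∫⁻ ν, F ν ∂clusters z ρ B k := by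
  induction k generalizing F with
  | zero =>
    rw [lintegral_clusters_zero _ (by fun_prop), lintegral_clusters_zero _ hF]
    congr 1
    ext1
    simp [toMeasure_restrict]
  | succ k ih =>
    rw [lintegral_clusters_succ _ _ (by fun_prop), lintegral_clusters_succ _ _ hF]
    simp_rw [restrict_add]
    have h1 : ∀ ν : PointMeasure X, ∫⁻ ν', F (ν.restrict B.1 B.2.2 + ν'.restrict B.1 B.2.2)
        ∂clusters z ρ B k = ∫⁻ ν', F (ν.restrict B.1 B.2.2 + ν') ∂clusters z ρ B k :=
      fun ν => ih (F := fun κ => F (ν.restrict B.1 B.2.2 + κ)) (by fun_prop)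
    simp_rw [h1]
    have hm : Measurable fun ν : PointMeasure X => ∫⁻ ν', F (ν + ν') ∂clusters z ρ B k :=
      Measurable.lintegral_prod_right' (f := fun p : PointMeasure X × PointMeasure X =>
        F (p.1 + p.2)) (by fun_prop)
    rw [lintegral_cluster _ _ _ hm, lintegral_cluster _ _ _ (F := fun ν =>
      ∫⁻ ν', F (ν.restrict B.1 B.2.2 + ν') ∂clusters z ρ B k) (hm.comp (measurable_restrict B.2.2))]
    refine tsum_congr fun j => ?_
    congr 1
    refine setLIntegral_congr_fun B.2.2 fun x hx => ?_
    have : (site (j + 1) x : PointMeasure X).restrict B.1 B.2.2 = site (j + 1) x := by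
      apply restrict_eq_self
      simp [toMeasure_site, Measure.dirac_apply' x B.2.2.compl, hx]
    simp only [this]

/-- The intensity enters only through a scalar, which disappears on conditioning by the number of
sites. This is why one specification serves all `w`. -/
lemma clusters_smul (w : ℝ≥0) (B : BoundedBorel X) (k : ℕ) :
    clusters z (w • ρ) B k = (w : ℝ≥0∞) ^ k • clusters z ρ B k := by
  have h : cluster z (w • ρ) B = (w : ℝ≥0∞) • cluster z ρ B := by
    refine Measure.ext_of_lintegral _ fun F hF => ?_
    rw [lintegral_smul_measure, lintegral_cluster _ _ _ hF, lintegral_cluster _ _ _ hF,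
      smul_eq_mul, ← ENNReal.tsum_mul_left]
    refine tsum_congr fun j => ?_
    rw [Measure.restrict_smul, ENNReal.smul_def, lintegral_smul_measure, smul_eq_mul]
    ring
  have hs : w • ρ = (w : ℝ≥0∞) • ρ := rfl
  induction k with
  | zero => simp [clusters]
  | succ k ih =>
    refine Measure.ext_of_lintegral _ fun F hF => ?_
    have : SFinite (w • ρ) := by rw [hs]; infer_instance
    rw [lintegral_smul_measure, lintegral_clusters_succ _ _ hF, lintegral_clusters_succ _ _ hF, h,
      lintegral_smul_measure, ih]
    simp_rw [lintegral_smul_measure, smul_eq_mul]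
    rw [lintegral_const_mul]
    · ring
    · exact Measurable.lintegral_prod_right' (f := fun p : PointMeasure X × PointMeasure X =>
        F (p.1 + p.2)) (by fun_prop)

end PolyaSum

end

noncomputable section

/-! ### From the Campbell equation to the law in a bounded set. -/

namespace PolyaSum

open BoundedBorel PointMeasure

variable {X : Type*} [MeasurableSpace X] [StandardBorelSpace X] [Bornology X] [SigmaBounded X]
variable {z : ℝ} {ρ : Measure X} [IsDiffuse ρ] {P : Measure (PointMeasure X)}

/-- The atoms of a configuration are countably many and `ρ` has no atoms: points drawn from `ρ`
avoid occupied sites. -/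
lemma ae_singleton_eq_zero (ρ : Measure X) [h : IsDiffuse ρ] (μ : PointMeasure X) :
    ∀ᵐ x ∂ρ, μ.toMeasure {x} = 0 := by
  have h1 : {x | ¬ μ.toMeasure {x} = 0} ⊆
      ⋃ n, {x | x ∈ (exhaust X n).1 ∧ μ.toMeasure {x} ≠ 0} := by
    intro x hx
    obtain ⟨n, hn⟩ := mem_iUnion.1 ((iUnion_exhaust X).symm ▸ mem_univ x)
    exact mem_iUnion.2 ⟨n, hn, hx⟩
  have : NullSingletonClass ρ := ⟨h.singleton⟩
  exact measure_mono_null h1 (measure_iUnion_null fun n => (μ.finite_atoms _).measure_zero ρ)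

@[fun_prop]
lemma measurable_apply_singleton_comp {α : Type*} [MeasurableSpace α] {f : α → X}
    {g : α → PointMeasure X} (hf : Measurable f) (hg : Measurable g) :
    Measurable fun a => (g a).toMeasure {f a} :=
  measurable_apply_singleton.comp (hf.prodMk hg)

lemma measurable_lintegral_right {α : Type*} [MeasurableSpace α] {m : Measure X} [SFinite m]
    {h : α → X → ℝ≥0∞} (hh : Measurable (Function.uncurry h)) :
    Measurable fun a => ∫⁻ x, h a x ∂m :=
  Measurable.lintegral_prod_right' (f := Function.uncurry h) hh

/-- The contribution to the Campbell measure of the sites of multiplicity `j + 1`. -/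
lemma campbell_multiplicity (hP : IsPolyaSumProcess z ρ P) (j : ℕ) {H : X → PointMeasure X → ℝ≥0∞}
    (hH : Measurable (Function.uncurry H)) :
    ∫⁻ μ, ∫⁻ x, {x | μ.toMeasure {x} = (j + 1 : ℕ)}.indicator (fun x => H x μ) x ∂μ.toMeasure ∂P =
      ENNReal.ofReal z ^ (j + 1) * ∫⁻ μ, ∫⁻ x, H x (site (j + 1) x + μ) ∂ρ ∂P := by
  have hind : ∀ (j : ℕ) (H : X → PointMeasure X → ℝ≥0∞), Measurable (Function.uncurry H) →
      Measurable fun p : X × PointMeasure X =>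
        {x | p.2.toMeasure {x} = j}.indicator (fun x => H x p.2) p.1 := fun j H hH =>
    hH.indicator (measurable_apply_singleton (measurableSet_singleton (j : ℝ≥0∞)))
  have hadd : ∀ H : X → PointMeasure X → ℝ≥0∞, Measurable (Function.uncurry H) → ∀ i,
      Measurable (Function.uncurry fun x μ => H x (site i x + μ)) := fun H hH i =>
    hH.comp (f := fun p : X × PointMeasure X => (p.1, site i p.1 + p.2)) (by fun_prop)
  have hmass : ∀ (μ : PointMeasure X) (x : X), (site 1 x + μ).toMeasure {x} = 1 + μ.toMeasure {x} :=
    fun μ x => by simp [toMeasure_site]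
  induction j generalizing H with
  | zero =>
    rw [hP.2 (fun p => {x | p.2.toMeasure {x} = (0 + 1 : ℕ)}.indicator (fun x => H x p.2) p.1)
      (hind _ H hH)]
    simp only [zero_add, pow_one, addPoint_eq]
    congr 1
    -- A point drawn from `ρ` opens a site of multiplicity one; a point drawn from `μ` hits an
    -- occupied site and makes its multiplicity at least two. Only the `ρ` part survives.
    refine lintegral_congr fun μ => ?_
    rw [lintegral_add_measure, (?_ : ∫⁻ x, _ ∂μ.toMeasure = 0), add_zero]
    · refine lintegral_congr_ae ?_
      filter_upwards [ae_singleton_eq_zero ρ μ] with x hx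
      rw [indicator_of_mem]
      rw [mem_ofPred_eq, hmass, hx]; simp
    · refine (lintegral_congr_ae ?_).trans lintegral_zero
      filter_upwards [μ.ae_singleton_ne_zero] with x hx
      rw [indicator_of_notMem]
      rw [mem_ofPred_eq, hmass]
      obtain ⟨k, hk⟩ := μ.exists_nat_singleton x
      rw [hk] at hx ⊢
      norm_cast at hx ⊢
      omega
  | succ j ih =>
    rw [hP.2 (fun p => {x | p.2.toMeasure {x} = (j + 1 + 1 : ℕ)}.indicator (fun x => H x p.2) p.1)
      (hind _ H hH)]
    -- Multiplicity `j + 2` after the addition means `j + 1` before it, so now the `ρ` part vanishes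
    -- and only the `μ` part survives.
    have h1 : ∀ μ : PointMeasure X, ∫⁻ x, {y | (μ.addPoint x).toMeasure {y} =
        (j + 1 + 1 : ℕ)}.indicator (fun y => H y (μ.addPoint x)) x ∂(ρ + μ.toMeasure) =
        ∫⁻ x, {x | μ.toMeasure {x} = (j + 1 : ℕ)}.indicator
          (fun x => H x (site 1 x + μ)) x ∂μ.toMeasure := by
      intro μ
      rw [lintegral_add_measure, (?_ : ∫⁻ x, _ ∂ρ = 0), zero_add]
      · refine lintegral_congr fun x => ?_
        rw [addPoint_eq]
        by_cases hx : μ.toMeasure {x} = (j + 1 : ℕ)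
        · rw [indicator_of_mem, indicator_of_mem]
          · exact hx
          · rw [mem_ofPred_eq, hmass, hx]; push_cast; ring
        · rw [indicator_of_notMem, indicator_of_notMem]
          · exact hx
          · rw [mem_ofPred_eq, hmass]
            obtain ⟨k, hk⟩ := μ.exists_nat_singleton x
            rw [hk] at hx ⊢
            norm_cast at hx ⊢
            omega
      · refine (lintegral_congr_ae ?_).trans lintegral_zero
        filter_upwards [ae_singleton_eq_zero ρ μ] with x hx
        rw [addPoint_eq, indicator_of_notMem]
        rw [mem_ofPred_eq, hmass, hx]
        norm_cast
        omega
    simp_rw [h1]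
    rw [ih (hadd H hH 1), pow_succ' _ (j + 1), mul_assoc]
    congr 2
    refine lintegral_congr fun μ => lintegral_congr fun x => ?_
    rw [← add_assoc, ← site_add, add_comm 1]

/-- The Mecke formula for the occupied sites. -/
lemma campbell_sites (hP : IsPolyaSumProcess z ρ P) (B : BoundedBorel X)
    {H : X → PointMeasure X → ℝ≥0∞} (hH : Measurable (Function.uncurry H)) :
    ∫⁻ μ, ∫⁻ x in B.1, H x μ * (μ.toMeasure {x})⁻¹ ∂μ.toMeasure ∂P =
      ∑' j, logWeight z j * ∫⁻ μ, ∫⁻ x in B.1, H x (site (j + 1) x + μ) ∂ρ ∂P := by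
  -- `μ` counts a site of multiplicity `j + 1` that many times; the weight `1/(j + 1)` undoes this
  -- and turns `z^(j+1)` into `logWeight z j`.
  let H' : ℕ → X → PointMeasure X → ℝ≥0∞ := fun j x μ =>
    B.1.indicator (fun x => H x μ * ((j + 1 : ℕ) : ℝ≥0∞)⁻¹) x
  have hH' : ∀ j, Measurable (Function.uncurry (H' j)) := fun j =>
    (hH.mul_const _).indicator (B.2.2.preimage measurable_fst)
  have hind : ∀ j : ℕ, Measurable fun p : PointMeasure X × X =>
        {x | p.1.toMeasure {x} = (j + 1 : ℕ)}.indicator (fun x => H' j x p.1) p.2 := fun j =>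
    ((hH' j).comp measurable_swap).indicator ((measurable_apply_singleton.comp measurable_swap)
      (measurableSet_singleton ((j + 1 : ℕ) : ℝ≥0∞)))
  have h1 : ∀ μ : PointMeasure X, ∫⁻ x in B.1, H x μ * (μ.toMeasure {x})⁻¹ ∂μ.toMeasure =
      ∑' j : ℕ, ∫⁻ x, {x | μ.toMeasure {x} = (j + 1 : ℕ)}.indicator (fun x => H' j x μ) x
        ∂μ.toMeasure := by
    intro μ
    rw [← lintegral_tsum (f := fun j x => {x | μ.toMeasure {x} = (j + 1 : ℕ)}.indicator
      (fun x => H' j x μ) x) fun j => ((hind j).comp measurable_prodMk_left).aemeasurable, ← lintegral_indicator B.2.2]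
    refine lintegral_congr_ae ?_
    filter_upwards [μ.ae_singleton_ne_zero] with x hx
    obtain ⟨k, hk⟩ := μ.exists_nat_singleton x
    have hk0 : k ≠ 0 := by rintro rfl; exact hx (by simpa using hk)
    rw [tsum_eq_single (k - 1)]
    · have hk1 : k - 1 + 1 = k := by omega
      rw [indicator_of_mem (s := {x | μ.toMeasure {x} = (k - 1 + 1 : ℕ)})
        (by rw [mem_ofPred_eq, hk, hk1])]
      simp only [H']
      by_cases hxB : x ∈ B.1
      · rw [indicator_of_mem hxB, indicator_of_mem hxB, hk1, hk]
      · rw [indicator_of_notMem hxB, indicator_of_notMem hxB]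
    · intro j hj
      rw [indicator_of_notMem]
      rw [mem_ofPred_eq, hk]
      norm_cast
      omega
  simp_rw [h1]
  rw [lintegral_tsum fun j => (measurable_lintegral_toMeasure (h := fun μ x =>
    {x | μ.toMeasure {x} = (j + 1 : ℕ)}.indicator (fun x => H' j x μ) x)
    (f := fun μ => μ) measurable_id (hind j)).aemeasurable]
  refine tsum_congr fun j => ?_
  rw [campbell_multiplicity hP j (hH' j), logWeight, ENNReal.div_eq_inv_mul, mul_comm (_⁻¹),
    mul_assoc]
  have hne : ((j + 1 : ℕ) : ℝ≥0∞)⁻¹ ≠ ∞ := by simp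
  congr 1
  rw [← lintegral_const_mul' _ _ hne]
  refine lintegral_congr fun μ => ?_
  rw [← lintegral_const_mul' _ _ hne, ← lintegral_indicator B.2.2]
  refine lintegral_congr fun x => ?_
  simp only [H', indicator]
  split_ifs
  · rw [mul_comm]
  · rfl

lemma xi_site_add {B : BoundedBorel X} {x : X} (hx : x ∈ B.1) {μ : PointMeasure X}
    (h0 : μ.toMeasure {x} = 0) (j : ℕ) : xi B (site (j + 1) x + μ) = xi B μ + 1 := by
  have h : {y | y ∈ B.1 ∧ (site (j + 1) x + μ).toMeasure {y} ≠ 0} =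
      insert x {y | y ∈ B.1 ∧ μ.toMeasure {y} ≠ 0} := by
    ext y
    by_cases hy : y = x
    · subst hy; simp [toMeasure_site, hx]
    · have : x ∉ ({y} : Set X) := by simpa using Ne.symm hy
      simp [toMeasure_site, hy, Ne.symm hy]
  rw [xi, h, Set.encard_insert_of_notMem, xi]
  simp [h0]

/-- This is `campbell_sites` for a function of the configuration alone, localized at `k + 1` sites:
on the left each of the `k + 1` sites contributes equally, on the right a new cluster falls on an
empty site and raises `ξ_B` from `k` to `k + 1`. -/
lemma lintegral_xi_succ (hP : IsPolyaSumProcess z ρ P) (B : BoundedBorel X) (k : ℕ)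
    {F : PointMeasure X → ℝ≥0∞} (hF : Measurable F) :
    (k + 1 : ℕ) * ∫⁻ μ in {μ | xi B μ = (k + 1 : ℕ)}, F μ ∂P =
      ∫⁻ μ in {μ | xi B μ = k}, ∫⁻ ν, F (ν + μ) ∂cluster z ρ B ∂P := by
  have hG : Measurable ({μ : PointMeasure X | xi B μ = (k + 1 : ℕ)}.indicator F) :=
    hF.indicator (measurableSet_xi_eq B _)
  have h := campbell_sites hP B
    (H := fun _ μ => {μ : PointMeasure X | xi B μ = (k + 1 : ℕ)}.indicator F μ)
    (hG.comp measurable_snd)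
  have hl : ∀ μ : PointMeasure X, ∫⁻ x in B.1, {μ : PointMeasure X | xi B μ =
      (k + 1 : ℕ)}.indicator F μ * (μ.toMeasure {x})⁻¹ ∂μ.toMeasure =
      {μ : PointMeasure X | xi B μ = (k + 1 : ℕ)}.indicator (fun μ => (k + 1 : ℕ) * F μ) μ := by
    intro μ
    rw [lintegral_const_mul _ (by fun_prop), lintegral_inv_apply_singleton]
    by_cases hμ : μ ∈ {μ : PointMeasure X | xi B μ = (k + 1 : ℕ)}
    · have h1 : xi B μ = (k + 1 : ℕ) := hμ
      rw [indicator_of_mem hμ, indicator_of_mem hμ, h1, mul_comm]; simp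
    · rw [indicator_of_notMem hμ, indicator_of_notMem hμ, zero_mul]
  simp_rw [hl] at h
  rw [lintegral_indicator (measurableSet_xi_eq B _), lintegral_const_mul _ hF] at h
  rw [h, ← lintegral_indicator (measurableSet_xi_eq B _)]
  have hr : ∀ μ : PointMeasure X, {μ : PointMeasure X | xi B μ = k}.indicator
      (fun μ => ∫⁻ ν, F (ν + μ) ∂cluster z ρ B) μ = ∑' j, logWeight z j *
        ∫⁻ x in B.1, {μ : PointMeasure X | xi B μ = (k + 1 : ℕ)}.indicator F
          (site (j + 1) x + μ) ∂ρ := by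
    intro μ
    have key : ∀ j, ∫⁻ x in B.1, {μ : PointMeasure X | xi B μ = (k + 1 : ℕ)}.indicator F
          (site (j + 1) x + μ) ∂ρ = ∫⁻ x in B.1, {μ : PointMeasure X | xi B μ = k}.indicator
          (fun μ => F (site (j + 1) x + μ)) μ ∂ρ := by
      intro j
      refine setLIntegral_congr_fun_ae B.2.2 ?_
      filter_upwards [ae_singleton_eq_zero ρ μ] with x hx hxB
      have := xi_site_add hxB hx j
      by_cases hμ : xi B μ = k
      · rw [indicator_of_mem, indicator_of_mem]
        · exact hμ
        · rw [mem_ofPred_eq, this, hμ]; rfl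
      · rw [indicator_of_notMem, indicator_of_notMem]
        · exact hμ
        · rw [mem_ofPred_eq, this]
          intro h
          refine hμ ?_
          push_cast at h
          exact (ENat.add_left_injective_of_ne_top (by simp)) h
    simp_rw [key]
    by_cases hμ : μ ∈ {μ : PointMeasure X | xi B μ = k}
    · rw [indicator_of_mem hμ, lintegral_cluster _ _ _ (F := fun ν => F (ν + μ)) (by fun_prop)]
      refine tsum_congr fun j => ?_
      simp_rw [indicator_of_mem hμ]
    · rw [indicator_of_notMem hμ]
      simp_rw [indicator_of_notMem hμ]
      simp
  simp_rw [hr]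
  have hm : ∀ j, Measurable fun μ : PointMeasure X => ∫⁻ x in B.1, {μ : PointMeasure X | xi B μ =
      (k + 1 : ℕ)}.indicator F (site (j + 1) x + μ) ∂ρ := fun j =>
    measurable_lintegral_right (h := fun μ x => {μ : PointMeasure X | xi B μ =
      (k + 1 : ℕ)}.indicator F (site (j + 1) x + μ))
      (hG.comp (f := fun p : PointMeasure X × X => site (j + 1) p.2 + p.1) (by fun_prop))
  rw [lintegral_tsum fun j => ((hm j).const_mul _).aemeasurable]
  refine tsum_congr fun j => ?_
  rw [lintegral_const_mul _ (hm j)]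

lemma measurable_lintegral_add {m : Measure (PointMeasure X)} [SFinite m]
    {F : PointMeasure X → ℝ≥0∞} (hF : Measurable F) :
    Measurable fun μ => ∫⁻ ν, F (ν + μ) ∂m :=
  Measurable.lintegral_prod_right' (f := fun p : PointMeasure X × PointMeasure X =>
    F (p.2 + p.1)) (by fun_prop)

/-- Removing the sites in `B` one at a time reduces everything to configurations that are empty in
`B`; the factors `k + 1` accumulate to the factorial. -/
lemma lintegral_xi_eq_aux (hP : IsPolyaSumProcess z ρ P) (B : BoundedBorel X) (k : ℕ)
    {F : PointMeasure X → ℝ≥0∞} (hF : Measurable F) :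
    k.factorial * ∫⁻ μ in {μ | xi B μ = k}, F μ ∂P =
      ∫⁻ μ in {μ | xi B μ = 0}, ∫⁻ ν, F (ν + μ) ∂clusters z ρ B k ∂P := by
  induction k generalizing F with
  | zero =>
    simp only [Nat.factorial_zero, Nat.cast_one, one_mul, Nat.cast_zero]
    refine lintegral_congr fun μ => ?_
    rw [lintegral_clusters_zero B (F := fun ν => F (ν + μ)) (by fun_prop), zero_add]
  | succ k ih =>
    rw [Nat.factorial_succ, mul_comm (k + 1), Nat.cast_mul, mul_assoc, lintegral_xi_succ hP B k hF,
      ih (measurable_lintegral_add hF)]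
    refine lintegral_congr fun μ => ?_
    rw [lintegral_clusters_succ B k (F := fun ν => F (ν + μ)) (by fun_prop), lintegral_lintegral_swap]
    · refine lintegral_congr fun ν => lintegral_congr fun ν' => ?_
      rw [add_assoc]
    · refine Measurable.aemeasurable ?_
      simp only [Function.uncurry_def]
      fun_prop

lemma iUnion_xi_eq (B : BoundedBorel X) :
    ⋃ k : ℕ, {μ : PointMeasure X | xi B μ = k} = univ := by
  refine eq_univ_of_forall fun μ => ?_
  obtain ⟨n, hn⟩ := exists_xi_eq B μ
  exact mem_iUnion.2 ⟨n, hn⟩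

lemma pairwise_disjoint_xi (B : BoundedBorel X) :
    Pairwise (Function.onFun Disjoint fun k : ℕ => {μ : PointMeasure X | xi B μ = k}) := by
  intro i j hij
  rw [Function.onFun, Set.disjoint_left]
  intro μ h1 h2
  rw [mem_ofPred_eq] at h1 h2
  rw [h1] at h2
  exact hij (by exact_mod_cast h2)

lemma lintegral_eq_tsum_xi (B : BoundedBorel X) (F : PointMeasure X → ℝ≥0∞)
    (P : Measure (PointMeasure X)) :
    ∫⁻ μ, F μ ∂P = ∑' k : ℕ, ∫⁻ μ in {μ | xi B μ = k}, F μ ∂P := by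
  rw [← lintegral_iUnion (fun k : ℕ => measurableSet_xi_eq B k) (pairwise_disjoint_xi B), iUnion_xi_eq,
    Measure.restrict_univ]

lemma lintegral_clusters_add_restrict_compl (B : BoundedBorel X) (k : ℕ)
    {F : PointMeasure X → ℝ≥0∞} (hF : Measurable F) (μ : PointMeasure X) :
    ∫⁻ ν, F ((ν + μ).restrict B.1ᶜ B.2.2.compl) ∂clusters z ρ B k =
      (siteRate z * ρ B.1) ^ k * F (μ.restrict B.1ᶜ B.2.2.compl) := by
  rw [← lintegral_clusters_restrict B k
    (F := fun ν => F ((ν + μ).restrict B.1ᶜ B.2.2.compl)) (by fun_prop)]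
  have h : ∀ ν : PointMeasure X, (ν.restrict B.1 B.2.2 + μ).restrict B.1ᶜ B.2.2.compl =
      μ.restrict B.1ᶜ B.2.2.compl := fun ν => by
    rw [restrict_add, restrict_restrict, restrict_eq_zero, zero_add]
    simp
  simp_rw [h]
  rw [lintegral_const, clusters_univ, mul_comm]

/-- For functions of the outside, the clusters added in `B` contribute only their mass, so the
integral over `ξ_B = k` is `c^k/k!` times that over `ξ_B = 0`. Summing over `k` expresses the void
event through the whole law and shows its independence of the outside. -/
lemma lintegral_restrict_compl_xi_zero (hz : z < 1) (hP : IsPolyaSumProcess z ρ P)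
    (B : BoundedBorel X) {F : PointMeasure X → ℝ≥0∞} (hF : Measurable F) :
    ∫⁻ μ in {μ | xi B μ = 0}, F (μ.restrict B.1ᶜ B.2.2.compl) ∂P =
      (expSeries (siteRate z * ρ B.1))⁻¹ * ∫⁻ μ, F (μ.restrict B.1ᶜ B.2.2.compl) ∂P := by
  have hc : siteRate z * ρ B.1 ≠ ∞ :=
    (ENNReal.mul_lt_top (siteRate_lt_top hz) (IsDiffuse.lt_top B)).ne
  have hF' : Measurable fun μ : PointMeasure X => F (μ.restrict B.1ᶜ B.2.2.compl) := by fun_prop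
  rw [lintegral_eq_tsum_xi B _ P]
  have h : ∀ k : ℕ, ∫⁻ μ in {μ | xi B μ = k}, F (μ.restrict B.1ᶜ B.2.2.compl) ∂P =
      (siteRate z * ρ B.1) ^ k * ((k.factorial : ℕ) : ℝ≥0∞)⁻¹ *
      ∫⁻ μ in {μ | xi B μ = 0}, F (μ.restrict B.1ᶜ B.2.2.compl) ∂P := by
    intro k
    have h := (lintegral_xi_eq_aux hP B k hF').trans
      (lintegral_congr fun μ => lintegral_clusters_add_restrict_compl B k hF μ)
    rw [lintegral_const_mul _ hF'] at h
    rw [mul_comm (_ ^ k), mul_assoc, ← h, ← mul_assoc, ENNReal.inv_mul_cancel, one_mul]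
    · exact_mod_cast k.factorial_ne_zero
    · simp
  rw [tsum_congr h, ENNReal.tsum_mul_right, ← expSeries, ← mul_assoc, ENNReal.inv_mul_cancel
    (expSeries_ne_zero _) (expSeries_ne_top hc), one_mul]

/-- The configuration in `B` and the configuration outside `B` of a Pólya sum process are
independent, and the former is a Poisson number of independent clusters. -/
theorem lintegral_xi_eq (hz : z < 1) (hP : IsPolyaSumProcess z ρ P) (B : BoundedBorel X) (k : ℕ)
    {F : PointMeasure X → ℝ≥0∞} (hF : Measurable F) :
    ∫⁻ μ in {μ | xi B μ = k}, F μ ∂P =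
      (expSeries (siteRate z * ρ B.1))⁻¹ * ((k.factorial : ℕ) : ℝ≥0∞)⁻¹ *
        ∫⁻ μ, ∫⁻ ν, F (ν + μ.restrict B.1ᶜ B.2.2.compl) ∂clusters z ρ B k ∂P := by
  have h := lintegral_xi_eq_aux hP B k hF
  -- A configuration without sites in `B` has no mass there and equals its outside restriction, so
  -- independence of the void event from the outside applies.
  have h2 : ∫⁻ μ in {μ | xi B μ = 0}, ∫⁻ ν, F (ν + μ) ∂clusters z ρ B k ∂P =
      ∫⁻ μ in {μ | xi B μ = 0}, ∫⁻ ν, F (ν + μ.restrict B.1ᶜ B.2.2.compl) ∂clusters z ρ B k ∂P := by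
    refine setLIntegral_congr_fun (measurableSet_xi_eq B 0) fun μ hμ => ?_
    rw [restrict_eq_self]
    rw [compl_compl]
    exact measure_eq_zero_of_xi hμ
  rw [h2, lintegral_restrict_compl_xi_zero hz hP B
    (F := fun μ => ∫⁻ ν, F (ν + μ) ∂clusters z ρ B k) (measurable_lintegral_add hF)] at h
  rw [mul_comm (expSeries _)⁻¹, mul_assoc, ← h, ← mul_assoc, ENNReal.inv_mul_cancel, one_mul]
  · exact_mod_cast k.factorial_ne_zero
  · simp

end PolyaSum

end

noncomputable section

/-! ### Existence of the Pólya sum process. -/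

namespace PolyaSum

open BoundedBorel PointMeasure

variable {X : Type*} [MeasurableSpace X] [Bornology X] [SigmaBounded X]

/-- The inner integral on the right-hand side of the Mecke formula of a Pólya sum process. -/
def meckeIntegral (z : ℝ) (m : Measure X) (H : X → PointMeasure X → ℝ≥0∞) (μ : PointMeasure X) :
    ℝ≥0∞ := ∑' j : ℕ, ENNReal.ofReal z ^ (j + 1) * ∫⁻ x, H x (site (j + 1) x + μ) ∂m

lemma measurable_comp_site_add {H : X → PointMeasure X → ℝ≥0∞}
    (hH : Measurable (Function.uncurry H)) (j : ℕ) :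
    Measurable (Function.uncurry fun (μ : PointMeasure X) x => H x (site j x + μ)) :=
  hH.comp (f := fun p : PointMeasure X × X => (p.2, site j p.2 + p.1)) (by fun_prop)

lemma measurable_lintegral_site_add {m : Measure X} [SFinite m] {H : X → PointMeasure X → ℝ≥0∞}
    (hH : Measurable (Function.uncurry H)) (j : ℕ) :
    Measurable fun μ : PointMeasure X => ∫⁻ x, H x (site j x + μ) ∂m :=
  Measurable.lintegral_prod_right' (measurable_comp_site_add hH j)

lemma measurable_meckeIntegral (z : ℝ) {m : Measure X} [SFinite m]
    {H : X → PointMeasure X → ℝ≥0∞} (hH : Measurable (Function.uncurry H)) :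
    Measurable (meckeIntegral z m H) :=
  Measurable.tsum fun j => (measurable_lintegral_site_add hH (j + 1)).const_mul _

/-- The `j + 1` points of a cluster cancel the denominator of `logWeight z j`. -/
lemma lintegral_lintegral_cluster (z : ℝ) (ρ : Measure X) (B : BoundedBorel X)
    {H : X → PointMeasure X → ℝ≥0∞} (hH : Measurable (Function.uncurry H)) (μ : PointMeasure X) :
    ∫⁻ ν, ∫⁻ x, H x (ν + μ) ∂ν.toMeasure ∂cluster z ρ B = meckeIntegral z (ρ.restrict B.1) H μ := by
  rw [lintegral_cluster z ρ B]
  · refine tsum_congr fun j => ?_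
    have h : ∀ x : X, ∫⁻ y, H y (site (j + 1) x + μ) ∂(site (j + 1) x : PointMeasure X).toMeasure =
        (j + 1 : ℕ) * H x (site (j + 1) x + μ) := fun x => by
      rw [toMeasure_site, lintegral_smul_measure, lintegral_dirac' _ (by fun_prop), smul_eq_mul]
    simp_rw [h]
    rw [lintegral_const_mul' _ _ (by simp), ← mul_assoc, logWeight, ENNReal.div_mul_cancel]
    · exact_mod_cast j.succ_ne_zero
    · simp
  · exact measurable_lintegral_toMeasure (h := fun (ν : PointMeasure X) x => H x (ν + μ))
      measurable_id (hH.comp (f := fun p : PointMeasure X × X => (p.2, p.1 + μ)) (by fun_prop))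

/-- The selected point belongs to one of `k + 1` exchangeable clusters. The induction treats the
first cluster by `lintegral_lintegral_cluster` and the remaining ones by the hypothesis for the
shifted function. -/
lemma campbell_clusters (z : ℝ) (ρ : Measure X) [SFinite ρ] (B : BoundedBorel X) (k : ℕ)
    {H : X → PointMeasure X → ℝ≥0∞} (hH : Measurable (Function.uncurry H)) :
    ∫⁻ μ, ∫⁻ x, H x μ ∂μ.toMeasure ∂clusters z ρ B (k + 1) =
      (k + 1 : ℕ) * ∫⁻ μ, meckeIntegral z (ρ.restrict B.1) H μ ∂clusters z ρ B k := by
  have hm0 : ∀ {H : X → PointMeasure X → ℝ≥0∞}, Measurable (Function.uncurry H) →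
      Measurable fun μ : PointMeasure X => ∫⁻ x, H x μ ∂μ.toMeasure := fun {H} hH =>
    measurable_lintegral_toMeasure (f := fun μ => μ) (h := fun μ x => H x μ)
      measurable_id (hH.comp measurable_swap)
  induction k generalizing H with
  | zero =>
    rw [lintegral_clusters_succ B _ (hm0 hH),
      lintegral_clusters_zero B (measurable_meckeIntegral z hH)]
    simp only [zero_add, Nat.cast_one, one_mul, ← lintegral_lintegral_cluster z ρ B hH]
    refine lintegral_congr fun ν => ?_
    rw [lintegral_clusters_zero B (F := fun ν' => ∫⁻ x, H x (ν + ν') ∂(ν + ν').toMeasure), add_zero]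
    exact measurable_lintegral_toMeasure (f := fun ν' => ν + ν')
      (h := fun (ν' : PointMeasure X) x => H x (ν + ν')) (by fun_prop)
      (hH.comp (f := fun p : PointMeasure X × X => (p.2, ν + p.1)) (by fun_prop))
  | succ k ih =>
    rw [lintegral_clusters_succ B _ (hm0 hH)]
    simp_rw [toMeasure_add, lintegral_add_measure]
    have hm1 : Measurable fun p : PointMeasure X × PointMeasure X =>
        ∫⁻ x, H x (p.1 + p.2) ∂p.1.toMeasure :=
      measurable_lintegral_toMeasure (f := fun p : PointMeasure X × PointMeasure X => p.1)
        (h := fun p x => H x (p.1 + p.2)) (by fun_prop)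
        (hH.comp (f := fun p : (PointMeasure X × PointMeasure X) × X => (p.2, p.1.1 + p.1.2))
          (by fun_prop))
    have h2 : ∀ ν : PointMeasure X, ∫⁻ ν', ∫⁻ x, H x (ν + ν') ∂ν.toMeasure +
        ∫⁻ x, H x (ν + ν') ∂ν'.toMeasure ∂clusters z ρ B (k + 1) =
        ∫⁻ ν', ∫⁻ x, H x (ν + ν') ∂ν.toMeasure ∂clusters z ρ B (k + 1) +
        (k + 1 : ℕ) * ∫⁻ ν', meckeIntegral z (ρ.restrict B.1) H (ν + ν') ∂clusters z ρ B k := by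
      intro ν
      rw [lintegral_add_left (f := fun ν' => ∫⁻ x, H x (ν + ν') ∂ν.toMeasure)
        (hm1.comp (f := fun ν' => (ν, ν')) (by fun_prop)),
        ih (H := fun x μ => H x (ν + μ))
          (hH.comp (f := fun p : X × PointMeasure X => (p.1, ν + p.2)) (by fun_prop))]
      congr 2
      refine lintegral_congr fun ν' => tsum_congr fun j => ?_
      congr 1
      refine lintegral_congr fun x => ?_
      rw [add_left_comm]
    simp_rw [h2]
    have hm2 : Measurable fun ν : PointMeasure X =>
        ∫⁻ ν', meckeIntegral z (ρ.restrict B.1) H (ν + ν') ∂clusters z ρ B k :=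
      Measurable.lintegral_prod_right' (f := fun p : PointMeasure X × PointMeasure X =>
        meckeIntegral z (ρ.restrict B.1) H (p.1 + p.2))
        ((measurable_meckeIntegral z hH).comp (by fun_prop))
    rw [lintegral_add_left hm1.lintegral_prod_right', lintegral_lintegral_swap hm1.aemeasurable,
      lintegral_const_mul _ hm2,
      ← lintegral_clusters_succ B k (measurable_meckeIntegral z hH)]
    simp_rw [lintegral_lintegral_cluster z ρ B hH]
    push_cast
    ring

/-- The Pólya sum process in a bounded set. -/
def localPolya (z : ℝ) (ρ : Measure X) (B : BoundedBorel X) : Measure (PointMeasure X) :=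
  Measure.sum fun k : ℕ => ((expSeries (siteRate z * ρ B.1))⁻¹ *
    ((k.factorial : ℕ) : ℝ≥0∞)⁻¹) • clusters z ρ B k

lemma lintegral_localPolya (z : ℝ) (ρ : Measure X) (B : BoundedBorel X)
    (F : PointMeasure X → ℝ≥0∞) : ∫⁻ μ, F μ ∂localPolya z ρ B =
      ∑' k : ℕ, (expSeries (siteRate z * ρ B.1))⁻¹ * ((k.factorial : ℕ) : ℝ≥0∞)⁻¹ *
        ∫⁻ μ, F μ ∂clusters z ρ B k := by
  rw [localPolya, lintegral_sum_measure]
  simp_rw [lintegral_smul_measure, smul_eq_mul]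

lemma isProbabilityMeasure_localPolya {z : ℝ} (hz : z < 1) (ρ : Measure X) [IsDiffuse ρ]
    (B : BoundedBorel X) : IsProbabilityMeasure (localPolya z ρ B) := by
  have hc : siteRate z * ρ B.1 ≠ ∞ :=
    (ENNReal.mul_lt_top (siteRate_lt_top hz) (IsDiffuse.lt_top B)).ne
  refine ⟨?_⟩
  rw [← lintegral_one, lintegral_localPolya]
  refine Eq.trans ?_ (tsum_poissonWeight hc)
  refine tsum_congr fun k => ?_
  rw [lintegral_one, clusters_univ, poissonWeight]
  ring

/-- The empty configuration contributes nothing, and the factor `k + 1` from `campbell_clusters`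
turns `1/(k+1)!` into `1/k!`. -/
lemma campbell_localPolya (z : ℝ) (ρ : Measure X) [SFinite ρ] (B : BoundedBorel X)
    {H : X → PointMeasure X → ℝ≥0∞} (hH : Measurable (Function.uncurry H)) :
    ∫⁻ μ, ∫⁻ x, H x μ ∂μ.toMeasure ∂localPolya z ρ B =
      ∫⁻ μ, meckeIntegral z (ρ.restrict B.1) H μ ∂localPolya z ρ B := by
  rw [lintegral_localPolya, lintegral_localPolya, tsum_eq_zero_add' ENNReal.summable,
    lintegral_clusters_zero]
  · simp only [toMeasure_zero, lintegral_zero_measure, mul_zero, zero_add]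
    refine tsum_congr fun k => ?_
    rw [campbell_clusters z ρ B k hH, mul_assoc, mul_assoc]
    congr 1
    rw [← mul_assoc, Nat.factorial_succ, Nat.cast_mul, mul_comm _ ((k.factorial : ℕ) : ℝ≥0∞),
      ENNReal.mul_inv (by simp) (by simp), mul_assoc _ _ ((k + 1 : ℕ) : ℝ≥0∞),
      ENNReal.inv_mul_cancel (by exact_mod_cast k.succ_ne_zero) (by simp), mul_one]
  · exact measurable_lintegral_toMeasure (f := fun μ => μ) (h := fun μ x => H x μ)
      measurable_id (hH.comp measurable_swap)

/-- The superposition of the configurations `ω n` in the cells. -/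
def superpose (ω : ℕ → PointMeasure X) : PointMeasure X where
  toMeasure := Measure.sum fun n => (ω n).toMeasure.restrict (cell X n).1
  exists_nat B := by
    obtain ⟨N, hN⟩ := exists_subset_exhaust B
    choose k hk using fun n => (ω n).exists_nat (B.inter (cell X n).1 (cell X n).2.2)
    -- Cells of index above `N` are disjoint from `exhaust X N`, which contains `B`; only finitely
    -- many terms remain.
    refine ⟨∑ n ∈ Finset.range (N + 1), k n, ?_⟩
    rw [Measure.sum_apply _ B.2.2, tsum_eq_sum (s := Finset.range (N + 1))]
    · push_cast
      refine Finset.sum_congr rfl fun n _ => ?_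
      rw [Measure.restrict_apply B.2.2, ← hk]
      rfl
    · intro n hn
      rw [Measure.restrict_apply B.2.2, ((disjoint_cell (by simpa using hn)).mono_left
        hN).inter_eq, measure_empty]

lemma toMeasure_superpose (ω : ℕ → PointMeasure X) :
    (superpose ω).toMeasure = Measure.sum fun n => (ω n).toMeasure.restrict (cell X n).1 := rfl

lemma measurable_superpose : Measurable (superpose (X := X)) := measurable_pointMeasure fun B => by
  simp only [toMeasure_superpose, Measure.sum_apply _ B.2.2, Measure.restrict_apply B.2.2]
  exact Measurable.tsum fun n => (measurable_apply (B.2.2.inter (cell X n).2.2)).comp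
    (measurable_pi_apply n)

lemma restrict_cell_superpose (ω : ℕ → PointMeasure X) (n : ℕ) :
    (superpose ω).restrict (cell X n).1 (cell X n).2.2 =
      (ω n).restrict (cell X n).1 (cell X n).2.2 := by
  ext1
  rw [toMeasure_restrict, toMeasure_superpose, Measure.restrict_sum _ (cell X n).2.2]
  ext1 S hS
  rw [Measure.sum_apply _ hS, tsum_eq_single n]
  · rw [Measure.restrict_restrict (cell X n).2.2, inter_self, toMeasure_restrict]
  · intro m hm
    rw [Measure.restrict_restrict (cell X n).2.2, (cell_disjoint hm.symm).inter_eq]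
    simp

lemma superpose_update (ω : ℕ → PointMeasure X) (n : ℕ) (ν : PointMeasure X) :
    superpose (Function.update ω n ν) = ν.restrict (cell X n).1 (cell X n).2.2 +
      (superpose ω).restrict (cell X n).1ᶜ (cell X n).2.2.compl := by
  rw [← restrict_add_restrict_compl (superpose (Function.update ω n ν)) (cell X n).2.2,
    restrict_cell_superpose, Function.update_self]
  congr 1
  ext1
  rw [toMeasure_restrict, toMeasure_restrict, toMeasure_superpose, toMeasure_superpose,
    Measure.restrict_sum _ (cell X n).2.2.compl, Measure.restrict_sum _ (cell X n).2.2.compl]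
  congr 1
  funext m
  by_cases hm : m = n
  · subst hm
    rw [Measure.restrict_restrict (cell X m).2.2.compl,
      Measure.restrict_restrict (cell X m).2.2.compl]
    simp
  · rw [Function.update_of_ne hm]

/-- Resampling one coordinate preserves a product of probability measures. -/
lemma map_update_infinitePi {Ω : Type*} [MeasurableSpace Ω] (Q : ℕ → Measure Ω)
    [∀ n, IsProbabilityMeasure (Q n)] (n : ℕ) :
    ((Measure.infinitePi Q).prod (Q n)).map (fun p => Function.update p.1 n p.2) =
      Measure.infinitePi Q := by
  have hm : Measurable fun p : (ℕ → Ω) × Ω => Function.update p.1 n p.2 := by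
    refine measurable_pi_lambda _ fun m => ?_
    by_cases hm : m = n
    · subst hm; simpa using measurable_snd
    · simp only [Function.update_of_ne hm]; fun_prop
  refine Measure.eq_infinitePi _ fun s t ht => ?_
  rw [Measure.map_apply hm (MeasurableSet.pi s.countable_toSet fun i _ => ht i)]
  have h : (fun p : (ℕ → Ω) × Ω => Function.update p.1 n p.2) ⁻¹' Set.pi s t =
      Set.pi (s.erase n) t ×ˢ (if n ∈ s then t n else univ) := by
    ext ⟨ω, x⟩
    simp only [mem_preimage, Set.mem_pi, mem_prod, Finset.coe_erase, Finset.mem_coe]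
    constructor
    · intro h
      refine ⟨fun i hi => ?_, ?_⟩
      · have h2 : i ≠ n := by simpa using hi.2
        simpa [Function.update_of_ne h2] using h i hi.1
      · split_ifs with hn
        · simpa using h n hn
        · trivial
    · rintro ⟨h1, h2⟩ i hi
      by_cases hin : i = n
      · subst hin
        simpa [hi] using h2
      · rw [Function.update_of_ne hin]
        exact h1 i ⟨hi, by simpa using hin⟩
  rw [h, Measure.prod_prod, Measure.infinitePi_pi Q (fun i _ => ht i)]
  split_ifs with hn
  · rw [mul_comm, Finset.mul_prod_erase s (fun i => Q i (t i)) hn]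
  · rw [Finset.erase_eq_of_notMem hn, measure_univ, mul_one]

lemma lintegral_update_infinitePi {Ω : Type*} [MeasurableSpace Ω] (Q : ℕ → Measure Ω)
    [∀ n, IsProbabilityMeasure (Q n)] (n : ℕ) {F : (ℕ → Ω) → ℝ≥0∞} (hF : Measurable F) :
    ∫⁻ ω, ∫⁻ x, F (Function.update ω n x) ∂Q n ∂Measure.infinitePi Q =
      ∫⁻ ω, F ω ∂Measure.infinitePi Q := by
  have hm : Measurable fun p : (ℕ → Ω) × Ω => Function.update p.1 n p.2 := by
    refine measurable_pi_lambda _ fun m => ?_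
    by_cases hm : m = n
    · subst hm; simpa using measurable_snd
    · simp only [Function.update_of_ne hm]; fun_prop
  conv_rhs => rw [← map_update_infinitePi Q n, lintegral_map hF hm]
  rw [lintegral_prod (fun p : (ℕ → Ω) × Ω => F (Function.update p.1 n p.2))
    (hF.comp hm).aemeasurable]

lemma lintegral_eq_tsum_cell (m : Measure X) (f : X → ℝ≥0∞) :
    ∫⁻ x, f x ∂m = ∑' n, ∫⁻ x in (cell X n).1, f x ∂m := by
  rw [← lintegral_iUnion (fun n => (cell X n).2.2) cell_disjoint, iUnion_cell,
    Measure.restrict_univ]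

section Existence

variable {z : ℝ} (ρ : Measure X) [IsDiffuse ρ]

/-- A law satisfying the Mecke formula of the Pólya sum process, with independent restrictions to
the cells. -/
def cellPolya (z : ℝ) (ρ : Measure X) : Measure (PointMeasure X) :=
  (Measure.infinitePi fun n => localPolya z ρ (cell X n)).map superpose

/-- The `n`-th coordinate is resampled with the others frozen; the frozen part `R` has no mass in
the cell, so the local formula `campbell_localPolya` applies to `H` shifted by `R`. -/
lemma campbell_superpose (hz : z < 1) {H : X → PointMeasure X → ℝ≥0∞}
    (hH : Measurable (Function.uncurry H)) (n : ℕ) :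
    ∫⁻ ω, ∫⁻ x in (cell X n).1, H x (superpose ω) ∂(superpose ω).toMeasure
        ∂(Measure.infinitePi fun n => localPolya z ρ (cell X n)) =
      ∫⁻ ω, meckeIntegral z (ρ.restrict (cell X n).1) H (superpose ω)
        ∂(Measure.infinitePi fun n => localPolya z ρ (cell X n)) := by
  have hprob : ∀ n, IsProbabilityMeasure (localPolya z ρ (cell X n)) := fun n =>
    isProbabilityMeasure_localPolya hz ρ _
  have hC := (cell X n).2.2
  have hm1 : Measurable fun μ : PointMeasure X => ∫⁻ x in (cell X n).1, H x μ ∂μ.toMeasure := by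
    simp_rw [← lintegral_indicator hC]
    exact measurable_lintegral_toMeasure (f := fun μ => μ) (h := fun μ x =>
      (cell X n).1.indicator (fun x => H x μ) x)
      measurable_id ((hH.comp measurable_swap).indicator (hC.preimage measurable_snd))
  rw [← lintegral_update_infinitePi _ n (F := fun ω => ∫⁻ x in (cell X n).1, H x (superpose ω)
      ∂(superpose ω).toMeasure) (hm1.comp measurable_superpose),
    ← lintegral_update_infinitePi _ n (F := fun ω => meckeIntegral z (ρ.restrict (cell X n).1) H
      (superpose ω)) ((measurable_meckeIntegral z hH).comp measurable_superpose)]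
  refine lintegral_congr fun ω => ?_
  simp only [superpose_update]
  set R := (superpose ω).restrict (cell X n).1ᶜ hC.compl with hR
  have hR0 : R.toMeasure (cell X n).1 = 0 := by
    rw [hR, toMeasure_restrict, Measure.restrict_apply hC, inter_compl_self, measure_empty]
  have hH' : Measurable (Function.uncurry fun x (ν : PointMeasure X) =>
      (cell X n).1.indicator (fun x => H x (ν.restrict (cell X n).1 hC + R)) x) :=
    (hH.comp (f := fun p : X × PointMeasure X => (p.1, p.2.restrict (cell X n).1 hC + R))
      (by fun_prop)).indicator (hC.preimage measurable_fst)
  have h := campbell_localPolya z ρ (cell X n) hH'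
  simp_rw [lintegral_indicator hC] at h
  have hl : ∀ ν : PointMeasure X, ∫⁻ x in (cell X n).1, H x (ν.restrict (cell X n).1 hC + R)
      ∂(ν.restrict (cell X n).1 hC + R).toMeasure =
      ∫⁻ x in (cell X n).1, H x (ν.restrict (cell X n).1 hC + R) ∂ν.toMeasure := by
    intro ν
    rw [toMeasure_add, Measure.restrict_add, Measure.restrict_eq_zero.2 hR0, add_zero,
      toMeasure_restrict, Measure.restrict_restrict hC, inter_self]
  simp_rw [hl]
  rw [h]
  refine lintegral_congr fun ν => tsum_congr fun j => ?_
  congr 1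
  refine setLIntegral_congr_fun hC fun x hx => ?_
  have hs : (site (j + 1) x : PointMeasure X).restrict (cell X n).1 hC = site (j + 1) x := by
    apply restrict_eq_self
    simp [toMeasure_site, Measure.dirac_apply' x hC.compl, hx]
  simp only [indicator_of_mem hx, restrict_add, hs, add_assoc]

lemma campbell_cellPolya (hz : z < 1) {H : X → PointMeasure X → ℝ≥0∞}
    (hH : Measurable (Function.uncurry H)) :
    ∫⁻ μ, ∫⁻ x, H x μ ∂μ.toMeasure ∂cellPolya z ρ =
      ∫⁻ μ, meckeIntegral z ρ H μ ∂cellPolya z ρ := by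
  have hm0 : Measurable fun μ : PointMeasure X => ∫⁻ x, H x μ ∂μ.toMeasure :=
    measurable_lintegral_toMeasure (f := fun μ => μ) (h := fun μ x => H x μ)
      measurable_id (hH.comp measurable_swap)
  have hm1 : ∀ n, Measurable fun μ : PointMeasure X =>
      ∫⁻ x in (cell X n).1, H x μ ∂μ.toMeasure := fun n => by
    simp_rw [← lintegral_indicator (cell X n).2.2]
    exact measurable_lintegral_toMeasure (f := fun μ => μ) (h := fun μ x =>
      (cell X n).1.indicator (fun x => H x μ) x)
      measurable_id ((hH.comp measurable_swap).indicator ((cell X n).2.2.preimage measurable_snd))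
  rw [cellPolya, lintegral_map hm0 measurable_superpose,
    lintegral_map (measurable_meckeIntegral z hH) measurable_superpose]
  simp_rw [lintegral_eq_tsum_cell (superpose _).toMeasure]
  rw [lintegral_tsum (f := fun n ω => ∫⁻ x in (cell X n).1, H x (superpose ω)
    ∂(superpose ω).toMeasure) fun n => ((hm1 n).comp measurable_superpose).aemeasurable]
  simp_rw [campbell_superpose ρ hz hH]
  rw [← lintegral_tsum (f := fun n ω => meckeIntegral z (ρ.restrict (cell X n).1) H
    (superpose ω)) fun n => ((measurable_meckeIntegral z hH).comp measurable_superpose).aemeasurable]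
  refine lintegral_congr fun ω => ?_
  simp_rw [meckeIntegral]
  rw [ENNReal.tsum_comm]
  refine tsum_congr fun j => ?_
  rw [ENNReal.tsum_mul_left, ← lintegral_eq_tsum_cell]

/-- The Mecke sum is self-similar: beyond its first term, it is `z` times the Mecke sum of the
function shifted by one point at `x`, and the latter is again a Campbell integral. -/
theorem isPolyaSumProcess_cellPolya (hz : z < 1) : IsPolyaSumProcess z ρ (cellPolya z ρ) := by
  have hprob : ∀ n, IsProbabilityMeasure (localPolya z ρ (cell X n)) := fun n =>
    isProbabilityMeasure_localPolya hz ρ _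
  refine ⟨Measure.isProbabilityMeasure_map measurable_superpose.aemeasurable, fun h hh => ?_⟩
  have hH : Measurable (Function.uncurry fun x μ => h (x, μ)) := hh
  have hH1 : Measurable (Function.uncurry fun x (μ : PointMeasure X) => h (x, site 1 x + μ)) :=
    hh.comp (f := fun p : X × PointMeasure X => (p.1, site 1 p.1 + p.2)) (by fun_prop)
  rw [campbell_cellPolya ρ hz hH]
  simp_rw [addPoint_eq, lintegral_add_measure]
  rw [lintegral_add_left (measurable_lintegral_site_add hH 1), campbell_cellPolya ρ hz hH1,
    ← lintegral_add_left (measurable_lintegral_site_add hH 1),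
    ← lintegral_const_mul' _ _ ENNReal.ofReal_ne_top]
  refine lintegral_congr fun μ => ?_
  rw [meckeIntegral, tsum_eq_zero_add' ENNReal.summable, mul_add, meckeIntegral,
    ← ENNReal.tsum_mul_left]
  simp only [zero_add, pow_one]
  congr 1
  refine tsum_congr fun j => ?_
  rw [← mul_assoc, ← pow_succ']
  congr 1
  refine lintegral_congr fun x => ?_
  rw [← add_assoc, ← site_add, add_comm 1]

end Existence

end PolyaSum

end

noncomputable section

/-! ### Uniqueness of the Pólya sum process. -/

namespace PolyaSum

open BoundedBorel PointMeasure

variable {X : Type*} [MeasurableSpace X] [Bornology X] [SigmaBounded X]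

variable (X) in
/-- The events that depend only on the configuration in a bounded set. -/
def localEvents : Set (Set (PointMeasure X)) :=
  {S | ∃ n : ℕ, ∃ A, MeasurableSet A ∧
    S = {μ | μ.restrict (exhaust X n).1 (exhaust X n).2.2 ∈ A}}

lemma generateFrom_localEvents :
    (inferInstance : MeasurableSpace (PointMeasure X)) =
      MeasurableSpace.generateFrom (localEvents X) := by
  apply le_antisymm
  · refine iSup_le fun B => ?_
    rintro _ ⟨A, hA, rfl⟩
    obtain ⟨n, hn⟩ := exists_subset_exhaust B
    refine MeasurableSpace.measurableSet_generateFrom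
      ⟨n, zeta B ⁻¹' A, measurable_zeta B hA, ?_⟩
    ext μ
    simp only [mem_preimage, mem_ofPred_eq, zeta, toMeasure_restrict,
      Measure.restrict_apply B.2.2, inter_eq_self_of_subset_left hn]
  · refine MeasurableSpace.generateFrom_le ?_
    rintro _ ⟨n, A, hA, rfl⟩
    exact measurable_restrict (exhaust X n).2.2 hA

lemma isPiSystem_localEvents : IsPiSystem (localEvents X) := by
  have key : ∀ {m n : ℕ}, m ≤ n → ∀ A, MeasurableSet A → ∃ A', MeasurableSet A' ∧
      {μ : PointMeasure X | μ.restrict (exhaust X m).1 (exhaust X m).2.2 ∈ A} =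
        {μ | μ.restrict (exhaust X n).1 (exhaust X n).2.2 ∈ A'} := fun {m n} hmn A hA => by
    refine ⟨_, measurable_restrict (exhaust X m).2.2 hA, ?_⟩
    ext μ
    simp only [mem_preimage, mem_ofPred_eq, restrict_restrict]
    rw [restrict_congr μ _ (inter_eq_self_of_subset_left (exhaust_mono hmn))]
  rintro _ ⟨m, A, hA, rfl⟩ _ ⟨n, A', hA', rfl⟩ -
  obtain ⟨A₁, hA₁, h₁⟩ := key (le_max_left m n) A hA
  obtain ⟨A₂, hA₂, h₂⟩ := key (le_max_right m n) A' hA'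
  exact ⟨max m n, A₁ ∩ A₂, hA₁.inter hA₂, by rw [h₁, h₂]; rfl⟩

/-- Finite laws of configurations are determined by their restrictions to bounded sets. -/
lemma ext_of_restrict {P Q : Measure (PointMeasure X)} [IsFiniteMeasure P]
    (h : ∀ B : BoundedBorel X, ∀ A, MeasurableSet A →
      P {μ | μ.restrict B.1 B.2.2 ∈ A} = Q {μ | μ.restrict B.1 B.2.2 ∈ A}) : P = Q := by
  refine ext_of_generate_finite _ generateFrom_localEvents isPiSystem_localEvents ?_ ?_
  · rintro _ ⟨n, A, hA, rfl⟩
    exact h _ A hA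
  · simpa using h (exhaust X 0) univ MeasurableSet.univ

variable [StandardBorelSpace X] {z : ℝ} {ρ : Measure X} [IsDiffuse ρ]

lemma siteMass_lt_top (hz : z < 1) (ρ : Measure X) [IsDiffuse ρ] (B : BoundedBorel X) :
    siteRate z * ρ B.1 < ∞ := ENNReal.mul_lt_top (siteRate_lt_top hz) (IsDiffuse.lt_top B)

/-- In `lintegral_xi_eq` the outside configuration is invisible to a function of the part in `B` and
integrates to one. So any solution has explicit local laws, whence uniqueness. -/
lemma lintegral_restrict_eq_localPolya (hz : z < 1) {P : Measure (PointMeasure X)}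
    (hP : IsPolyaSumProcess z ρ P) (B : BoundedBorel X) {F : PointMeasure X → ℝ≥0∞}
    (hF : Measurable F) :
    ∫⁻ μ, F (μ.restrict B.1 B.2.2) ∂P = ∫⁻ μ, F μ ∂localPolya z ρ B := by
  rw [lintegral_eq_tsum_xi B _ P, lintegral_localPolya]
  refine tsum_congr fun k => ?_
  rw [lintegral_xi_eq hz hP B k (by fun_prop)]
  congr 1
  have hprob := hP.1
  have h : ∀ ν μ : PointMeasure X, (ν + μ.restrict B.1ᶜ B.2.2.compl).restrict B.1 B.2.2 =
      ν.restrict B.1 B.2.2 := fun ν μ => by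
    rw [restrict_add, restrict_restrict, restrict_eq_zero (S := B.1 ∩ B.1ᶜ), add_zero]
    simp
  simp_rw [h, lintegral_clusters_restrict B k hF]
  simp

theorem IsPolyaSumProcess.unique (hz : z < 1) {P Q : Measure (PointMeasure X)}
    (hP : IsPolyaSumProcess z ρ P) (hQ : IsPolyaSumProcess z ρ Q) : P = Q := by
  have := hP.1
  refine ext_of_restrict fun B A hA => ?_
  have h := (lintegral_restrict_eq_localPolya hz hP B (measurable_one.indicator hA)).trans
    (lintegral_restrict_eq_localPolya hz hQ B (measurable_one.indicator hA)).symm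
  have h1 : ∀ P : Measure (PointMeasure X), ∫⁻ μ, A.indicator 1 (μ.restrict B.1 B.2.2) ∂P =
      P {μ | μ.restrict B.1 B.2.2 ∈ A} := fun P =>
    (lintegral_indicator_one (μ := P) (measurable_restrict B.2.2 hA))
  rwa [h1, h1] at h

lemma isPolyaSumProcess_polya (hz : z < 1) (ρ : Measure X) [IsDiffuse ρ] :
    IsPolyaSumProcess z ρ (polya z ρ) := by
  have h : ∃ P, IsPolyaSumProcess z ρ P := ⟨_, isPolyaSumProcess_cellPolya ρ hz⟩
  rw [polya, dif_pos h]
  exact h.choose_spec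

lemma isPolyaSumProcess_iff (hz : z < 1) (ρ : Measure X) [IsDiffuse ρ]
    (P : Measure (PointMeasure X)) : IsPolyaSumProcess z ρ P ↔ P = polya z ρ :=
  ⟨fun h => h.unique hz (isPolyaSumProcess_polya hz ρ), fun h => h ▸ isPolyaSumProcess_polya hz ρ⟩

lemma measure_xi_eq (hz : z < 1) {P : Measure (PointMeasure X)} (hP : IsPolyaSumProcess z ρ P)
    (B : BoundedBorel X) (k : ℕ) :
    P {μ | xi B μ = k} = poissonWeight (siteRate z * ρ B.1) k := by
  have := hP.1
  have h := lintegral_xi_eq hz hP B k measurable_one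
  simp only [Pi.one_apply, lintegral_one, Measure.restrict_apply_univ, lintegral_const,
    measure_univ, mul_one, clusters_univ] at h
  rw [h, poissonWeight]
  ring

lemma poissonWeight_eq_zero_iff {c : ℝ≥0∞} (hc : c ≠ ∞) (k : ℕ) :
    poissonWeight c k = 0 ↔ c ^ k = 0 := by
  simp [poissonWeight, ENNReal.inv_eq_zero, expSeries_ne_top hc]

/-! ### The σ-fields `sites B` and the gluing of configurations. -/

section Sites

/-- As `ζ_B` is finite, the truncated difference is the true mass of `B' \ B`. Conversely the mass
of `C \ B` is the increment from `B` to `C ∪ B`. -/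
lemma outside_eq (B : BoundedBorel X) : outside B = MeasurableSpace.comap
    (fun μ : PointMeasure X => μ.restrict B.1ᶜ B.2.2.compl) inferInstance := by
  have key : ∀ (B' : BoundedBorel X), B.1 ⊆ B'.1 → ∀ μ : PointMeasure X,
      zeta B' μ - zeta B μ = zeta B' (μ.restrict B.1ᶜ B.2.2.compl) := fun B' h μ => by
    rw [zeta, zeta, zeta, toMeasure_restrict, Measure.restrict_apply B'.2.2, ← sdiff_eq,
      measure_sdiff h B.2.2.nullMeasurableSet (μ.lt_top B).ne]
  apply le_antisymm
  · refine iSup_le fun B' => ?_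
    simp_rw [key B'.1 B'.2]
    rintro _ ⟨A, hA, rfl⟩
    exact ⟨_, measurable_zeta B'.1 hA, rfl⟩
  · rw [← measurable_iff_comap_le]
    refine @measurable_pointMeasure X _ _ _ (outside B) _ fun C => ?_
    have h : ∀ μ : PointMeasure X, (μ.restrict B.1ᶜ B.2.2.compl).toMeasure C.1 =
        zeta (C.union B) μ - zeta B μ := fun μ => by
      rw [key _ subset_union_right, zeta, toMeasure_restrict, Measure.restrict_apply C.2.2,
        Measure.restrict_apply (C.union B).2.2]
      congr 1
      ext x
      simp only [union, mem_inter_iff, mem_union, mem_compl_iff]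
      tauto
    simp_rw [h]
    rw [measurable_iff_comap_le]
    exact le_iSup (fun B' : {B' : BoundedBorel X // B.1 ⊆ B'.1} =>
      MeasurableSpace.comap (fun μ : PointMeasure X => zeta B'.1 μ - zeta B μ) inferInstance)
      ⟨C.union B, subset_union_right⟩

lemma measurable_sites_restrict (B : BoundedBorel X) :
    Measurable[sites B] fun μ : PointMeasure X => μ.restrict B.1ᶜ B.2.2.compl := by
  rw [measurable_iff_comap_le, ← outside_eq]
  exact le_sup_left

lemma measurableSet_sites_xi (B : BoundedBorel X) (n : ℕ∞) :
    MeasurableSet[sites B] {μ : PointMeasure X | xi B μ = n} := by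
  have h : MeasurableSpace.comap (xi B) ⊤ ≤ sites (X := X) B := le_sup_right
  exact h _ ⟨{n}, trivial, rfl⟩

lemma sites_le (B : BoundedBorel X) :
    sites B ≤ (inferInstance : MeasurableSpace (PointMeasure X)) := by
  refine sup_le ?_ ?_
  · rw [outside_eq, ← measurable_iff_comap_le]
    exact measurable_restrict _
  · rw [← measurable_iff_comap_le]
    exact measurable_xi B

/-- `ξ_B` is `ξ_{B'}` plus the number of sites in `B \ B'`, and the latter is read off the
configuration outside `B'`. -/
lemma sites_antitone {B B' : BoundedBorel X} (h : B'.1 ⊆ B.1) :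
    sites (X := X) B ≤ sites B' := by
  refine sup_le ?_ ?_
  · rw [outside_eq, ← measurable_iff_comap_le]
    have h1 : ∀ μ : PointMeasure X, μ.restrict B.1ᶜ B.2.2.compl =
        (μ.restrict B'.1ᶜ B'.2.2.compl).restrict B.1ᶜ B.2.2.compl := fun μ => by
      rw [restrict_restrict, restrict_congr μ _
        (inter_eq_self_of_subset_left (compl_subset_compl.2 h)).symm]
    rw [funext h1]
    exact (measurable_restrict B.2.2.compl).comp (measurable_sites_restrict B')
  · rintro _ ⟨A, -, rfl⟩
    have h1 : ∀ n : ℕ∞, {μ : PointMeasure X | xi (B.diff B') μ = n} =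
        (fun μ : PointMeasure X => μ.restrict B'.1ᶜ B'.2.2.compl) ⁻¹'
          {μ | xi (B.diff B') μ = n} := fun n => by
      ext μ
      simp only [mem_ofPred_eq, mem_preimage]
      rw [xi_congr (ν := μ.restrict B'.1ᶜ B'.2.2.compl) B'.2.2.compl inter_subset_right]
      rw [restrict_restrict, restrict_congr μ _ (inter_self _).symm]
    have h2 : xi B ⁻¹' A = ⋃ p : {p : ℕ∞ × ℕ∞ // p.1 + p.2 ∈ A},
        {μ : PointMeasure X | xi B' μ = p.1.1} ∩ {μ | xi (B.diff B') μ = p.1.2} := by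
      ext μ
      simp only [mem_preimage, mem_iUnion, xi_add_diff h μ]
      constructor
      · intro hμ
        exact ⟨⟨(xi B' μ, xi (B.diff B') μ), hμ⟩, rfl, rfl⟩
      · rintro ⟨⟨p, hp⟩, h1, h2⟩
        rw [mem_ofPred_eq] at h1 h2
        rw [h1, h2]
        exact hp
    rw [h2]
    refine MeasurableSet.iUnion fun p => (measurableSet_sites_xi B' _).inter ?_
    rw [h1]
    exact measurable_sites_restrict B' (measurableSet_xi_eq _ _)

/-- Events of `sites B` depend only on the outside configuration and the number of sites. -/
lemma mem_iff_of_measurableSet_sites {B : BoundedBorel X} {S : Set (PointMeasure X)}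
    (hS : MeasurableSet[sites B] S) {μ ν : PointMeasure X}
    (h : μ.restrict B.1ᶜ B.2.2.compl = ν.restrict B.1ᶜ B.2.2.compl) (hxi : xi B μ = xi B ν) :
    μ ∈ S ↔ ν ∈ S := by
  -- Only factorization through the pair is needed, so the target may carry the discrete σ-field.
  have hle : sites (X := X) B ≤ MeasurableSpace.comap
      (fun μ : PointMeasure X => (μ.restrict B.1ᶜ B.2.2.compl, xi B μ)) ⊤ := by
    refine sup_le ?_ ?_
    · rw [outside_eq]
      rintro _ ⟨A, -, rfl⟩
      exact ⟨Prod.fst ⁻¹' A, trivial, rfl⟩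
    · rintro _ ⟨A, -, rfl⟩
      exact ⟨Prod.snd ⁻¹' A, trivial, rfl⟩
  obtain ⟨A, -, rfl⟩ := hle _ hS
  simp only [mem_preimage, h, hxi]

lemma restrict_glue (B : BoundedBorel X) (ν μ : PointMeasure X) :
    (glue B ν μ).restrict B.1ᶜ B.2.2.compl = μ.restrict B.1ᶜ B.2.2.compl := by
  rw [glue_eq, restrict_add, restrict_restrict, restrict_restrict, restrict_eq_zero, zero_add,
    restrict_congr μ _ (inter_self _)]
  simp

lemma restrict_glue_self (B : BoundedBorel X) (ν μ : PointMeasure X) :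
    (glue B ν μ).restrict B.1 B.2.2 = ν.restrict B.1 B.2.2 := by
  rw [glue_eq, restrict_add, restrict_restrict, restrict_restrict, restrict_congr ν _
    (inter_self _), restrict_eq_zero (S := B.1 ∩ B.1ᶜ), add_zero]
  simp

lemma xi_glue {B B' : BoundedBorel X} (h : B'.1 ⊆ B.1) (ν μ : PointMeasure X) :
    xi B' (glue B ν μ) = xi B' ν := xi_congr B.2.2 h (restrict_glue_self B ν μ)

lemma glue_glue {B B' : BoundedBorel X} (h : B'.1 ⊆ B.1) (ν' ν μ : PointMeasure X) :
    glue B' ν' (glue B ν μ) = glue B (glue B' ν' ν) μ := by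
  simp only [glue_eq, restrict_add, restrict_restrict]
  rw [restrict_congr ν' (B.2.2.inter B'.2.2) (inter_eq_self_of_subset_right h),
    restrict_congr μ (B'.2.2.compl.inter B.2.2.compl)
      (inter_eq_self_of_subset_right (compl_subset_compl.2 h)), add_assoc,
    restrict_congr ν (B'.2.2.compl.inter B.2.2) (inter_comm _ _)]

end Sites

end PolyaSum

end

noncomputable section

/-! ### The kernels `siteKernel` form a local specification. -/

namespace PolyaSum

open BoundedBorel PointMeasure

variable {X : Type*} [MeasurableSpace X] [Bornology X] [SigmaBounded X] [StandardBorelSpace X]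
  {z : ℝ} {ρ : Measure X} [IsDiffuse ρ]

lemma isProbabilityMeasure_polya (hz : z < 1) (ρ : Measure X) [IsDiffuse ρ] :
    IsProbabilityMeasure (polya z ρ) := (isPolyaSumProcess_polya hz ρ).1

lemma polya_xi_eq_zero_iff (hz : z < 1) (B : BoundedBorel X) (k : ℕ) :
    polya z ρ {μ | xi B μ = k} = 0 ↔ (siteRate z * ρ B.1) ^ k = 0 := by
  rw [measure_xi_eq hz (isPolyaSumProcess_polya hz ρ),
    poissonWeight_eq_zero_iff (siteMass_lt_top hz ρ B).ne]

instance isProbabilityMeasure_condLaw [Fact (z < 1)] (B : BoundedBorel X) (n : ℕ∞) :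
    IsProbabilityMeasure (condLaw z ρ B n) := by
  have := isProbabilityMeasure_polya (Fact.out : z < 1) ρ
  rw [condLaw]
  split_ifs with h
  · assumption
  · exact cond_isProbabilityMeasure h

lemma measurable_glue_left (B : BoundedBorel X) (μ : PointMeasure X) :
    Measurable fun ν => glue B ν μ := (measurable_glue B).comp (measurable_id.prodMk measurable_const)

lemma lintegral_siteKernel (B : BoundedBorel X) (μ : PointMeasure X) {F : PointMeasure X → ℝ≥0∞}
    (hF : Measurable F) :
    ∫⁻ ν, F ν ∂siteKernel z ρ B μ = ∫⁻ ν, F (glue B ν μ) ∂condLaw z ρ B (xi B μ) := by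
  rw [siteKernel, lintegral_map hF (measurable_glue_left B μ)]

instance isProbabilityMeasure_siteKernel [Fact (z < 1)] (B : BoundedBorel X)
    (μ : PointMeasure X) : IsProbabilityMeasure (siteKernel z ρ B μ) :=
  Measure.isProbabilityMeasure_map (measurable_glue_left B μ).aemeasurable

lemma lintegral_condLaw_of_ne_zero {B : BoundedBorel X} {n : ℕ∞}
    (h : polya z ρ {ν | xi B ν = n} ≠ 0) (F : PointMeasure X → ℝ≥0∞) :
    ∫⁻ ν, F ν ∂condLaw z ρ B n =
      (polya z ρ {ν | xi B ν = n})⁻¹ * ∫⁻ ν in {ν | xi B ν = n}, F ν ∂polya z ρ := by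
  rw [condLaw, if_neg h, ProbabilityTheory.cond, lintegral_smul_measure, smul_eq_mul]

lemma ae_xi_condLaw {B : BoundedBorel X} {n : ℕ∞} (h : polya z ρ {ν | xi B ν = n} ≠ 0) :
    ∀ᵐ ν ∂condLaw z ρ B n, xi B ν = n := by
  rw [condLaw, if_neg h, ProbabilityTheory.cond]
  exact Measure.ae_smul_measure (ae_restrict_mem (measurableSet_xi_eq B n)) _

/-- Given `k` occupied sites in `B`, the configuration in `B` consists of `k` clusters. -/
lemma lintegral_glue_condLaw (hz : z < 1) (B : BoundedBorel X) {k : ℕ}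
    (hk : (siteRate z * ρ B.1) ^ k ≠ 0) {F : PointMeasure X → ℝ≥0∞} (hF : Measurable F)
    (μ : PointMeasure X) :
    ∫⁻ ν, F (glue B ν μ) ∂condLaw z ρ B k =
      ((siteRate z * ρ B.1) ^ k)⁻¹ *
        ∫⁻ ν, F (ν + μ.restrict B.1ᶜ B.2.2.compl) ∂clusters z ρ B k := by
  have := isProbabilityMeasure_polya hz ρ
  have hc := siteMass_lt_top hz ρ B
  have hF' : Measurable fun ν => F (glue B ν μ) := hF.comp (measurable_glue_left B μ)
  rw [lintegral_condLaw_of_ne_zero ((polya_xi_eq_zero_iff hz B k).not.2 hk),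
    lintegral_xi_eq hz (isPolyaSumProcess_polya hz ρ) B k hF',
    measure_xi_eq hz (isPolyaSumProcess_polya hz ρ)]
  -- Gluing discards the outside part `κ`, so the outer integral in `lintegral_xi_eq` is over a
  -- constant.
  have h1 : ∀ κ : PointMeasure X, ∫⁻ ν, F (glue B (ν + κ.restrict B.1ᶜ B.2.2.compl) μ)
      ∂clusters z ρ B k = ∫⁻ ν, F (ν + μ.restrict B.1ᶜ B.2.2.compl) ∂clusters z ρ B k := fun κ => by
    rw [← lintegral_clusters_restrict B k
      (F := fun ν => F (ν + μ.restrict B.1ᶜ B.2.2.compl)) (by fun_prop)]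
    refine lintegral_congr fun ν => ?_
    rw [glue_eq, restrict_add, restrict_restrict, restrict_eq_zero (S := B.1 ∩ B.1ᶜ), add_zero]
    simp
  simp_rw [h1]
  rw [lintegral_const, measure_univ, mul_one, ← mul_assoc]
  congr 1
  have hf : ((k.factorial : ℕ) : ℝ≥0∞) ≠ 0 := by exact_mod_cast k.factorial_ne_zero
  have he : (expSeries (siteRate z * ρ B.1))⁻¹ * ((k.factorial : ℕ) : ℝ≥0∞)⁻¹ ≠ 0 := by
    simp [ENNReal.inv_eq_zero, expSeries_ne_top hc.ne]
  have he' : (expSeries (siteRate z * ρ B.1))⁻¹ * ((k.factorial : ℕ) : ℝ≥0∞)⁻¹ ≠ ∞ :=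
    ENNReal.mul_ne_top (ENNReal.inv_ne_top.2 (expSeries_ne_zero _)) (ENNReal.inv_ne_top.2 hf)
  have hw : poissonWeight (siteRate z * ρ B.1) k = (expSeries (siteRate z * ρ B.1))⁻¹ *
      ((k.factorial : ℕ) : ℝ≥0∞)⁻¹ * (siteRate z * ρ B.1) ^ k := by rw [poissonWeight]; ring
  rw [hw, ENNReal.mul_inv (Or.inl he) (Or.inl he'),
    mul_right_comm, ENNReal.inv_mul_cancel he he', one_mul]

/-- The kernel sees `μ` only through its outside restriction and the countably valued `ξ_B`. -/
lemma measurable_sites_lintegral_siteKernel [Fact (z < 1)] (B : BoundedBorel X)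
    {F : PointMeasure X → ℝ≥0∞} (hF : Measurable F) :
    Measurable[sites B] fun μ => ∫⁻ ν, F ν ∂siteKernel z ρ B μ := by
  have h1 : ∀ n : ℕ∞, Measurable[sites B] fun μ : PointMeasure X =>
      ∫⁻ ν, F (glue B ν μ) ∂condLaw z ρ B n := fun n => by
    have hm : Measurable fun κ : PointMeasure X =>
        ∫⁻ ν, F (ν.restrict B.1 B.2.2 + κ) ∂condLaw z ρ B n :=
      Measurable.lintegral_prod_right' (f := fun p : PointMeasure X × PointMeasure X =>
        F (p.2.restrict B.1 B.2.2 + p.1)) (by fun_prop)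
    exact hm.comp (measurable_sites_restrict B)
  intro S hS
  have h2 : (fun μ => ∫⁻ ν, F ν ∂siteKernel z ρ B μ) ⁻¹' S = ⋃ n : ℕ∞, {μ | xi B μ = n} ∩
      (fun μ : PointMeasure X => ∫⁻ ν, F (glue B ν μ) ∂condLaw z ρ B n) ⁻¹' S := by
    ext μ
    simp only [mem_preimage, mem_iUnion, mem_inter_iff, mem_ofPred_eq, exists_eq_left',
      lintegral_siteKernel B μ hF]
  rw [h2]
  exact MeasurableSet.iUnion fun n => (measurableSet_sites_xi B n).inter (h1 n hS)

/-- Resampling keeps both the outside and the number of sites, so `f` stays constant and factors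
out. Positivity of the conditioning event matters: with the default law in `condLaw` the number of
sites need not be kept. -/
lemma lintegral_eq_of_measurable_sites {B : BoundedBorel X} [Fact (z < 1)]
    {f : PointMeasure X → ℝ≥0∞} (hf : Measurable[sites B] f) {μ : PointMeasure X}
    (hμ : polya z ρ {ν | xi B ν = xi B μ} ≠ 0) (G : PointMeasure X → ℝ≥0∞) (hG : Measurable G) :
    ∫⁻ ν, f ν * G ν ∂siteKernel z ρ B μ = f μ * ∫⁻ ν, G ν ∂siteKernel z ρ B μ := by
  have hf' : Measurable f := hf.mono (sites_le B) le_rfl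
  rw [lintegral_siteKernel B μ (F := fun ν => f ν * G ν) (hf'.mul hG), lintegral_siteKernel B μ hG,
    ← lintegral_const_mul _
      (f := fun ν => G (glue B ν μ)) (hG.comp (measurable_glue_left B μ))]
  refine lintegral_congr_ae ?_
  filter_upwards [ae_xi_condLaw hμ] with ν hν
  have h : f (glue B ν μ) = f μ := (mem_iff_of_measurableSet_sites
    (hf (measurableSet_singleton (f μ))) (restrict_glue B ν μ) ((xi_glue subset_rfl ν μ).trans hν)).2
    rfl
  rw [h]

/-- The Pólya sum processes for multiples of `ρ` satisfy the equilibrium equations. -/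
lemma lintegral_lintegral_siteKernel [hz : Fact (z < 1)] (w : ℝ≥0) (B : BoundedBorel X)
    {F : PointMeasure X → ℝ≥0∞} (hF : Measurable F) :
    ∫⁻ μ, ∫⁻ ν, F ν ∂siteKernel z ρ B μ ∂polya z (w • ρ) = ∫⁻ μ, F μ ∂polya z (w • ρ) := by
  have hz := hz.out
  have hP := isPolyaSumProcess_polya hz (w • ρ)
  rw [lintegral_eq_tsum_xi B, lintegral_eq_tsum_xi B F]
  refine tsum_congr fun k => ?_
  have hcw : siteRate z * (w • ρ) B.1 = w * (siteRate z * ρ B.1) := by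
    rw [Measure.smul_apply, ENNReal.smul_def, smul_eq_mul, mul_left_comm]
  -- If the event is null both sides vanish. Otherwise it also has positive probability for `ρ`, so
  -- `condLaw` is a genuine conditioning.
  by_cases h0 : (siteRate z * (w • ρ) B.1) ^ k = 0
  · rw [Measure.restrict_eq_zero.2 ((polya_xi_eq_zero_iff hz B k).2 h0)]
    simp
  have hk : (siteRate z * ρ B.1) ^ k ≠ 0 := fun h => h0 (by rw [hcw, mul_pow, h, mul_zero])
  have hk' : (siteRate z * ρ B.1) ^ k ≠ ∞ := ENNReal.pow_ne_top (siteMass_lt_top hz ρ B).ne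
  have hm : Measurable fun κ : PointMeasure X =>
      ((siteRate z * ρ B.1) ^ k)⁻¹ * ∫⁻ ν, F (ν + κ) ∂clusters z ρ B k :=
    (measurable_lintegral_add hF).const_mul _
  have h1 : ∫⁻ μ in {μ | xi B μ = k}, ∫⁻ ν, F ν ∂siteKernel z ρ B μ ∂polya z (w • ρ) =
      ∫⁻ μ in {μ | xi B μ = k}, ((siteRate z * ρ B.1) ^ k)⁻¹ *
        ∫⁻ ν, F (ν + μ.restrict B.1ᶜ B.2.2.compl) ∂clusters z ρ B k ∂polya z (w • ρ) := by
    refine setLIntegral_congr_fun (measurableSet_xi_eq B k) fun μ hμ => ?_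
    rw [mem_ofPred_eq] at hμ
    rw [lintegral_siteKernel B μ hF, hμ, lintegral_glue_condLaw hz B hk hF]
  rw [h1, lintegral_xi_eq hz hP B k (F := fun μ => ((siteRate z * ρ B.1) ^ k)⁻¹ *
        ∫⁻ ν, F (ν + μ.restrict B.1ᶜ B.2.2.compl) ∂clusters z ρ B k)
        (hm.comp (measurable_restrict B.2.2.compl)), lintegral_xi_eq hz hP B k hF]
  congr 1
  -- The mass of `k` clusters of `w • ρ` cancels against the inverse mass for `ρ` and leaves `w ^
  -- k`, exactly the ratio given by `clusters_smul`.
  refine lintegral_congr fun μ => ?_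
  rw [lintegral_clusters_add_restrict_compl (ρ := w • ρ) B k hm, restrict_restrict,
    restrict_congr μ _ (inter_self _), restrict_congr μ (S := B.1ᶜ) _ rfl, hcw, mul_pow, mul_assoc,
    ← mul_assoc _ _⁻¹, ENNReal.mul_inv_cancel hk hk', one_mul, clusters_smul,
    lintegral_smul_measure, smul_eq_mul]

/-- A value of `ξ_B` that is null for `ρ` is null for `w • ρ`, so the default branch of `condLaw` is
almost surely not met. -/
lemma ae_polya_xi_ne_zero (hz : z < 1) (w : ℝ≥0) (B : BoundedBorel X) :
    ∀ᵐ μ ∂polya z (w • ρ), polya z ρ {ν | xi B ν = xi B μ} ≠ 0 := by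
  have h : {μ : PointMeasure X | ¬ polya z ρ {ν | xi B ν = xi B μ} ≠ 0} ⊆
      ⋃ k : ℕ, {μ | xi B μ = k ∧ polya z ρ {ν | xi B ν = k} = 0} := by
    intro μ hμ
    obtain ⟨k, hk⟩ := exists_xi_eq B μ
    rw [mem_ofPred_eq, not_not, hk] at hμ
    exact mem_iUnion.2 ⟨k, hk, hμ⟩
  refine measure_mono_null h (measure_iUnion_null fun k => ?_)
  by_cases hk : polya z ρ {ν | xi B ν = k} = 0
  · simp only [hk, and_true]
    rw [polya_xi_eq_zero_iff hz] at hk ⊢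
    rw [Measure.smul_apply, ENNReal.smul_def, smul_eq_mul, mul_left_comm, mul_pow, hk, mul_zero]
  · simp [hk]

lemma setLIntegral_siteKernel [hz : Fact (z < 1)] (w : ℝ≥0) (B : BoundedBorel X)
    {F : PointMeasure X → ℝ≥0∞} (hF : Measurable F) {S : Set (PointMeasure X)}
    (hS : MeasurableSet[sites B] S) :
    ∫⁻ μ in S, ∫⁻ ν, F ν ∂siteKernel z ρ B μ ∂polya z (w • ρ) =
      ∫⁻ μ in S, F μ ∂polya z (w • ρ) := by
  have hS' := sites_le B _ hS
  have hmul : ∀ F : PointMeasure X → ℝ≥0∞, S.indicator F = fun μ => S.indicator 1 μ * F μ :=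
    fun F => by ext μ; by_cases hμ : μ ∈ S <;> simp [hμ]
  rw [← lintegral_indicator hS', ← lintegral_indicator hS',
    ← lintegral_lintegral_siteKernel (ρ := ρ) w B (hF.indicator hS'), hmul, hmul F]
  refine lintegral_congr_ae ?_
  filter_upwards [ae_polya_xi_ne_zero hz.out w B] with μ hμ
  exact (lintegral_eq_of_measurable_sites (Measurable.indicator (m := sites B)
    (f := 1) (@measurable_const _ _ _ (sites B) 1) hS) hμ F hF).symm

/-- The conditioning event lies in `sites B`, hence in `sites B'`, so the invariance of `Poy_{z,ρ}`
survives the conditioning. -/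
lemma lintegral_condLaw_siteKernel [hz : Fact (z < 1)] {B B' : BoundedBorel X} (h : B'.1 ⊆ B.1)
    (n : ℕ∞) {F : PointMeasure X → ℝ≥0∞} (hF : Measurable F) :
    ∫⁻ μ, ∫⁻ ν, F ν ∂siteKernel z ρ B' μ ∂condLaw z ρ B n = ∫⁻ μ, F μ ∂condLaw z ρ B n := by
  by_cases hn : polya z ρ {ν | xi B ν = n} = 0
  · rw [condLaw, if_pos hn]
    simpa using lintegral_lintegral_siteKernel (ρ := ρ) 1 B' hF
  · rw [lintegral_condLaw_of_ne_zero hn, lintegral_condLaw_of_ne_zero hn]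
    congr 1
    simpa using setLIntegral_siteKernel (ρ := ρ) 1 B' hF
      (sites_antitone h _ (measurableSet_sites_xi B n))

/-- Resampling in `B'` commutes with gluing along `B` (`glue_glue`), so consistency reduces to the
invariance of `condLaw` under the smaller kernel. -/
lemma siteKernel_consistent [hz : Fact (z < 1)] {B B' : BoundedBorel X} (h : B'.1 ⊆ B.1)
    (μ : PointMeasure X) {F : PointMeasure X → ℝ≥0∞} (hF : Measurable F) :
    ∫⁻ ν, ∫⁻ κ, F κ ∂siteKernel z ρ B' ν ∂siteKernel z ρ B μ = ∫⁻ ν, F ν ∂siteKernel z ρ B μ := by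
  have hF' : Measurable fun ν => F (glue B ν μ) := hF.comp (measurable_glue_left B μ)
  rw [lintegral_siteKernel B μ hF, lintegral_siteKernel B μ
    ((measurable_sites_lintegral_siteKernel B' hF).mono (sites_le B') le_rfl),
    ← lintegral_condLaw_siteKernel h _ hF']
  refine lintegral_congr fun ν => ?_
  rw [lintegral_siteKernel B' _ hF, lintegral_siteKernel B' _ hF', xi_glue h]
  simp_rw [glue_glue h]

theorem isLocalSpecification_siteKernel (hz : z < 1) (ρ : Measure X) [IsDiffuse ρ] :
    IsLocalSpecification sites (siteKernel z ρ)
      (fun B => {μ | polya z ρ {ν | xi B ν = xi B μ} = 0}) := by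
  have : Fact (z < 1) := ⟨hz⟩
  have hA : ∀ (B : BoundedBorel X) (μ : PointMeasure X) A, MeasurableSet A →
      siteKernel z ρ B μ A = ∫⁻ ν, A.indicator 1 ν ∂siteKernel z ρ B μ := fun B μ A hA =>
    (lintegral_indicator_one hA).symm
  refine ⟨sites_le, fun B B' h => sites_antitone h, fun B μ => inferInstance, ?_, ?_, ?_⟩
  · intro B B' h μ A hA'
    simp_rw [hA _ _ A hA']
    exact siteKernel_consistent h μ (measurable_one.indicator hA')
  · intro B A hA'
    simp_rw [hA _ _ A hA']
    exact measurable_sites_lintegral_siteKernel B (measurable_one.indicator hA')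
  · intro B f hf μ hμ
    simpa using lintegral_eq_of_measurable_sites hf hμ 1 measurable_one

end PolyaSum

end

noncomputable section

/-! ### Convergence of bounded backward martingales. -/

namespace PolyaSum

section BackwardMartingale

open Filter
open scoped Topology

variable {Ω : Type*} {m0 : MeasurableSpace Ω} {P : Measure Ω} [IsProbabilityMeasure P]

/-- The maximal inequality for backward martingales. -/
lemma measure_exists_le_condExp_antitone {𝒢 : ℕ → MeasurableSpace Ω} (hanti : Antitone 𝒢)
    (hle : ∀ n, 𝒢 n ≤ m0) (φ : Ω → ℝ) (N : ℕ) {ε : ℝ≥0} (hε : ε ≠ 0) :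
    P {ω | ∃ n ≤ N, (ε : ℝ) ≤ |(P[φ | 𝒢 n]) ω|} ≤ ENNReal.ofReal (∫ ω, |φ ω| ∂P) / ε := by
  -- Reversing time on `0, …, N` gives a forward martingale, to which Doob's inequality applies; the
  -- truncation of `N - k` keeps the filtration monotone beyond `N`.
  let ℱ : Filtration ℕ m0 := ⟨fun k => 𝒢 (N - k), fun i j hij => hanti (by omega), fun k => hle _⟩
  have hM : Martingale (fun k => P[φ | ℱ k]) ℱ P := martingale_condExp φ ℱ P
  have hsub := hM.submartingale.sup hM.neg.submartingale
  have hmax := maximal_ineq hsub (fun k ω => by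
    simp only [Pi.zero_apply, Pi.sup_apply, Pi.neg_apply]
    exact abs_nonneg ((P[φ | ℱ k]) ω)) (ε := ε) N
  rw [ENNReal.le_div_iff_mul_le (by simp [hε]) (by simp), mul_comm]
  refine (mul_le_mul_right (measure_mono ?_) _).trans (hmax.trans (ENNReal.ofReal_le_ofReal ?_))
  · rintro ω ⟨n, hn, hω⟩
    rw [mem_ofPred_eq]
    refine hω.trans ?_
    have : N - (N - n) = n := by omega
    have h2 : |(P[φ | 𝒢 n]) ω| = ((fun k => P[φ | ℱ k]) ⊔ -fun k => P[φ | ℱ k]) (N - n) ω := by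
      change _ = |(P[φ | 𝒢 (N - (N - n))]) ω|
      rw [this]
    rw [h2]
    exact Finset.le_sup' (fun k => ((fun k => P[φ | ℱ k]) ⊔ -fun k => P[φ | ℱ k]) k ω)
      (Finset.mem_range.2 (by omega))
  · refine (setIntegral_le_integral (integrable_condExp.abs) ?_).trans (integral_abs_condExp_le φ)
    exact Eventually.of_forall fun ω => abs_nonneg _

/-- Bounded backward martingales converge almost surely. -/
theorem ae_cauchySeq_condExp_antitone {𝒢 : ℕ → MeasurableSpace Ω} (hanti : Antitone 𝒢)
    (hle : ∀ n, 𝒢 n ≤ m0) {f : Ω → ℝ} (hbd : ∀ᵐ ω ∂P, |f ω| ≤ 1) :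
    ∀ᵐ ω ∂P, CauchySeq fun n => (P[f | 𝒢 n]) ω := by
  set g : ℕ → Ω → ℝ := fun n => P[f | 𝒢 n] with hg
  have hgbd : ∀ n, ∀ᵐ ω ∂P, |g n ω| ≤ 1 := fun n => by
    simpa using ae_bdd_abs_condExp_of_ae_bdd_abs (m := 𝒢 n) (R := 1) (by simpa using hbd)
  have hgsm : ∀ n, StronglyMeasurable[𝒢 n] (g n) := fun n => stronglyMeasurable_condExp
  have hgm : ∀ n, AEStronglyMeasurable (g n) P := fun n =>
    ((hgsm n).mono (hle n)).aestronglyMeasurable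
  have hgL : ∀ n, MemLp (g n) 2 P := fun n => MemLp.of_bound (hgm n) 1 (hgbd n)
  have hgi : ∀ n, Integrable (g n) P := fun n => integrable_condExp
  have htower : ∀ {m n : ℕ}, m ≤ n → P[g m | 𝒢 n] =ᵐ[P] g n := fun {m n} hmn =>
    condExp_condExp_of_le (hanti hmn) (hle m)
  -- Orthogonality of increments: `g n` is the projection of `g m`. So squared increments telescope
  -- to differences of `a`, which decreases to its infimum `L`.
  have hprod : ∀ {m n : ℕ}, m ≤ n → ∫ ω, g m ω * g n ω ∂P = ∫ ω, g n ω * g n ω ∂P := by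
    intro m n hmn
    have h1 := condExp_mul_of_stronglyMeasurable_right (μ := P) (f := g m) (hgsm n)
      ((hgL m).integrable_mul (hgL n)) (hgi m)
    have h2 := integral_condExp (μ := P) (f := g m * g n) (hle n)
    rw [show ∫ ω, g m ω * g n ω ∂P = ∫ ω, (g m * g n) ω ∂P from rfl, ← h2]
    refine integral_congr_ae ?_
    filter_upwards [h1, htower hmn] with ω h3 h4
    rw [h3, Pi.mul_apply, h4]
  set a : ℕ → ℝ := fun n => ∫ ω, g n ω * g n ω ∂P with ha
  have hsq : ∀ {m n : ℕ}, m ≤ n → ∫ ω, (g m ω - g n ω) ^ 2 ∂P = a m - a n := by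
    intro m n hmn
    have hi : ∀ i j, Integrable (fun ω => g i ω * g j ω) P := fun i j =>
      (hgL i).integrable_mul (hgL j)
    have h1 : ∀ ω, (g m ω - g n ω) ^ 2 = g m ω * g m ω - 2 * (g m ω * g n ω) + g n ω * g n ω :=
      fun ω => by ring
    simp_rw [h1]
    have h2 : Integrable (fun ω => g m ω * g m ω - 2 * (g m ω * g n ω)) P :=
      (hi m m).sub ((hi m n).const_mul 2)
    rw [integral_add h2 (hi n n), integral_sub (hi m m) ((hi m n).const_mul 2), integral_const_mul, hprod hmn]
    ring
  have ha_anti : Antitone a := fun m n hmn => by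
    have := hsq hmn
    have h0 : 0 ≤ ∫ ω, (g m ω - g n ω) ^ 2 ∂P := integral_nonneg fun ω => sq_nonneg _
    linarith
  have ha_bdd : BddBelow (range a) :=
    ⟨0, by rintro _ ⟨n, rfl⟩; exact integral_nonneg fun ω => mul_self_nonneg _⟩
  set L := ⨅ n, a n with hL
  have haL : Tendsto a atTop (𝓝 L) := tendsto_atTop_ciInf ha_anti ha_bdd
  -- Nonnegativity of the variance bounds the `L¹` norm by the `L²` norm.
  have hL1 : ∀ {m n : ℕ}, m ≤ n → ∫ ω, |g m ω - g n ω| ∂P ≤ √(a m - L) := by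
    intro m n hmn
    apply Real.le_sqrt_of_sq_le
    have hv := variance_nonneg (fun ω => |g m ω - g n ω|) P
    have hmem : MemLp (fun ω => |g m ω - g n ω|) 2 P := ((hgL m).sub (hgL n)).norm
    rw [variance_eq_sub hmem] at hv
    have h2 : P[(fun ω => |g m ω - g n ω|) ^ 2] = a m - a n := by
      rw [← hsq hmn]
      exact integral_congr_ae (Eventually.of_forall fun ω => by simp)
    rw [h2] at hv
    have h3 : L ≤ a n := ciInf_le ha_bdd n
    linarith
  have key : ∀ ε : ℝ≥0, ε ≠ 0 → ∀ᵐ ω ∂P, ∃ m, ∀ n, m ≤ n → |g n ω - g m ω| < 2 * ε := by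
    intro ε hε
    have hE : ∀ m, P {ω | ∃ n, m ≤ n ∧ 2 * (ε : ℝ) ≤ |g n ω - g m ω|} ≤
        ENNReal.ofReal (√(a m - L)) / ε := by
      intro m
      have h1 : {ω | ∃ n, m ≤ n ∧ 2 * (ε : ℝ) ≤ |g n ω - g m ω|} =
          ⋃ N, {ω | ∃ n, (m ≤ n ∧ n ≤ N) ∧ 2 * (ε : ℝ) ≤ |g n ω - g m ω|} := by
        ext ω
        simp only [mem_ofPred_eq, mem_iUnion]
        exact ⟨fun ⟨n, hn, h⟩ => ⟨n, n, ⟨hn, le_rfl⟩, h⟩, fun ⟨_, n, hn, h⟩ => ⟨n, hn.1, h⟩⟩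
      have hmono : Monotone fun N => {ω | ∃ n, (m ≤ n ∧ n ≤ N) ∧ 2 * (ε : ℝ) ≤ |g n ω - g m ω|} := by
        rintro i j hij ω ⟨n, hn, h⟩
        exact ⟨n, ⟨hn.1, hn.2.trans hij⟩, h⟩
      rw [h1, hmono.measure_iUnion]
      refine iSup_le fun N => ?_
      by_cases hmN : m ≤ N
      · refine le_trans ?_ ((measure_exists_le_condExp_antitone hanti hle
          (fun ω => g m ω - g N ω) N hε).trans
          (ENNReal.div_le_div_right (ENNReal.ofReal_le_ofReal (hL1 hmN)) _))
        -- `g n - g N` is the backward martingale of `g m - g N`, whose `L¹` norm is small for large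
        -- `m`.
        have hce : ∀ᵐ ω ∂P, ∀ n, m ≤ n → n ≤ N →
            (P[fun ω => g m ω - g N ω | 𝒢 n]) ω = g n ω - g N ω := by
          rw [ae_all_iff]
          intro n
          by_cases hn : m ≤ n ∧ n ≤ N
          · have h2 := condExp_sub (μ := P) (hgi m) (hgi N) (𝒢 n)
            have h3 : P[g N | 𝒢 n] =ᵐ[P] g N := by
              rw [condExp_of_stronglyMeasurable (hle n) ((hgsm N).mono (hanti hn.2)) (hgi N)]
            filter_upwards [h2, h3, htower hn.1] with ω h4 h5 h6 _ _
            change (P[g m - g N | 𝒢 n]) ω = _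
            rw [h4, Pi.sub_apply, h5, h6]
          · exact Eventually.of_forall fun ω h1 h2 => absurd ⟨h1, h2⟩ hn
        refine measure_mono_ae ?_
        filter_upwards [hce] with ω hω
        rintro ⟨n, ⟨hn1, hn2⟩, h⟩
        -- A deviation of `2ε` between `n` and `m` forces one of at least `ε` from `g N`, either at
        -- `n` or at `m`.
        by_cases hc : (ε : ℝ) ≤ |g n ω - g N ω|
        · exact ⟨n, hn2, by rwa [hω n hn1 hn2]⟩
        · refine ⟨m, hmN, ?_⟩
          rw [hω m le_rfl hmN]
          have h7 : |g n ω - g m ω| ≤ |g n ω - g N ω| + |g m ω - g N ω| := by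
            rw [abs_sub_comm (g m ω)]; exact abs_sub_le _ _ _
          push Not at hc
          linarith
      · have : {ω | ∃ n, (m ≤ n ∧ n ≤ N) ∧ 2 * (ε : ℝ) ≤ |g n ω - g m ω|} = ∅ := by
          ext ω
          simp only [mem_ofPred_eq, mem_empty_iff_false, iff_false]
          rintro ⟨n, hn, -⟩
          omega
        rw [this]; simp
    have hlim : Tendsto (fun m => ENNReal.ofReal (√(a m - L)) / ε) atTop (𝓝 0) := by
      have h1 : Tendsto (fun m => √(a m - L)) atTop (𝓝 0) := by
        have h3 : Tendsto (fun m => a m - L) atTop (𝓝 0) := by simpa using haL.sub_const L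
        simpa using h3.sqrt
      have h2 := ENNReal.tendsto_ofReal h1
      rw [ENNReal.ofReal_zero] at h2
      simpa using ENNReal.Tendsto.div_const h2 (Or.inr (by simpa using hε))
    rw [ae_iff]
    refine le_antisymm (ge_of_tendsto' hlim fun m => (measure_mono ?_).trans (hE m)) zero_le
    intro ω hω
    rw [mem_ofPred_eq] at hω
    push Not at hω
    exact hω m
  have key' : ∀ᵐ ω ∂P, ∀ j : ℕ, ∃ m, ∀ n, m ≤ n →
      |g n ω - g m ω| < 2 * (((j : ℝ≥0) + 1)⁻¹ : ℝ≥0) :=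
    ae_all_iff.2 fun j => key _ (by positivity)
  filter_upwards [key'] with ω hω
  rw [Metric.cauchySeq_iff']
  intro δ hδ
  obtain ⟨j, hj⟩ := exists_nat_one_div_lt (half_pos hδ)
  obtain ⟨m, hm⟩ := hω j
  refine ⟨m, fun n hn => ?_⟩
  have := hm n hn
  push_cast at this
  rw [Real.dist_eq]
  rw [one_div] at hj
  linarith

end BackwardMartingale

end PolyaSum

end

noncomputable section

/-! ### Averaging identities, mixtures, and the binomial law of the sites. -/

namespace PolyaSum

open BoundedBorel PointMeasure

section CondExp

variable {Ω : Type*} {m m0 : MeasurableSpace Ω} {P : Measure Ω} [IsProbabilityMeasure P]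

/-- A kernel is a version of a conditional probability if and only if it satisfies the averaging
identities. -/
lemma condExp_indicator_ae_eq_iff (hm : m ≤ m0) {A : Set Ω} (hA : MeasurableSet A)
    {g : Ω → ℝ≥0∞} (hg : Measurable[m] g) (hg1 : ∀ ω, g ω ≤ 1) :
    P[A.indicator (fun _ => (1 : ℝ)) | m] =ᵐ[P] (fun ω => (g ω).toReal) ↔
      ∀ S, MeasurableSet[m] S → P (A ∩ S) = ∫⁻ ω in S, g ω ∂P := by
  have hg0 : Measurable g := hg.mono hm le_rfl
  have hint : Integrable (A.indicator (fun _ => (1 : ℝ))) P :=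
    (integrable_const 1).indicator hA
  have hgint : Integrable (fun ω => (g ω).toReal) P := by
    refine Integrable.of_bound hg0.ennreal_toReal.aestronglyMeasurable 1
      (Filter.Eventually.of_forall fun ω => ?_)
    rw [Real.norm_of_nonneg ENNReal.toReal_nonneg]
    exact ENNReal.toReal_le_of_le_ofReal zero_le_one (by simpa using hg1 ω)
  have h1 : ∀ S, MeasurableSet[m] S →
      ∫ ω in S, A.indicator (fun _ => (1 : ℝ)) ω ∂P = (P (A ∩ S)).toReal := fun S hS => by
    rw [integral_indicator_const _ hA]
    simp [measureReal_def, Measure.restrict_apply hA]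
  have h2 : ∀ S, MeasurableSet[m] S →
      ∫ ω in S, (g ω).toReal ∂P = (∫⁻ ω in S, g ω ∂P).toReal := fun S hS =>
    integral_toReal hg0.aemeasurable
      (Filter.Eventually.of_forall fun ω => (hg1 ω).trans_lt ENNReal.one_lt_top)
  have h3 : ∀ S : Set Ω, ∫⁻ ω in S, g ω ∂P ≠ ∞ := fun S => by
    refine ((lintegral_mono fun ω => hg1 ω).trans_lt ?_).ne
    rw [lintegral_one, Measure.restrict_apply_univ]
    exact measure_lt_top P S
  constructor
  · intro h S hS
    have h4 := setIntegral_condExp hm hint hS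
    rw [h1 S hS, setIntegral_congr_ae (hm S hS) (h.mono fun ω hω _ => hω), h2 S hS] at h4
    exact ((ENNReal.toReal_eq_toReal_iff' (h3 S) (measure_ne_top P _)).1 h4).symm
  · intro h
    refine (ae_eq_condExp_of_forall_setIntegral_eq hm hint (fun S _ _ => hgint.integrableOn)
      (fun S hS _ => ?_) hg.ennreal_toReal.aestronglyMeasurable).symm
    rw [h1 S hS, h2 S hS, h S hS]

end CondExp

variable {X : Type*} [MeasurableSpace X] [Bornology X] [SigmaBounded X] [StandardBorelSpace X]
  {z : ℝ} {ρ : Measure X} [IsDiffuse ρ]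

lemma siteKernel_apply_eq (B : BoundedBorel X) (μ : PointMeasure X) {A : Set (PointMeasure X)}
    (hA : MeasurableSet A) : siteKernel z ρ B μ A = ∫⁻ ν, A.indicator 1 ν ∂siteKernel z ρ B μ :=
  (lintegral_indicator_one hA).symm

lemma measurable_sites_siteKernel [Fact (z < 1)] (B : BoundedBorel X) {A : Set (PointMeasure X)}
    (hA : MeasurableSet A) : Measurable[sites B] fun μ => siteKernel z ρ B μ A := by
  simp_rw [siteKernel_apply_eq _ _ hA]
  exact measurable_sites_lintegral_siteKernel B (measurable_one.indicator hA)

lemma mem_invariantLaws_iff [Fact (z < 1)] {P : Measure (PointMeasure X)} :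
    P ∈ invariantLaws sites (siteKernel z ρ) ↔ IsProbabilityMeasure P ∧
      ∀ (B : BoundedBorel X) (A S : Set (PointMeasure X)), MeasurableSet A →
        MeasurableSet[sites B] S → P (A ∩ S) = ∫⁻ μ in S, siteKernel z ρ B μ A ∂P := by
  refine and_congr_right fun hP => forall_congr' fun B => forall_congr' fun A => ?_
  rw [forall_comm, ← forall_comm]
  constructor
  · intro h S hA
    exact (condExp_indicator_ae_eq_iff (sites_le B) hA (measurable_sites_siteKernel B hA)
      fun μ => prob_le_one).1 (h hA) S
  · intro h hA
    exact (condExp_indicator_ae_eq_iff (sites_le B) hA (measurable_sites_siteKernel B hA)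
      fun μ => prob_le_one).2 fun S => h S hA

lemma polya_mem_invariantLaws [hz : Fact (z < 1)] (w : ℝ≥0) :
    polya z (w • ρ) ∈ invariantLaws sites (siteKernel z ρ) := by
  refine mem_invariantLaws_iff.2 ⟨isProbabilityMeasure_polya hz.out _, fun B A S hA hS => ?_⟩
  simp_rw [siteKernel_apply_eq _ _ hA]
  rw [setLIntegral_siteKernel w B (measurable_one.indicator hA) hS, lintegral_indicator_one hA,
    Measure.restrict_apply hA]

-- On events depending on a bounded set the probability is an explicit series in `w`, and these
-- events form a generating π-system.
variable (ρ) in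
lemma measurable_polya (hz : z < 1) : Measurable fun w : ℝ≥0 => polya z (w • ρ) := by
  have hprob : ∀ w : ℝ≥0, IsProbabilityMeasure (polya z (w • ρ)) := fun w =>
    isProbabilityMeasure_polya hz _
  refine Measurable.measure_of_isPiSystem_of_isProbabilityMeasure generateFrom_localEvents
    isPiSystem_localEvents ?_
  rintro _ ⟨n, A, hA, rfl⟩
  set B := exhaust X n
  have h : ∀ w : ℝ≥0, polya z (w • ρ) {μ | μ.restrict B.1 B.2.2 ∈ A} =
      ∑' k : ℕ, (expSeries (w * (siteRate z * ρ B.1)))⁻¹ * ((k.factorial : ℕ) : ℝ≥0∞)⁻¹ *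
        ((w : ℝ≥0∞) ^ k * clusters z ρ B k A) := fun w => by
    have h1 := lintegral_restrict_eq_localPolya hz (isPolyaSumProcess_polya hz (w • ρ)) B
      (measurable_one.indicator hA)
    have h2 : ∫⁻ μ, A.indicator 1 (μ.restrict B.1 B.2.2) ∂polya z (w • ρ) =
        polya z (w • ρ) {μ | μ.restrict B.1 B.2.2 ∈ A} :=
      lintegral_indicator_one (measurable_restrict B.2.2 hA)
    rw [← h2, h1, lintegral_localPolya]
    refine tsum_congr fun k => ?_
    rw [lintegral_indicator_one hA, clusters_smul]
    simp only [Measure.smul_apply, ENNReal.smul_def, smul_eq_mul]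
    rw [mul_left_comm (siteRate z)]
  rw [funext h]
  have hexp : Measurable expSeries := Measurable.tsum fun k => by fun_prop
  have hw : Measurable fun w : ℝ≥0 => (w : ℝ≥0∞) := measurable_coe_nnreal_ennreal
  exact Measurable.tsum fun k =>
    (((hexp.comp (hw.mul_const _)).inv.mul_const _)).mul ((hw.pow_const k).mul_const _)

/-- Mixtures of Pólya sum processes satisfy the equilibrium equations. -/
lemma mixture_mem_invariantLaws [hz : Fact (z < 1)] (V : Measure ℝ≥0) [IsProbabilityMeasure V]
    {P : Measure (PointMeasure X)}
    (hP : ∀ A, MeasurableSet A → P A = ∫⁻ w, polya z (w • ρ) A ∂V) :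
    P ∈ invariantLaws sites (siteKernel z ρ) := by
  have hm := measurable_polya ρ hz.out
  have hbind : P = V.bind fun w => polya z (w • ρ) := by
    ext A hA
    rw [hP A hA, Measure.bind_apply hA hm.aemeasurable]
  have hprob : ∀ w : ℝ≥0, IsProbabilityMeasure (polya z (w • ρ)) := fun w =>
    isProbabilityMeasure_polya hz.out _
  refine mem_invariantLaws_iff.2 ⟨⟨by simp [hP univ MeasurableSet.univ]⟩, fun B A S hA hS => ?_⟩
  have hS' := sites_le B _ hS
  have hk : Measurable fun μ => siteKernel z ρ B μ A :=
    (measurable_sites_siteKernel B hA).mono (sites_le B) le_rfl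
  rw [hP _ (hA.inter hS'), ← lintegral_indicator hS', hbind,
    Measure.lintegral_bind hm.aemeasurable (hk.indicator hS').aemeasurable]
  refine lintegral_congr fun w => ?_
  rw [lintegral_indicator hS']
  exact (mem_invariantLaws_iff.1 (polya_mem_invariantLaws w)).2 B A S hA hS

section Binomial

lemma lintegral_xi_restrict_compl (hz : z < 1) {P : Measure (PointMeasure X)}
    (hP : IsPolyaSumProcess z ρ P) (B : BoundedBorel X) (k : ℕ) {F : PointMeasure X → ℝ≥0∞}
    (hF : Measurable F) :
    ∫⁻ μ in {μ | xi B μ = k}, F (μ.restrict B.1ᶜ B.2.2.compl) ∂P =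
      poissonWeight (siteRate z * ρ B.1) k * ∫⁻ μ, F (μ.restrict B.1ᶜ B.2.2.compl) ∂P := by
  have hF' : Measurable fun μ : PointMeasure X => F (μ.restrict B.1ᶜ B.2.2.compl) := by fun_prop
  have h : ∀ μ : PointMeasure X, ∫⁻ ν, F ((ν + μ.restrict B.1ᶜ B.2.2.compl).restrict B.1ᶜ
      B.2.2.compl) ∂clusters z ρ B k =
      (siteRate z * ρ B.1) ^ k * F (μ.restrict B.1ᶜ B.2.2.compl) := fun μ => by
    rw [lintegral_clusters_add_restrict_compl B k hF, restrict_restrict,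
      restrict_congr μ _ (inter_self _)]
  rw [lintegral_xi_eq hz hP B k hF']
  simp_rw [h]
  rw [lintegral_const_mul _ hF', poissonWeight]
  ring

/-- The numbers of sites in `B'` and in `B \ B'` are independent Poisson variables, as the latter is
a function of the outside of `B'`. -/
lemma polya_xi_inter_xi (hz : z < 1) {B B' : BoundedBorel X} (h : B'.1 ⊆ B.1) (k l : ℕ) :
    polya z ρ ({μ | xi B' μ = k} ∩ {μ | xi B μ = (k + l : ℕ)}) =
      poissonWeight (siteRate z * ρ B'.1) k *
        poissonWeight (siteRate z * ρ (B.diff B').1) l := by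
  have hP := isPolyaSumProcess_polya hz ρ
  have hD : ∀ μ : PointMeasure X, xi (B.diff B') (μ.restrict B'.1ᶜ B'.2.2.compl) =
      xi (B.diff B') μ := fun μ => by
    refine xi_congr B'.2.2.compl inter_subset_right ?_
    rw [restrict_restrict, restrict_congr μ _ (inter_self _)]
  have h1 := lintegral_xi_restrict_compl hz hP B' k
    (measurable_one.indicator (measurableSet_xi_eq (B.diff B') l))
  have h2 : ∀ μ : PointMeasure X, {μ : PointMeasure X | xi (B.diff B') μ = l}.indicator
      (1 : PointMeasure X → ℝ≥0∞) (μ.restrict B'.1ᶜ B'.2.2.compl) =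
      {μ : PointMeasure X | xi (B.diff B') μ = l}.indicator 1 μ := fun μ => by
    simp only [indicator, mem_ofPred_eq, hD, Pi.one_apply]
  simp_rw [h2] at h1
  rw [lintegral_indicator_one (measurableSet_xi_eq _ _),
    lintegral_indicator_one (measurableSet_xi_eq _ _), measure_xi_eq hz hP,
    Measure.restrict_apply (measurableSet_xi_eq _ _)] at h1
  rw [← h1]
  congr 1
  ext μ
  simp only [mem_inter_iff, mem_ofPred_eq, xi_add_diff h μ]
  constructor
  · rintro ⟨h3, h4⟩
    refine ⟨?_, h3⟩
    rw [h3, Nat.cast_add] at h4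
    exact (ENat.add_right_injective_of_ne_top (by simp)) h4
  · rintro ⟨h3, h4⟩
    exact ⟨h4, by rw [h3, h4, Nat.cast_add]⟩

lemma poissonWeight_eq {c : ℝ≥0∞} (hc : c ≠ ∞) (k : ℕ) :
    poissonWeight c k = ENNReal.ofReal (Real.exp (-c.toReal) * c.toReal ^ k / k.factorial) := by
  rw [poissonWeight, expSeries_eq hc, Real.exp_neg, mul_div_assoc,
    ENNReal.ofReal_mul (by positivity), ENNReal.ofReal_inv_of_pos (Real.exp_pos _),
    ENNReal.ofReal_div_of_pos (by positivity), ENNReal.ofReal_pow ENNReal.toReal_nonneg,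
    ENNReal.ofReal_toReal hc, ENNReal.ofReal_natCast, div_eq_mul_inv]

/-- Given the number of sites in a larger set, the number of sites is binomial. -/
lemma condLaw_xi (hz0 : 0 < z) (hz : z < 1) {B B' : BoundedBorel X} (h : B'.1 ⊆ B.1)
    (hB : ρ B.1 ≠ 0) (k m : ℕ) :
    condLaw z ρ B m {μ | xi B' μ = k} = ENNReal.ofReal (m.choose k *
      ((ρ B'.1).toReal / (ρ B.1).toReal) ^ k *
        (1 - (ρ B'.1).toReal / (ρ B.1).toReal) ^ (m - k)) := by
  have hP := isPolyaSumProcess_polya hz ρ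
  have hprob := hP.1
  have hm0 : polya z ρ {ν | xi B ν = m} ≠ 0 := by
    rw [Ne, polya_xi_eq_zero_iff hz]
    exact pow_ne_zero _ (mul_ne_zero (siteRate_pos hz0) hB)
  rw [condLaw, if_neg hm0, cond_apply (measurableSet_xi_eq B m), inter_comm]
  by_cases hkm : k ≤ m
  · obtain ⟨l, rfl⟩ := Nat.exists_eq_add_of_le hkm
    rw [polya_xi_inter_xi hz h, measure_xi_eq hz hP, poissonWeight_eq (siteMass_lt_top hz ρ B).ne,
      poissonWeight_eq (siteMass_lt_top hz ρ B').ne,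
      poissonWeight_eq (siteMass_lt_top hz ρ (B.diff B')).ne]
    have hsum : ρ B.1 = ρ B'.1 + ρ (B.diff B').1 := by
      rw [← measure_inter_add_sdiff B.1 B'.2.2, inter_eq_self_of_subset_right h]
      rfl
    have hBpos : 0 < (ρ B.1).toReal := ENNReal.toReal_pos hB (IsDiffuse.lt_top B).ne
    have hr : 0 < (siteRate z).toReal :=
      ENNReal.toReal_pos (siteRate_pos hz0) (siteRate_lt_top hz).ne
    have hsum' : (ρ B.1).toReal = (ρ B'.1).toReal + (ρ (B.diff B').1).toReal := by
      rw [hsum, ENNReal.toReal_add (IsDiffuse.lt_top B').ne (IsDiffuse.lt_top _).ne]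
    simp only [ENNReal.toReal_mul]
    set b := (ρ B.1).toReal
    set b' := (ρ B'.1).toReal
    set d := (ρ (B.diff B').1).toReal
    set r := (siteRate z).toReal
    rw [← ENNReal.ofReal_inv_of_pos (by positivity), ← ENNReal.ofReal_mul (by positivity),
      ← ENNReal.ofReal_mul (by positivity)]
    congr 1
    have hd : 1 - b' / b = d / b := by field_simp; linarith
    -- The exponentials cancel by additivity of `ρ`, and the powers of `r` because the exponents `k`
    -- and `l` add up; what remains is binomial and free of `z`.
    have he : Real.exp (-(r * b)) = Real.exp (-(r * b')) * Real.exp (-(r * d)) := by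
      rw [← Real.exp_add]; congr 1; rw [hsum']; ring
    rw [hd, he, Nat.add_sub_cancel_left, Nat.cast_add_choose]
    have hk1 : ((k.factorial : ℕ) : ℝ) ≠ 0 := by positivity
    have hk2 : ((l.factorial : ℕ) : ℝ) ≠ 0 := by positivity
    have hk3 : (((k + l).factorial : ℕ) : ℝ) ≠ 0 := by positivity
    have hb : b ≠ 0 := hBpos.ne'
    have hr' : r ≠ 0 := hr.ne'
    rw [pow_add, mul_pow, mul_pow, mul_pow, mul_pow, div_pow, div_pow]
    field_simp
  · have hempty : ({μ : PointMeasure X | xi B' μ = k} ∩ {μ | xi B μ = m}) = ∅ := by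
      ext μ
      simp only [mem_inter_iff, mem_ofPred_eq, mem_empty_iff_false, iff_false, not_and]
      intro h1 h2
      rw [xi_add_diff h μ, h1] at h2
      have h3 : (k : ℕ∞) ≤ m := h2 ▸ le_self_add
      exact hkm (by exact_mod_cast h3)
    rw [hempty, measure_empty, mul_zero, Nat.choose_eq_zero_of_lt (by omega)]
    simp

lemma siteKernel_xi (hz0 : 0 < z) (hz : z < 1) {B B' : BoundedBorel X} (h : B'.1 ⊆ B.1)
    (hB : ρ B.1 ≠ 0) (k m : ℕ) {μ : PointMeasure X} (hμ : xi B μ = m) :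
    siteKernel z ρ B μ {μ | xi B' μ = k} = ENNReal.ofReal (m.choose k *
      ((ρ B'.1).toReal / (ρ B.1).toReal) ^ k *
        (1 - (ρ B'.1).toReal / (ρ B.1).toReal) ^ (m - k)) := by
  rw [← condLaw_xi hz0 hz h hB, siteKernel,
    Measure.map_apply (measurable_glue_left B μ) (measurableSet_xi_eq B' k), hμ]
  congr 1
  ext ν
  simp only [mem_preimage, mem_ofPred_eq, xi_glue h]

end Binomial

end PolyaSum

end

noncomputable section

namespace PolyaSum

/-! ### Limits of binomial probabilities. -/

section BinomialLimits

open Filter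
open scoped Topology

/-- This removes the truncated subtraction `m - k`; for `k > m` both sides vanish with the binomial
coefficient. -/
lemma choose_mul_eq {p : ℝ} (hp : p < 1) (m k : ℕ) :
    (m.choose k : ℝ) * p ^ k * (1 - p) ^ (m - k) =
      (m.choose k * p ^ k) * ((1 - p) ^ m * ((1 - p) ^ k)⁻¹) := by
  by_cases h : k ≤ m
  · have h1 : (1 - p) ^ k ≠ 0 := pow_ne_zero _ (by linarith)
    obtain ⟨l, rfl⟩ := Nat.exists_eq_add_of_le h
    rw [Nat.add_sub_cancel_left, pow_add]
    field_simp
  · rw [Nat.choose_eq_zero_of_lt (by omega)]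
    simp

lemma choose_succ_mul_eq (p : ℝ) (m k : ℕ) :
    (m.choose (k + 1) : ℝ) * p ^ (k + 1) =
      (m.choose k * p ^ k) * ((m * p - k * p) / (k + 1)) := by
  have hk : (k : ℝ) + 1 ≠ 0 := by positivity
  have h : (m.choose (k + 1) : ℝ) * (k + 1) = m.choose k * (m - k) := by
    by_cases h : k ≤ m
    · have := Nat.choose_succ_right_eq m k
      rw [← Nat.cast_sub h]
      exact_mod_cast this
    · rw [Nat.choose_eq_zero_of_lt (by omega), Nat.choose_eq_zero_of_lt (by omega)]
      simp
  field_simp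
  rw [pow_succ]
  linear_combination p ^ k * p * h

lemma one_sub_pow_eq_exp {p : ℝ} (hp : p < 1) (m : ℕ) :
    (1 - p) ^ m = Real.exp (m * Real.log (1 - p)) := by
  rw [Real.exp_nat_mul, Real.exp_log (by linarith)]

variable {p : ℕ → ℝ} {m : ℕ → ℕ}

lemma log_one_sub_le {p : ℝ} (hp : p < 1) (m : ℕ) : m * Real.log (1 - p) ≤ -(m * p) := by
  have := Real.log_le_sub_one_of_pos (show 0 < 1 - p by linarith)
  nlinarith [Nat.cast_nonneg (α := ℝ) m]

lemma le_log_one_sub {p : ℝ} (hp : p < 1) (m : ℕ) :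
    -(m * p) ≤ (1 - p) * (m * Real.log (1 - p)) := by
  have h0 : 0 < 1 - p := by linarith
  have h1 := Real.one_sub_inv_le_log_of_pos h0
  have h2 : -p ≤ (1 - p) * Real.log (1 - p) := by
    calc -p = (1 - p) * (1 - (1 - p)⁻¹) := by field_simp; ring
      _ ≤ _ := mul_le_mul_of_nonneg_left h1 h0.le
  nlinarith [Nat.cast_nonneg (α := ℝ) m]

lemma tendsto_one_sub (hp : Tendsto p atTop (𝓝 0)) : Tendsto (fun n => 1 - p n) atTop (𝓝 1) := by
  simpa using hp.const_sub 1

/-- A converse to the Poisson limit: the void probability alone determines the mean, since `m log (1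
- p)` and `-m p` are asymptotically equal as `p → 0`. -/
lemma tendsto_mul_of_tendsto_pow (hp : Tendsto p atTop (𝓝 0)) {g : ℝ} (hg : g ≠ 0)
    (h : Tendsto (fun n => (1 - p n) ^ m n) atTop (𝓝 g)) :
    Tendsto (fun n => m n * p n) atTop (𝓝 (-Real.log g)) := by
  have hlt : ∀ᶠ n in atTop, p n < 1 := hp.eventually (gt_mem_nhds one_pos)
  have hlog : Tendsto (fun n => m n * Real.log (1 - p n)) atTop (𝓝 (Real.log g)) := by
    refine (h.log hg).congr' ?_
    filter_upwards [hlt] with n hn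
    rw [one_sub_pow_eq_exp hn, Real.log_exp]
  have h1 : Tendsto (fun n => -((1 - p n) * (m n * Real.log (1 - p n)))) atTop
      (𝓝 (-Real.log g)) := by
    simpa using ((tendsto_one_sub hp).mul hlog).neg
  refine tendsto_of_tendsto_of_tendsto_of_le_of_le' h1 hlog.neg ?_ ?_
  · filter_upwards [hlt] with n hn
    linarith [le_log_one_sub hn (m n)]
  · filter_upwards [hlt] with n hn
    linarith [log_one_sub_le hn (m n)]

lemma tendsto_pow_of_tendsto_mul (hp : Tendsto p atTop (𝓝 0)) {a : ℝ}
    (h : Tendsto (fun n => m n * p n) atTop (𝓝 a)) :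
    Tendsto (fun n => (1 - p n) ^ m n) atTop (𝓝 (Real.exp (-a))) := by
  have hlt : ∀ᶠ n in atTop, p n < 1 := hp.eventually (gt_mem_nhds one_pos)
  have h1 : Tendsto (fun n => -(m n * p n) / (1 - p n)) atTop (𝓝 (-a)) := by
    have h2 := h.neg.div (tendsto_one_sub hp) one_ne_zero
    rw [div_one] at h2
    exact h2
  have hlog : Tendsto (fun n => m n * Real.log (1 - p n)) atTop (𝓝 (-a)) := by
    refine tendsto_of_tendsto_of_tendsto_of_le_of_le' h1 h.neg ?_ ?_
    · filter_upwards [hlt] with n hn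
      rw [div_le_iff₀' (by linarith)]
      exact le_log_one_sub hn (m n)
    · filter_upwards [hlt] with n hn
      exact log_one_sub_le hn (m n)
  refine ((Real.continuous_exp.tendsto _).comp hlog).congr' ?_
  filter_upwards [hlt] with n hn
  rw [one_sub_pow_eq_exp hn, Function.comp_apply]

/-- The Poisson limit theorem. -/
lemma tendsto_binomial (hp : Tendsto p atTop (𝓝 0)) {a : ℝ}
    (h : Tendsto (fun n => m n * p n) atTop (𝓝 a)) (k : ℕ) :
    Tendsto (fun n => ((m n).choose k : ℝ) * p n ^ k * (1 - p n) ^ (m n - k)) atTop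
      (𝓝 (Real.exp (-a) * a ^ k / k.factorial)) := by
  have h1 : Tendsto (fun n => ((m n).choose k : ℝ) * p n ^ k) atTop
      (𝓝 (a ^ k / k.factorial)) := by
    induction k with
    | zero => simp
    | succ k ih =>
      simp_rw [choose_succ_mul_eq]
      have h2 : Tendsto (fun n => m n * p n - k * p n) atTop (𝓝 a) := by
        simpa using h.sub (hp.const_mul (k : ℝ))
      have h3 := ih.mul (h2.div_const ((k : ℝ) + 1))
      convert h3 using 2
      rw [Nat.factorial_succ, pow_succ]
      push_cast
      field_simp
  have h2 := h1.mul ((tendsto_pow_of_tendsto_mul hp h).mul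
    (((tendsto_one_sub hp).pow k).inv₀ (by simp)))
  rw [show a ^ k / k.factorial * (Real.exp (-a) * (1 ^ k)⁻¹) =
    Real.exp (-a) * a ^ k / k.factorial by simp; ring] at h2
  refine h2.congr' ?_
  filter_upwards [hp.eventually (gt_mem_nhds one_pos)] with n hn
  rw [choose_mul_eq hn]

/-- With `x = -m log (1 - p)`, which tends to infinity, one has `m p ≤ x`, so the probability is at
most `x ^ k e^{-x} (1 - p)^{-k}`. -/
lemma tendsto_binomial_zero (hp0 : ∀ n, 0 ≤ p n) (hp : Tendsto p atTop (𝓝 0))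
    (h : Tendsto (fun n => (1 - p n) ^ m n) atTop (𝓝 0)) (k : ℕ) :
    Tendsto (fun n => ((m n).choose k : ℝ) * p n ^ k * (1 - p n) ^ (m n - k)) atTop (𝓝 0) := by
  have hlt : ∀ᶠ n in atTop, p n < 1 := hp.eventually (gt_mem_nhds one_pos)
  have hx : Tendsto (fun n => -(m n * Real.log (1 - p n))) atTop atTop := by
    have h1 : Tendsto (fun n => (1 - p n) ^ m n) atTop (𝓝[>] 0) := by
      refine tendsto_nhdsWithin_iff.2 ⟨h, ?_⟩
      filter_upwards [hlt] with n hn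
      exact pow_pos (sub_pos.2 hn) _
    have h2 := tendsto_neg_atBot_atTop.comp (Real.tendsto_log_nhdsGT_zero.comp h1)
    refine h2.congr' ?_
    filter_upwards [hlt] with n hn
    simp only [Function.comp_apply]
    rw [one_sub_pow_eq_exp hn, Real.log_exp]
  have h1 := ((Real.tendsto_pow_mul_exp_neg_atTop_nhds_zero k).comp hx).mul
    (((tendsto_one_sub hp).pow k).inv₀ (by simp))
  rw [zero_mul] at h1
  refine tendsto_of_tendsto_of_tendsto_of_le_of_le' tendsto_const_nhds h1 ?_ ?_
  · filter_upwards [hlt] with n hn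
    have := hp0 n
    have : 0 ≤ 1 - p n := by linarith
    positivity
  · filter_upwards [hlt] with n hn
    have h0 := hp0 n
    have h2 : 0 < 1 - p n := by linarith
    rw [choose_mul_eq hn]
    simp only [Function.comp_apply, neg_neg]
    rw [← one_sub_pow_eq_exp hn, mul_assoc _ ((1 - p n) ^ m n)]
    refine mul_le_mul_of_nonneg_right ?_ (by positivity)
    calc ((m n).choose k : ℝ) * p n ^ k ≤ (m n : ℝ) ^ k * p n ^ k := by
          gcongr
          exact_mod_cast Nat.choose_le_pow (m n) k
      _ = (m n * p n) ^ k := (mul_pow _ _ _).symm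
      _ ≤ _ := by
          have := log_one_sub_le hn (m n)
          gcongr
          linarith

end BinomialLimits

end PolyaSum

end

noncomputable section

/-! ### The density of sites and the tail conditional law. -/

namespace PolyaSum

open BoundedBorel PointMeasure Filter
open scoped Topology

variable {X : Type*} [MeasurableSpace X] [Bornology X]

/-- Increasing cofinal sequences of bounded Borel sets exhausting the space. -/
structure IsExhaustion (K : ℕ → BoundedBorel X) : Prop where
  mono : ∀ m n, m ≤ n → (K m).1 ⊆ (K n).1
  iUnion : ⋃ n, (K n).1 = univ
  cofinal : ∀ B : BoundedBorel X, ∃ n, B.1 ⊆ (K n).1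

/-- The limiting number of occupied sites in `K n` per unit of expected number of sites. -/
def density (z : ℝ) (ρ : Measure X) (K : ℕ → BoundedBorel X) (μ : PointMeasure X) : ℝ≥0 :=
  (limsup (fun n => (xi (K n) μ : ℝ≥0∞) / (siteRate z * ρ (K n).1)) atTop).toNNReal

variable [SigmaBounded X] [StandardBorelSpace X] {K : ℕ → BoundedBorel X} {z : ℝ} {ρ : Measure X}

lemma tail_le (hK : IsExhaustion K) (B : BoundedBorel X) : ⨅ n, sites (K n) ≤ sites B := by
  obtain ⟨n, hn⟩ := hK.cofinal B
  exact (iInf_le _ n).trans (sites_antitone hn)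

lemma measurable_tail {β : Type*} [MeasurableSpace β] {f : PointMeasure X → β}
    (h : ∀ N, Measurable[sites (K N)] f) : Measurable[⨅ n, sites (K n)] f := fun _ hs =>
  MeasurableSpace.measurableSet_iInf.2 fun N => h N hs

section Density

lemma measurable_sites_xi (B : BoundedBorel X) :
    Measurable[sites B] fun μ : PointMeasure X => (xi B μ : ℝ≥0∞) := by
  have h : Measurable[sites B, ⊤] (xi (X := X) B) := by
    rw [measurable_iff_comap_le]
    exact le_sup_right
  exact Measurable.comp (@measurable_from_top ℕ∞ ℝ≥0∞ _ _) h

/-- A limit superior ignores finitely many terms, and those of index at least `N` are measurable for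
`sites (K N)`. -/
lemma measurable_density (hK : IsExhaustion K) :
    Measurable[⨅ n, sites (K n)] (density z ρ K) := by
  refine Measurable.ennreal_toNNReal (measurable_tail fun N => ?_)
  have h : ∀ μ : PointMeasure X,
      limsup (fun n => (xi (K n) μ : ℝ≥0∞) / (siteRate z * ρ (K n).1)) atTop =
      limsup (fun n => (xi (K (n + N)) μ : ℝ≥0∞) / (siteRate z * ρ (K (n + N)).1)) atTop :=
    fun μ => (limsup_nat_add _ N).symm
  rw [funext h]
  refine Measurable.limsup fun n => Measurable.div_const ?_ _
  exact (measurable_sites_xi _).mono (sites_antitone (hK.mono _ _ (Nat.le_add_left N n))) le_rfl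

lemma tendsto_measure_exhaustion (hK : IsExhaustion K) (hρ : ρ univ = ∞) :
    Tendsto (fun n => ρ (K n).1) atTop (𝓝 ∞) := by
  rw [← hρ, ← hK.iUnion]
  exact tendsto_measure_iUnion_atTop fun m n h => hK.mono m n h

lemma tendsto_ratio [IsDiffuse ρ] (hK : IsExhaustion K) (hρ : ρ univ = ∞) (B : BoundedBorel X) :
    Tendsto (fun n => (ρ B.1).toReal / (ρ (K n).1).toReal) atTop (𝓝 0) := by
  have h : Tendsto (fun n => ρ B.1 / ρ (K n).1) atTop (𝓝 0) := by
    have := ENNReal.Tendsto.const_div (a := ρ B.1) (tendsto_measure_exhaustion hK hρ)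
      (Or.inr (IsDiffuse.lt_top B).ne)
    simpa using this
  have h2 := (ENNReal.tendsto_toReal ENNReal.zero_ne_top).comp h
  simpa [Function.comp_def, ENNReal.toReal_div] using h2

lemma eventually_measure_ne_zero (hK : IsExhaustion K) (hρ : ρ univ = ∞) :
    ∀ᶠ n in atTop, ρ (K n).1 ≠ 0 :=
  ((tendsto_measure_exhaustion hK hρ).eventually (lt_mem_nhds ENNReal.zero_lt_top)).mono
    fun _ h => h.ne'

lemma eventually_siteKernel_xi [IsDiffuse ρ] (hK : IsExhaustion K) (hz0 : 0 < z) (hz : z < 1)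
    (hρ : ρ univ = ∞) (B : BoundedBorel X) (k : ℕ) (μ : PointMeasure X) :
    ∀ᶠ n in atTop, siteKernel z ρ (K n) μ {ν | xi B ν = k} =
      ENNReal.ofReal ((xi (K n) μ).toNat.choose k *
      ((ρ B.1).toReal / (ρ (K n).1).toReal) ^ k *
        (1 - (ρ B.1).toReal / (ρ (K n).1).toReal) ^ ((xi (K n) μ).toNat - k)) := by
  obtain ⟨N, hN⟩ := hK.cofinal B
  filter_upwards [eventually_measure_ne_zero hK hρ, eventually_ge_atTop N] with n hn hNn
  exact siteKernel_xi hz0 hz (hN.trans (hK.mono _ _ hNn)) hn k _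
    (ENat.natCast_toNat (xi_lt_top _ μ).ne).symm

/-- The density times the expected number of sites in `B'` is the binomial mean, the quantity
governing the Poisson limit. If `ρ B` has zero real value, both sides are zero by the convention for
division. -/
lemma toReal_density_mul (hz0 : 0 < z) (hz : z < 1) (B B' : BoundedBorel X)
    (μ : PointMeasure X) :
    ((xi B μ : ℝ≥0∞) / (siteRate z * ρ B.1)).toReal * ((siteRate z).toReal * (ρ B'.1).toReal) =
      (xi B μ).toNat * ((ρ B'.1).toReal / (ρ B.1).toReal) := by
  have hr : (siteRate z).toReal ≠ 0 :=
    (ENNReal.toReal_pos (siteRate_pos hz0) (siteRate_lt_top hz).ne).ne'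
  obtain ⟨m, hm⟩ := exists_xi_eq B μ
  rw [hm, ENNReal.toReal_div, ENNReal.toReal_mul]
  simp only [ENat.toENNReal_coe, ENNReal.toReal_natCast, ENat.toNat_natCast]
  by_cases hb : (ρ B.1).toReal = 0
  · simp [hb]
  · field_simp

lemma tendsto_siteKernel_xi [IsDiffuse ρ] (hK : IsExhaustion K) (hz0 : 0 < z) (hz : z < 1)
    (hρ : ρ univ = ∞) (B : BoundedBorel X) (k : ℕ) {μ : PointMeasure X} {w : ℝ≥0}
    (h : Tendsto (fun n => (xi (K n) μ : ℝ≥0∞) / (siteRate z * ρ (K n).1)) atTop (𝓝 w)) :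
    Tendsto (fun n => siteKernel z ρ (K n) μ {ν | xi B ν = k}) atTop
      (𝓝 (polya z (w • ρ) {ν | xi B ν = k})) := by
  have h1 := ((ENNReal.tendsto_toReal ENNReal.coe_ne_top).comp h).mul_const
    ((siteRate z).toReal * (ρ B.1).toReal)
  simp only [Function.comp_def, toReal_density_mul hz0 hz, ENNReal.coe_toReal] at h1
  have h2 := ENNReal.tendsto_ofReal (tendsto_binomial (tendsto_ratio hK hρ B) h1 k)
  rw [measure_xi_eq hz (isPolyaSumProcess_polya hz (w • ρ)),
    poissonWeight_eq (siteMass_lt_top hz (w • ρ) B).ne]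
  have h3 : (siteRate z * (w • ρ) B.1).toReal =
      w * ((siteRate z).toReal * (ρ B.1).toReal) := by
    rw [Measure.smul_apply, ENNReal.smul_def, smul_eq_mul, ENNReal.toReal_mul, ENNReal.toReal_mul,
      ENNReal.coe_toReal]
    ring
  rw [h3]
  refine h2.congr' ?_
  filter_upwards [eventually_siteKernel_xi hK hz0 hz hρ B k μ] with n hn
  exact hn.symm

end Density

section Tail

variable [IsDiffuse ρ] [hz : Fact (z < 1)] {P : Measure (PointMeasure X)}

/-- A tail event lies in every `sites (K n)`, so the averaged kernel probabilities do not depend on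
`n`; dominated convergence passes to the limit inside. -/
lemma measure_inter_eq_of_tendsto (hK : IsExhaustion K)
    (hP : P ∈ invariantLaws sites (siteKernel z ρ)) {A S : Set (PointMeasure X)}
    (hA : MeasurableSet A) (hS : MeasurableSet[⨅ n, sites (K n)] S) {g : PointMeasure X → ℝ≥0∞}
    (h : ∀ᵐ μ ∂P.restrict S, Tendsto (fun n => siteKernel z ρ (K n) μ A) atTop (𝓝 (g μ))) :
    P (A ∩ S) = ∫⁻ μ in S, g μ ∂P := by
  rw [mem_invariantLaws_iff] at hP
  have := hP.1
  have h1 : Tendsto (fun n => ∫⁻ μ in S, siteKernel z ρ (K n) μ A ∂P) atTop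
      (𝓝 (∫⁻ μ in S, g μ ∂P)) := by
    refine tendsto_lintegral_of_dominated_convergence 1 (fun n =>
      (measurable_sites_siteKernel (K n) hA).mono (sites_le _) le_rfl)
      (fun n => Eventually.of_forall fun μ => prob_le_one) ?_ h
    simp
  refine tendsto_nhds_unique (tendsto_const_nhds.congr fun n => ?_) h1
  exact hP.2 (K n) A S hA (tail_le hK _ _ hS)

lemma measurableSet_tail_tendsto_siteKernel (hK : IsExhaustion K) {A : Set (PointMeasure X)}
    (hA : MeasurableSet A) : MeasurableSet[⨅ n, sites (K n)]
      {μ | Tendsto (fun n => siteKernel z ρ (K n) μ A) atTop (𝓝 0)} := by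
  refine MeasurableSpace.measurableSet_iInf.2 fun N => ?_
  have h : {μ : PointMeasure X | Tendsto (fun n => siteKernel z ρ (K n) μ A) atTop (𝓝 0)} =
      {μ | Tendsto (fun n => siteKernel z ρ (K (n + N)) μ A) atTop (𝓝 0)} := by
    ext μ
    exact (tendsto_add_atTop_iff_nat
      (f := fun n => siteKernel z ρ (K n) μ A) N).symm
  rw [h]
  exact measurableSet_tendsto (𝓝 0) fun n => (measurable_sites_siteKernel _ hA).mono
    (sites_antitone (hK.mono _ _ (Nat.le_add_left N n))) le_rfl

/-- The void probabilities of a fixed `B` of positive `ρ` measure form a backward martingale and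
converge. Where the limit is positive, its logarithm gives the limiting density; a zero limit is
excluded almost surely. -/
lemma ae_tendsto_density (hK : IsExhaustion K) (hz0 : 0 < z) (hρ : ρ univ = ∞)
    (hP : P ∈ invariantLaws sites (siteKernel z ρ)) :
    ∀ᵐ μ ∂P, Tendsto (fun n => (xi (K n) μ : ℝ≥0∞) / (siteRate z * ρ (K n).1)) atTop
      (𝓝 (density z ρ K μ)) := by
  have := hP.1
  obtain ⟨n₀, hn₀⟩ := (eventually_measure_ne_zero hK hρ).exists
  set B := K n₀
  have hp := tendsto_ratio hK hρ B
  have hr : 0 < (siteRate z).toReal * (ρ B.1).toReal :=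
    mul_pos (ENNReal.toReal_pos (siteRate_pos hz0) (siteRate_lt_top hz.out).ne)
      (ENNReal.toReal_pos hn₀ (IsDiffuse.lt_top B).ne)
  have hp1 : ∀ᶠ n in atTop, (ρ B.1).toReal / (ρ (K n).1).toReal < 1 :=
    hp.eventually (gt_mem_nhds one_pos)
  have hp0 : ∀ n, 0 ≤ (ρ B.1).toReal / (ρ (K n).1).toReal := fun n => by positivity
  have hq : ∀ μ : PointMeasure X, ∀ᶠ n in atTop, (siteKernel z ρ (K n) μ).real
      {ν | xi B ν = (0 : ℕ)} = (1 - (ρ B.1).toReal / (ρ (K n).1).toReal) ^ (xi (K n) μ).toNat :=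
    fun μ => by
      filter_upwards [eventually_siteKernel_xi hK hz0 hz.out hρ B 0 μ, hp1] with n hn hn1
      have : 0 ≤ 1 - (ρ B.1).toReal / (ρ (K n).1).toReal := by linarith
      rw [measureReal_def, hn, ENNReal.toReal_ofReal (by positivity)]
      simp
  set A : Set (PointMeasure X) := {ν | xi B ν = (0 : ℕ)}
  have hA : MeasurableSet A := measurableSet_xi_eq B _
  -- the set where all sites escape is negligible
  set N : Set (PointMeasure X) := {μ | Tendsto (fun n => siteKernel z ρ (K n) μ A) atTop (𝓝 0)}
  have hN : MeasurableSet[⨅ n, sites (K n)] N := measurableSet_tail_tendsto_siteKernel hK hA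
  have hN0 : P N = 0 := by
    -- On `N` the probability of exactly `k` sites also tends to zero, for every `k`. Since `ξ_B` is
    -- finite, these events exhaust `N`.
    have h : ∀ k : ℕ, P ({μ | xi B μ = k} ∩ N) = 0 := fun k => by
      rw [measure_inter_eq_of_tendsto hK hP (measurableSet_xi_eq B k) hN (g := 0), Pi.zero_def,
        lintegral_zero]
      refine (ae_restrict_iff' (sites_le _ _ (tail_le hK B _ hN))).2
        (Eventually.of_forall fun μ hμ => ?_)
      have h1 : Tendsto (fun n => (1 - (ρ B.1).toReal / (ρ (K n).1).toReal) ^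
          (xi (K n) μ).toNat) atTop (𝓝 0) :=
        ((ENNReal.tendsto_toReal ENNReal.zero_ne_top).comp hμ).congr' (hq μ)
      have h2 := ENNReal.tendsto_ofReal (tendsto_binomial_zero hp0 hp h1 k)
      rw [ENNReal.ofReal_zero] at h2
      refine h2.congr' ?_
      filter_upwards [eventually_siteKernel_xi hK hz0 hz.out hρ B k μ] with n hn
      exact hn.symm
    have h2 : N = ⋃ k : ℕ, {μ | xi B μ = k} ∩ N := by
      rw [← iUnion_inter, iUnion_xi_eq, univ_inter]
    rw [h2]
    exact measure_iUnion_null h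
  have hcauchy := ae_cauchySeq_condExp_antitone (P := P) (𝒢 := fun n => sites (K n))
    (f := A.indicator fun _ => (1 : ℝ)) (fun m n h => sites_antitone (hK.mono m n h))
    (fun n => sites_le _) (Eventually.of_forall fun μ => by
      by_cases hμ : μ ∈ A <;> simp [hμ])
  have heq : ∀ᵐ μ ∂P, ∀ n, (P[A.indicator (fun _ => (1 : ℝ)) | sites (K n)]) μ =
      (siteKernel z ρ (K n) μ).real A := ae_all_iff.2 fun n => hP.2 (K n) A hA
  filter_upwards [hcauchy, heq, measure_eq_zero_iff_ae_notMem.1 hN0] with μ h1 h2 h3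
  simp_rw [h2] at h1
  obtain ⟨g, hg⟩ := cauchySeq_tendsto_of_complete h1
  have hg0 : g ≠ 0 := by
    rintro rfl
    refine h3 ?_
    have := ENNReal.tendsto_ofReal hg
    change Tendsto (fun n => siteKernel z ρ (K n) μ A) atTop (𝓝 0)
    simpa [measureReal_def, ENNReal.ofReal_toReal (measure_ne_top _ _)] using this
  have h4 := tendsto_mul_of_tendsto_pow hp hg0 (hg.congr' (hq μ))
  simp_rw [← toReal_density_mul hz0 hz.out] at h4
  have h5 := ENNReal.tendsto_ofReal (h4.div_const ((siteRate z).toReal * (ρ B.1).toReal))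
  simp_rw [mul_div_cancel_right₀ _ hr.ne'] at h5
  have h6 : Tendsto (fun n => (xi (K n) μ : ℝ≥0∞) / (siteRate z * ρ (K n).1)) atTop
      (𝓝 (ENNReal.ofReal (-Real.log g / ((siteRate z).toReal * (ρ B.1).toReal)))) := by
    refine h5.congr' ?_
    filter_upwards [eventually_measure_ne_zero hK hρ] with n hn
    refine ENNReal.ofReal_toReal (ENNReal.div_ne_top ?_ (mul_ne_zero (siteRate_pos hz0) hn))
    simpa using (xi_lt_top (K n) μ).ne
  rw [density, h6.limsup_eq, ENNReal.coe_toNNReal ENNReal.ofReal_ne_top]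
  exact h6

lemma measure_eq_tsum_xi (P : Measure (PointMeasure X)) (B : BoundedBorel X)
    (A : Set (PointMeasure X)) : P A = ∑' k : ℕ, P ({μ | xi B μ = k} ∩ A) := by
  have h := lintegral_eq_tsum_xi B 1 (P.restrict A)
  simp only [Pi.one_apply, lintegral_one, Measure.restrict_apply_univ,
    Measure.restrict_apply (measurableSet_xi_eq B _)] at h
  exact h

/-- Given the number of sites in `B`, the configuration in `B` has the law `condLaw`. -/
lemma measure_restrict_inter_xi (hP : P ∈ invariantLaws sites (siteKernel z ρ))
    (B : BoundedBorel X) (k : ℕ) {A S : Set (PointMeasure X)} (hA : MeasurableSet A)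
    (hS : MeasurableSet[sites B] S) :
    P ({μ | xi B μ = k} ∩ ({μ | μ.restrict B.1 B.2.2 ∈ A} ∩ S)) =
      condLaw z ρ B k {μ | μ.restrict B.1 B.2.2 ∈ A} * P ({μ | xi B μ = k} ∩ S) := by
  have hA' : MeasurableSet {μ : PointMeasure X | μ.restrict B.1 B.2.2 ∈ A} :=
    measurable_restrict B.2.2 hA
  have hS' : MeasurableSet[sites B] ({μ : PointMeasure X | xi B μ = k} ∩ S) :=
    (measurableSet_sites_xi B k).inter hS
  rw [inter_left_comm, (mem_invariantLaws_iff.1 hP).2 B _ _ hA' hS',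
    ← setLIntegral_const]
  refine setLIntegral_congr_fun (sites_le B _ hS') fun μ hμ => ?_
  rw [siteKernel, Measure.map_apply (measurable_glue_left B μ) hA', hμ.1]
  congr 1
  ext ν
  simp only [mem_preimage, mem_ofPred_eq, restrict_glue_self]

/-- The Pólya sum process of random density is a version of the tail conditional distribution. -/
theorem measure_inter_tail (hK : IsExhaustion K) (hz0 : 0 < z) (hρ : ρ univ = ∞)
    (hP : P ∈ invariantLaws sites (siteKernel z ρ)) {A S : Set (PointMeasure X)}
    (hA : MeasurableSet A) (hS : MeasurableSet[⨅ n, sites (K n)] S) :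
    P (A ∩ S) = ∫⁻ μ in S, polya z (density z ρ K μ • ρ) A ∂P := by
  have := hP.1
  have hS' : MeasurableSet S := sites_le _ _ (tail_le hK (K 0) _ hS)
  have hm : Measurable fun μ => polya z (density z ρ K μ • ρ) := (measurable_polya ρ hz.out).comp
    ((measurable_density hK).mono ((tail_le hK (K 0)).trans (sites_le _)) le_rfl)
  have hmA : ∀ A, MeasurableSet A → Measurable fun μ => polya z (density z ρ K μ • ρ) A :=
    fun A hA => (Measure.measurable_coe hA).comp hm
  -- As an identity of measures it can be checked on events in a bounded `B`. Given `ξ_B = k` both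
  -- sides have the same law `condLaw` there, so only the law of `ξ_B` has to be compared, where the
  -- Poisson limit applies.
  have key : P.restrict S = (P.restrict S).bind fun μ => polya z (density z ρ K μ • ρ) := by
    refine ext_of_restrict fun B A hA => ?_
    have hA' : MeasurableSet {μ : PointMeasure X | μ.restrict B.1 B.2.2 ∈ A} :=
      measurable_restrict B.2.2 hA
    rw [Measure.bind_apply hA' hm.aemeasurable, Measure.restrict_apply hA',
      measure_eq_tsum_xi P B]
    have h1 : ∀ w : ℝ≥0, polya z (w • ρ) {μ | μ.restrict B.1 B.2.2 ∈ A} = ∑' k : ℕ,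
        condLaw z ρ B (k : ℕ) {μ | μ.restrict B.1 B.2.2 ∈ A} * polya z (w • ρ) {μ | xi B μ = k} :=
      fun w => by
        rw [measure_eq_tsum_xi _ B]
        refine tsum_congr fun k => ?_
        have := measure_restrict_inter_xi (polya_mem_invariantLaws (z := z) (ρ := ρ) w) B k hA
          MeasurableSet.univ
        rwa [inter_univ, inter_univ] at this
    simp_rw [h1]
    rw [lintegral_tsum fun k : ℕ =>
      ((hmA _ (measurableSet_xi_eq B k)).const_mul _).aemeasurable]
    refine tsum_congr fun k => ?_
    rw [measure_restrict_inter_xi hP B k hA (tail_le hK B _ hS),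
      lintegral_const_mul _ (hmA _ (measurableSet_xi_eq B k)),
      measure_inter_eq_of_tendsto hK hP (measurableSet_xi_eq B k) hS]
    filter_upwards [ae_restrict_of_ae (ae_tendsto_density hK hz0 hρ hP)] with μ hμ
    exact tendsto_siteKernel_xi hK hz0 hz.out hρ B k hμ
  have h := congrArg (fun Q : Measure (PointMeasure X) => Q A) key
  rwa [Measure.restrict_apply hA, Measure.bind_apply hA hm.aemeasurable] at h

end Tail

end PolyaSum

end

noncomputable section

/-! ### Mixture representation and extreme points. -/

namespace PolyaSum

open BoundedBorel PointMeasure Filter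
open scoped Topology

variable {X : Type*} [MeasurableSpace X] [Bornology X] [SigmaBounded X] [StandardBorelSpace X]
  {K : ℕ → BoundedBorel X} {z : ℝ} {ρ : Measure X} [IsDiffuse ρ]

lemma polya_xi_zero (hz : z < 1) (w : ℝ≥0) (B : BoundedBorel X) :
    polya z (w • ρ) {μ | xi B μ = (0 : ℕ)} =
      ENNReal.ofReal (Real.exp (-(w * (siteRate z * ρ B.1).toReal))) := by
  rw [measure_xi_eq hz (isPolyaSumProcess_polya hz (w • ρ)),
    poissonWeight_eq (siteMass_lt_top hz (w • ρ) B).ne]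
  have h3 : (siteRate z * (w • ρ) B.1).toReal = w * (siteRate z * ρ B.1).toReal := by
    rw [Measure.smul_apply, ENNReal.smul_def, smul_eq_mul, mul_left_comm, ENNReal.toReal_mul,
      ENNReal.coe_toReal]
  rw [h3, pow_zero, Nat.factorial_zero, Nat.cast_one, mul_one, div_one]

lemma tendsto_siteMass (hK : IsExhaustion K) (hz0 : 0 < z) (hz : z < 1) (hρ : ρ univ = ∞) :
    Tendsto (fun n => (siteRate z * ρ (K n).1).toReal) atTop atTop := by
  have h : Tendsto (fun n => siteRate z * ρ (K n).1) atTop (𝓝 ∞) := by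
    have := ENNReal.Tendsto.const_mul (a := siteRate z) (tendsto_measure_exhaustion hK hρ)
      (Or.inl ENNReal.top_ne_zero)
    rwa [ENNReal.mul_top (siteRate_pos hz0)] at this
  have h2 : ∀ n, siteRate z * ρ (K n).1 =
      ENNReal.ofReal (siteRate z * ρ (K n).1).toReal := fun n =>
    (ENNReal.ofReal_toReal (siteMass_lt_top hz ρ (K n)).ne).symm
  rw [funext h2] at h
  exact ENNReal.tendsto_ofReal_nhds_top.1 h

/-- A Pólya sum process is a mixture of Pólya sum processes in the trivial way only. -/
lemma ae_eq_of_polya_eq_mixture (hK : IsExhaustion K) (hz0 : 0 < z) (hz : z < 1)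
    (hρ : ρ univ = ∞) {w : ℝ≥0} {V : Measure ℝ≥0} [IsProbabilityMeasure V]
    (h : ∀ A, MeasurableSet A → polya z (w • ρ) A = ∫⁻ v, polya z (v • ρ) A ∂V) :
    ∀ᵐ v ∂V, v = w := by
  set c : ℕ → ℝ := fun n => (siteRate z * ρ (K n).1).toReal
  have hc : Tendsto c atTop atTop := tendsto_siteMass hK hz0 hz hρ
  have hvoid : ∀ n, ENNReal.ofReal (Real.exp (-(w * c n))) =
      ∫⁻ v : ℝ≥0, ENNReal.ofReal (Real.exp (-(v * c n))) ∂V := fun n => by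
    have := h _ (measurableSet_xi_eq (K n) (0 : ℕ))
    simp_rw [polya_xi_zero hz] at this
    exact this
  -- Mass of `V` on `[0, a]` with `a < w` would make the mixed void probabilities decay no faster
  -- than `e^{-a c_n}`, against the required `e^{-w c_n}` with `c_n → ∞`.
  have hlt : V (Iio w) = 0 := by
    refine measure_null_of_locally_null _ fun x hx => ?_
    obtain ⟨a, hxa, haw⟩ := exists_between (mem_Iio.1 hx)
    refine ⟨Iic a, mem_nhdsWithin_of_mem_nhds (Iic_mem_nhds hxa), ?_⟩
    have h1 : ∀ n, V (Iic a) ≤ ENNReal.ofReal (Real.exp (-((w - a) * c n))) := fun n => by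
      have hcn : 0 ≤ c n := ENNReal.toReal_nonneg
      have h2 : ENNReal.ofReal (Real.exp (-(a * c n))) * V (Iic a) ≤
          ENNReal.ofReal (Real.exp (-(w * c n))) := by
        rw [hvoid, ← setLIntegral_const]
        refine (setLIntegral_mono' measurableSet_Iic fun v hv => ?_).trans
          (setLIntegral_le_lintegral _ _)
        have hv' : (v : ℝ) ≤ a := hv
        gcongr
      have h3 : ENNReal.ofReal (Real.exp (-(w * c n))) = ENNReal.ofReal (Real.exp (-(a * c n))) *
          ENNReal.ofReal (Real.exp (-((w - a) * c n))) := by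
        rw [← ENNReal.ofReal_mul (Real.exp_nonneg _), ← Real.exp_add]
        congr 2
        ring
      rw [h3] at h2
      exact (ENNReal.mul_le_mul_iff_right (by simp [Real.exp_pos]) ENNReal.ofReal_ne_top).1 h2
    have haw' : (0 : ℝ) < w - a := sub_pos.2 haw
    have h4 : Tendsto (fun n => ENNReal.ofReal (Real.exp (-((w - a) * c n)))) atTop (𝓝 0) := by
      have := ENNReal.tendsto_ofReal (Real.tendsto_exp_neg_atTop_nhds_zero.comp
        (hc.const_mul_atTop haw'))
      simpa using this
    exact le_antisymm (ge_of_tendsto' h4 h1) zero_le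
  obtain ⟨n, hn⟩ := (hc.eventually (eventually_gt_atTop 0)).exists
  -- Now `v ≥ w` almost surely; at a single `n` with `c n > 0` the integrands are ordered and have
  -- equal integrals, hence agree.
  have hle : (fun v : ℝ≥0 => ENNReal.ofReal (Real.exp (-(v * c n)))) ≤ᵐ[V]
      fun _ => ENNReal.ofReal (Real.exp (-(w * c n))) := by
    filter_upwards [measure_eq_zero_iff_ae_notMem.1 hlt] with v hv
    have hv' : (w : ℝ) ≤ v := not_lt.1 hv
    gcongr
  have heq := ae_eq_of_ae_le_of_lintegral_le hle (by rw [← hvoid]; exact ENNReal.ofReal_ne_top)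
    aemeasurable_const (by rw [← hvoid]; simp)
  filter_upwards [heq] with v hv
  rw [ENNReal.ofReal_eq_ofReal_iff (Real.exp_nonneg _) (Real.exp_nonneg _), Real.exp_eq_exp,
    neg_inj] at hv
  exact_mod_cast mul_right_cancel₀ hn.ne' hv

variable [hz : Fact (z < 1)] {P : Measure (PointMeasure X)}

theorem isHSufficient_tail (hK : IsExhaustion K) (hz0 : 0 < z) (hρ : ρ univ = ∞) :
    IsHSufficient (⨅ n, sites (K n)) (invariantLaws sites (siteKernel z ρ)) := by
  have hle := (tail_le hK (K 0)).trans (sites_le _)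
  have hm : Measurable[⨅ n, sites (K n)] fun μ => polya z (density z ρ K μ • ρ) :=
    (measurable_polya ρ hz.out).comp (measurable_density hK)
  have hprob : ∀ μ, IsProbabilityMeasure (polya z (density z ρ K μ • ρ)) := fun μ =>
    isProbabilityMeasure_polya hz.out _
  refine ⟨hle, @Kernel.mk _ _ (⨅ n, sites (K n)) _ _ hm, hprob, fun P hP => ⟨fun A hA => ?_,
    Eventually.of_forall fun μ => polya_mem_invariantLaws _⟩⟩
  have := hP.1
  exact (condExp_indicator_ae_eq_iff hle hA (Measurable.comp (Measure.measurable_coe hA) hm)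
    fun μ => prob_le_one).2 fun S hS => measure_inter_tail hK hz0 hρ hP hA hS

/-- The mixing measure is the law of the density under `P`; the formula is `measure_inter_tail`
integrated over the whole space. -/
lemma exists_mixture (hK : IsExhaustion K) (hz0 : 0 < z) (hρ : ρ univ = ∞)
    (hP : P ∈ invariantLaws sites (siteKernel z ρ)) :
    ∃ V : Measure ℝ≥0, IsProbabilityMeasure V ∧
      ∀ A, MeasurableSet A → P A = ∫⁻ w, polya z (w • ρ) A ∂V := by
  have := hP.1
  have hm : Measurable (density z ρ K) :=
    (measurable_density hK).mono ((tail_le hK (K 0)).trans (sites_le _)) le_rfl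
  refine ⟨P.map (density z ρ K), Measure.isProbabilityMeasure_map hm.aemeasurable,
    fun A hA => ?_⟩
  rw [lintegral_map (f := fun w => polya z (w • ρ) A) ((Measure.measurable_coe hA).comp (measurable_polya ρ hz.out)) hm]
  simpa using measure_inter_tail hK hz0 hρ hP hA MeasurableSet.univ

/-- A tail event lies in every `sites B`, so it can be absorbed into the test set of the averaging
identity. -/
lemma cond_mem_invariantLaws (hK : IsExhaustion K)
    (hP : P ∈ invariantLaws sites (siteKernel z ρ)) {T : Set (PointMeasure X)}
    (hT : MeasurableSet[⨅ n, sites (K n)] T) (hT0 : P T ≠ 0) :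
    ProbabilityTheory.cond P T ∈ invariantLaws sites (siteKernel z ρ) := by
  rw [mem_invariantLaws_iff] at hP ⊢
  have := hP.1
  refine ⟨cond_isProbabilityMeasure hT0, fun B A S hA hS => ?_⟩
  have hTB := tail_le hK B _ hT
  have hT' := sites_le B _ hTB
  have hS' := sites_le B _ hS
  rw [cond_apply hT', ProbabilityTheory.cond, Measure.restrict_smul, lintegral_smul_measure,
    smul_eq_mul, Measure.restrict_restrict hS', ← hP.2 B A _ hA (hS.inter hTB)]
  congr 2
  ext μ
  simp only [mem_inter_iff]
  tauto

/-- Extreme equilibrium laws are trivial on the tail σ-field. -/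
lemma measure_eq_zero_of_mem_extremePoints (hK : IsExhaustion K)
    (hP : P ∈ (invariantLaws sites (siteKernel z ρ)).extremePoints ℝ≥0)
    {T : Set (PointMeasure X)} (hT : MeasurableSet[⨅ n, sites (K n)] T) :
    P T = 0 ∨ P Tᶜ = 0 := by
  have := hP.1.1
  have hT' := sites_le _ _ (tail_le hK (K 0) _ hT)
  by_contra! hne
  -- A nontrivial tail event splits `P` into its two conditional laws, weighted by the probabilities
  -- of `T` and `Tᶜ`.
  have hseg : P ∈ openSegment ℝ≥0 (ProbabilityTheory.cond P T) (ProbabilityTheory.cond P Tᶜ) := by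
    refine ⟨(P T).toNNReal, (P Tᶜ).toNNReal, ENNReal.toNNReal_pos hne.1 (measure_ne_top P _),
      ENNReal.toNNReal_pos hne.2 (measure_ne_top P _), ?_, ?_⟩
    · rw [← ENNReal.toNNReal_add (measure_ne_top P _) (measure_ne_top P _),
        measure_add_measure_compl hT', measure_univ, ENNReal.toNNReal_one]
    · ext A hA
      simp only [Measure.add_apply, Measure.smul_apply, ENNReal.smul_def, smul_eq_mul,
        ENNReal.coe_toNNReal (measure_ne_top P _)]
      rw [mul_comm, mul_comm (P Tᶜ)]
      exact cond_add_cond_compl_eq hT' P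
  have h := hP.2 (cond_mem_invariantLaws hK hP.1 hT hne.1)
    (cond_mem_invariantLaws hK hP.1 hT.compl hne.2) hseg
  refine hne.2 ?_
  rw [prob_compl_eq_zero_iff hT', ← h]
  exact cond_apply_self hne.1 (measure_ne_top P _)

theorem extremePoints_invariantLaws (hK : IsExhaustion K) (hz0 : 0 < z) (hρ : ρ univ = ∞) :
    (invariantLaws sites (siteKernel z ρ)).extremePoints ℝ≥0 =
      {P | ∃ w : ℝ≥0, P = polya z (w • ρ)} := by
  ext P
  constructor
  · intro hP
    have := hP.1.1
    -- The tail is trivial and `ℝ≥0` is countably separated, so the tail measurable density is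
    -- almost surely constant.
    obtain ⟨w, hw⟩ := exists_eventuallyEq_const_of_forall_separating (l := ae P)
      (f := density z ρ K) MeasurableSet fun U hU => by
        rcases measure_eq_zero_of_mem_extremePoints hK hP (measurable_density hK hU) with h | h
        · exact Or.inr (measure_eq_zero_iff_ae_notMem.1 h)
        · exact Or.inl h
    refine ⟨w, Measure.ext fun A hA => ?_⟩
    have h := measure_inter_tail hK hz0 hρ hP.1 hA MeasurableSet.univ
    rw [inter_univ, Measure.restrict_univ] at h
    rw [h, lintegral_congr_ae (g := fun _ => polya z (w • ρ) A)
      (hw.mono fun μ hμ => by simp only [hμ, Function.const_apply]), lintegral_const, measure_univ,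
      mul_one]
  · rintro ⟨w, rfl⟩
    refine ⟨polya_mem_invariantLaws w, ?_⟩
    rintro P₁ hP₁ P₂ hP₂ ⟨a, b, ha, -, hab, hsum⟩
    obtain ⟨V₁, hV₁, h₁⟩ := exists_mixture hK hz0 hρ hP₁
    obtain ⟨V₂, hV₂, h₂⟩ := exists_mixture hK hz0 hρ hP₂
    have hV : IsProbabilityMeasure (a • V₁ + b • V₂) := ⟨by
      simp only [Measure.add_apply, Measure.smul_apply, measure_univ, ENNReal.smul_def,
        smul_eq_mul, mul_one]
      exact_mod_cast hab⟩
    -- The combined mixing measure represents a single Pólya sum process, so it sits at `w`; since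
    -- `a > 0`, so does `V₁`.
    have hae : ∀ᵐ v ∂(a • V₁ + b • V₂), v = w := by
      refine ae_eq_of_polya_eq_mixture hK hz0 hz.out hρ fun A hA => ?_
      rw [← hsum, lintegral_add_measure, lintegral_smul_measure, lintegral_smul_measure,
        ← h₁ A hA, ← h₂ A hA]
      rfl
    have hae₁ : ∀ᵐ v ∂V₁, v = w := by
      have h := (ae_add_measure_iff.1 hae).1
      rw [ae_iff, Measure.smul_apply, ENNReal.smul_def, smul_eq_mul, mul_eq_zero] at h
      exact h.resolve_left (by exact_mod_cast ha.ne')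
    refine Measure.ext fun A hA => ?_
    rw [h₁ A hA, lintegral_congr_ae (g := fun _ => polya z (w • ρ) A)
      (hae₁.mono fun v hv => by simp only [hv]), lintegral_const, measure_univ, mul_one]

end PolyaSum

end

theorem mainTheorem1 {X : Type*} [TopologicalSpace X] [PolishSpace X] [MeasurableSpace X]
    [BorelSpace X] [Bornology X]
    (Bk : ℕ → PolyaSum.BoundedBorel X) (hBk_mono : ∀ m n, m ≤ n → (Bk m).1 ⊆ (Bk n).1)
    (hBk_union : ⋃ n, (Bk n).1 = univ)
    (hBk_cofinal : ∀ B : PolyaSum.BoundedBorel X, ∃ n, B.1 ⊆ (Bk n).1)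
    (z : ℝ) (hz0 : 0 < z) (hz1 : z < 1)
    (ρ : Measure X) (hρ_locFin : ∀ B : PolyaSum.BoundedBorel X, ρ B.1 < ∞)
    (hρ_diffuse : ∀ x, ρ {x} = 0) (hρ_infinite : ρ univ = ∞) :
    -- the Pólya sum processes are the unique solutions of their Campbell equations
    (∀ (w : ℝ≥0) (P : Measure (PolyaSum.PointMeasure X)),
      PolyaSum.IsPolyaSumProcess z (w • ρ) P ↔ P = PolyaSum.polya z (w • ρ)) ∧
    -- the conditional kernels form a local specification
    PolyaSum.IsLocalSpecification PolyaSum.sites (PolyaSum.siteKernel z ρ)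
      (fun B => {μ | PolyaSum.polya z ρ {ν | PolyaSum.xi B ν = PolyaSum.xi B μ} = 0}) ∧
    -- the tail σ-field is H-sufficient
    PolyaSum.IsHSufficient (⨅ n, PolyaSum.sites (Bk n))
      (PolyaSum.invariantLaws PolyaSum.sites (PolyaSum.siteKernel z ρ)) ∧
    -- the invariant laws are the mixed Pólya sum processes
    PolyaSum.invariantLaws PolyaSum.sites (PolyaSum.siteKernel z ρ) =
      {P | ∃ V : Measure ℝ≥0, IsProbabilityMeasure V ∧
        ∀ A, MeasurableSet A → P A = ∫⁻ w, PolyaSum.polya z (w • ρ) A ∂V} ∧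
    -- the extreme points are the Pólya sum processes
    (PolyaSum.invariantLaws PolyaSum.sites (PolyaSum.siteKernel z ρ)).extremePoints ℝ≥0 =
      {P | ∃ w : ℝ≥0, P = PolyaSum.polya z (w • ρ)} := by
  have : PolyaSum.SigmaBounded X := ⟨⟨Bk, hBk_mono, hBk_union, hBk_cofinal⟩⟩
  have : PolyaSum.IsDiffuse ρ := ⟨hρ_locFin, hρ_diffuse⟩
  have : Fact (z < 1) := ⟨hz1⟩
  have hK : PolyaSum.IsExhaustion Bk := ⟨hBk_mono, hBk_union, hBk_cofinal⟩
  refine ⟨fun w => PolyaSum.isPolyaSumProcess_iff hz1 (w • ρ),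
    PolyaSum.isLocalSpecification_siteKernel hz1 ρ,
    PolyaSum.isHSufficient_tail hK hz0 hρ_infinite, ?_,
    PolyaSum.extremePoints_invariantLaws hK hz0 hρ_infinite⟩
  ext P
  constructor
  · exact fun hP => PolyaSum.exists_mixture hK hz0 hρ_infinite hP
  · rintro ⟨V, hV, hP⟩
    exact PolyaSum.mixture_mem_invariantLaws V hP
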